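/- **Model.** Let $L,r\ge 1$, $0\le m_0\le m<rL$, $q\in(0,1)$, $\alpha\in(0,1)$, $\mu\in\mathbb R$, $|\rho|<1$, $\sigma_u>0$, and set $n=rL-m$, $p=p(r;q)=q^r/(q^r+(1-q)^r)$. Block assignments $W^{(1)},W^{(2)},\dots$ are i.i.d. Bernoulli$(q)$, and $W_t=W^{(k)}$ for $t\in\{(k-1)L+1,\dots,kL\}$. Outcomes are $$Y_t=\mu+\sum_{\ell=0}^{m_0}\beta_\ell W_{t-\ell}+\varepsilon_t,\qquad \varepsilon_t=\rho\,\varepsilon_{t-1}+u_t,$$ where $(\varepsilon_t)$ is a stationary mean-zero AR(1) process, independent of the assignments, with i.i.d. innovations $u_t$ of mean $0$ and variance $\sigma_u^2$. Put $\tau_{\rm tot}=\sum_{\ell=0}^{m_0}\beta_\ell$. **Test.** With $J$ pooled sections, section $j$ consists of blocks $(j-1)r+1,\dots,jr$. It is usable if all its block assignments agree; $Z_j$ is then their common value. $\mathcal J$ is the set of usable sections, $J_{\rm tot}=|\mathcal J|$, and $\bar Y_j$ is the mean outcome over the last $n$ periods of section $j$. Let $$\hat\tau=\frac1{J_{\rm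 tot}}\sum_{j\in\mathcal J}\Big(\frac{Z_j\bar Y_j}{p}-\frac{(1-Z_j)\bar Y_j}{1-p}\Big),\quad \hat V=\frac1{J_{\rm tot}^2}\sum_{j\in\mathcal J}\bar Y_j^2\Big(\frac{Z_j}{p^2}+\frac{1-Z_j}{(1-p)^2}\Big),\quad T_{\rm tot}=\frac{\hat\tau}{\sqrt{\hat V}},$$ with the convention $0/0=0$. Let $T^*_{\rm tot}$ be the same statistic with the labels replaced by independent Bernoulli$(p)$ labels $Z_j^*$, $j\in\mathcal J$, while $\mathcal J$ and the $\bar Y_j$ are held fixed, and let $c_{1-\alpha}$ be the $(1-\alpha)$-quantile of this conditional randomization distribution. The one-sided level-$\alpha$ conditional randomization test $\varphi_{\rm tot}$ rejects ($\varphi_{\rm tot}=1$) when $T_{\rm tot}\ge c_{1-\alpha}$. **Claim.** Let $$s=\sigma^2_{\bar\varepsilon}(n,\rho)=\mathrm{Var}\Big(\frac1n\sum_{i=1}^n\varepsilon_i\Big)=\frac{\sigma_u^2}{(1-\rho^2)n^2}\Big[n+2\sum_{h=1}^{n-1}(n-h)\rho^h\Big]$$ (the last equality being part of the claim), and $$\mu_{\rm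 tot}(k)=\frac{\tau_{\rm tot}\sqrt k}{\sqrt{\frac{s}{p(1-p)}+\frac{(\mu+\tau_{\rm tot})^2}{p}+\frac{\mu^2}{1-p}}},\qquad \sigma_{\rm tot}^2=\frac{s+\{\mu+(1-p)\tau_{\rm tot}\}^2}{s+p\mu^2+(1-p)(\mu+\tau_{\rm tot})^2}.$$ Let $\Phi$ be the standard normal distribution function and $z_{1-\alpha}$ its $(1-\alpha)$-quantile. Then: 1. Conditional on $J_{\rm tot}=k$, $$\mathbb P(\varphi_{\rm tot}=1\mid J_{\rm tot}=k)-\Big[1-\Phi\Big(\frac{z_{1-\alpha}-\mu_{\rm tot}(k)}{\sigma_{\rm tot}}\Big)\Big]\longrightarrow 0\qquad(k\to\infty),$$ uniformly over all lag coefficients $\beta_0,\dots,\beta_{m_0}$ and all $J$ with $\mathbb P(J_{\rm tot}=k)>0$. Moreover, along any sequence of lag coefficients $\beta^{(J)}$, this difference evaluated at $k=J_{\rm tot}$ tends to $0$ in probability as $J\to\infty$. Both statements also hold for the $p$-value form of the test, which rejects when the conditional randomization probability of $T_{\rm tot}^*\ge T_{\rm tot}$ is at most $\alpha$. 2. $0<\sigma_{\rm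 tot}^2\le1$ for every value of $\tau_{\rm tot}$, and $\sigma_{\rm tot}^2\to1$ as $\tau_{\rm tot}\to0$. -/

import Mathlib

open MeasureTheory ProbabilityTheory Filter Topology

namespace Switchback

noncomputable section

/-- The number `1` for `true` (treatment) and `0` for `false` (control). -/
def ind (b : Bool) : ℝ := if b then 1 else 0

/-! ### Design: blocks `B_k = {(k-1)L+1, …, kL}`, pooled sections of `r` consecutive blocks.
Blocks, sections and time points are numbered from `1`. -/

/-- The treatment path `W_t`, constant on each block: time `t ≥ 1` lies in block
`(t-1)/L + 1`.  There is no treatment before time `1`, coded as the value `0` at time `0`; this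
is never used in the focal outcomes below. -/
def path (L : ℕ) (w : ℕ → Bool) (t : ℕ) : ℝ :=
  if t = 0 then 0 else ind (w ((t - 1) / L + 1))

/-- The indices of the blocks that form pooled section `j`. -/
def sectionBlocks (r j : ℕ) : Finset ℕ := Finset.Icc ((j - 1) * r + 1) (j * r)

/-- The event `E_j`: pooled section `j` is constant. -/
def IsConst (r : ℕ) (w : ℕ → Bool) (j : ℕ) : Prop :=
  ∀ k ∈ sectionBlocks r j, ∀ k' ∈ sectionBlocks r j, w k = w k'

open Classical in
/-- The set of usable (constant) pooled sections among the sections `1, …, J`. -/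
def usable (r J : ℕ) (w : ℕ → Bool) : Finset ℕ :=
  (Finset.Icc 1 J).filter (IsConst r w)

/-- The label `Z_j` of a pooled section: the assignment of its first block, which on `E_j` is the
common value of all its blocks. -/
def label (r : ℕ) (w : ℕ → Bool) (j : ℕ) : Bool := w ((j - 1) * r + 1)

/-- The number `J_tot` of usable pooled sections. -/
def numUsable (r J : ℕ) (w : ℕ → Bool) : ℕ := (usable r J w).card

/-- `p(r;q) = q^r / (q^r + (1-q)^r)`. -/
def pooledProb (r : ℕ) (q : ℝ) : ℝ := q ^ r / (q ^ r + (1 - q) ^ r)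

/-- The focal time points of section `j`: its last `rL - m` periods. -/
def focal (L r m j : ℕ) : Finset ℕ := Finset.Icc ((j - 1) * (r * L) + 1 + m) (j * (r * L))

/-! ### Outcomes -/

/-- The distributed-lag potential outcome
`Y_t(w) = μ + ∑_{ℓ=0}^{m₀} β_ℓ w_{t-ℓ} + ε_t` at a treatment path `x` and error path `e`
(truncated subtraction sends all periods before the first one to `0`). -/
def outcome (m₀ : ℕ) (μ : ℝ) (β : ℕ → ℝ) (e : ℤ → ℝ) (x : ℕ → ℝ) (t : ℕ) : ℝ :=
  μ + ∑ l ∈ Finset.range (m₀ + 1), β l * x (t - l) + e (t : ℤ)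

/-- The observed focal mean of section `j`. -/
def focalMean (L r m m₀ : ℕ) (μ : ℝ) (β : ℕ → ℝ) (w : ℕ → Bool) (e : ℤ → ℝ) (j : ℕ) : ℝ :=
  (∑ t ∈ focal L r m j, outcome m₀ μ β e (path L w) t) / ((r * L - m : ℕ) : ℝ)

/-- The total long-run effect `τ_tot = ∑_{ℓ=0}^{m₀} β_ℓ`. -/
def tauTot (m₀ : ℕ) (β : ℕ → ℝ) : ℝ := ∑ l ∈ Finset.range (m₀ + 1), β l

/-! ### The studentized statistic and its randomization distribution, as functions of the
set `S` of usable sections, the section means `y` and the section labels `z` -/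

/-- Horvitz–Thompson estimator. -/
def htEst (p : ℝ) (S : Finset ℕ) (y : ℕ → ℝ) (z : ℕ → Bool) : ℝ :=
  (1 / (S.card : ℝ)) *
    ∑ j ∈ S, (ind (z j) * y j / p - (1 - ind (z j)) * y j / (1 - p))

/-- Upper-bound variance estimator. -/
def vUp (p : ℝ) (S : Finset ℕ) (y : ℕ → ℝ) (z : ℕ → Bool) : ℝ :=
  (1 / (S.card : ℝ) ^ 2) *
    ∑ j ∈ S, y j ^ 2 * (ind (z j) / p ^ 2 + (1 - ind (z j)) / (1 - p) ^ 2)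

/-- Studentized statistic. -/
def tStat (p : ℝ) (S : Finset ℕ) (y : ℕ → ℝ) (z : ℕ → Bool) : ℝ :=
  htEst p S y z / √(vUp p S y z)

open Classical in
/-- The probability that `T* := tStat p S y Z*` satisfies `C` when the labels `Z*_j`, `j ∈ S`, are
independent Bernoulli(`p`) and `y` is held fixed: a sum over the set `A` of sections that are
relabelled as treated. -/
def randProb (p : ℝ) (S : Finset ℕ) (y : ℕ → ℝ) (C : ℝ → Prop) : ℝ :=
  ∑ A ∈ S.powerset, p ^ A.card * (1 - p) ^ (S.card - A.card) *
    (if C (tStat p S y (fun j => decide (j ∈ A))) then 1 else 0)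

/-- The `a`-quantile `inf {t | F t ≥ a}` of a distribution function. -/
def quantile (F : ℝ → ℝ) (a : ℝ) : ℝ := sInf {t | a ≤ F t}

/-- The critical value: the `(1-α)`-quantile of the randomization distribution. -/
def critValue (p α : ℝ) (S : Finset ℕ) (y : ℕ → ℝ) : ℝ :=
  quantile (fun t => randProb p S y (fun s => s ≤ t)) (1 - α)

/-- The statistic `T_tot` of the experiment with `J` pooled sections. -/
def tTot (L r m m₀ J : ℕ) (q μ : ℝ) (β : ℕ → ℝ) (w : ℕ → Bool) (e : ℤ → ℝ) : ℝ :=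
  tStat (pooledProb r q) (usable r J w) (focalMean L r m m₀ μ β w e) (label r w)

/-- The one-sided conditional randomization test rejects: `T_tot ≥ c_{1-α}`. -/
def Rejects (L r m m₀ J : ℕ) (q μ α : ℝ) (β : ℕ → ℝ) (w : ℕ → Bool) (e : ℤ → ℝ) : Prop :=
  critValue (pooledProb r q) α (usable r J w) (focalMean L r m m₀ μ β w e)
    ≤ tTot L r m m₀ J q μ β w e

/-- The same test in its `p`-value form: the randomization probability of `T* ≥ T_tot` is at most
`α`.  It differs from `Rejects` only when `T_tot` is exactly the critical value. -/
def RejectsPval (L r m m₀ J : ℕ) (q μ α : ℝ) (β : ℕ → ℝ) (w : ℕ → Bool) (e : ℤ → ℝ) : Prop :=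
  randProb (pooledProb r q) (usable r J w) (focalMean L r m m₀ μ β w e)
    (fun s => tTot L r m m₀ J q μ β w e ≤ s) ≤ α

/-! ### Limiting quantities -/

/-- The closed form of `σ²_ε̄(n,ρ)`, with `σ_ε² = σ_u²/(1-ρ²)`. -/
def ar1MeanVar (σu ρ : ℝ) (n : ℕ) : ℝ :=
  (σu ^ 2 / (1 - ρ ^ 2)) / (n : ℝ) ^ 2 *
    ((n : ℝ) + 2 * ∑ h ∈ Finset.Ico 1 n, ((n : ℝ) - (h : ℝ)) * ρ ^ h)

/-- `μ_tot(k)`, where `s` is the variance of a section mean of the errors. -/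
def muTot (s p μ τ : ℝ) (k : ℕ) : ℝ :=
  τ * √(k : ℝ) / √(s / (p * (1 - p)) + (μ + τ) ^ 2 / p + μ ^ 2 / (1 - p))

/-- `σ_tot²`. -/
def sigmaTotSq (s p μ τ : ℝ) : ℝ :=
  (s + (μ + (1 - p) * τ) ^ 2) / (s + p * μ ^ 2 + (1 - p) * (μ + τ) ^ 2)

/-- The standard normal distribution function `Φ`. -/
def Phi (x : ℝ) : ℝ := cdf (gaussianReal 0 1) x

/-- `1 - Φ((z_{1-α} - μ_tot(k))/σ_tot)`. -/
def powerApprox (s p μ τ α : ℝ) (k : ℕ) : ℝ :=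
  1 - Phi ((quantile Phi (1 - α) - muTot s p μ τ k) / √(sigmaTotSq s p μ τ))

/-! ### The probabilistic model -/

/-- Regular switchback design: the block assignments are independent Bernoulli(`q`). -/
structure IsDesign {Ω : Type*} [MeasurableSpace Ω] (P : Measure Ω) (q : ℝ)
    (W : ℕ → Ω → Bool) : Prop where
  measurable : ∀ k, Measurable (W k)
  indep : iIndepFun W P
  prob : ∀ k, P.real {ω | W k ω = true} = q

/-- `ε` is a (wide-sense) stationary mean-zero AR(1) process `ε_t = ρ ε_{t-1} + u_t` whose
innovations `u_t` are i.i.d. with mean `0` and variance `σu²`.  With the recursion on all of `ℤ`,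
i.i.d. innovations and `|ρ| < 1`, wide-sense and strict stationarity are equivalent. -/
structure IsStationaryAR1 {Ω : Type*} [MeasurableSpace Ω] (P : Measure Ω) (ρ σu : ℝ)
    (u ε : ℤ → Ω → ℝ) : Prop where
  measurable : ∀ t, Measurable (ε t)
  innov_measurable : ∀ t, Measurable (u t)
  innov_indep : iIndepFun u P
  innov_ident : ∀ t, IdentDistrib (u t) (u 0) P P
  innov_memLp : MemLp (u 0) 2 P
  innov_mean : P[u 0] = 0
  innov_var : Var[u 0; P] = σu ^ 2
  recursion : ∀ t, ∀ᵐ ω ∂P, ε t ω = ρ * ε (t - 1) ω + u t ω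
  memLp : ∀ t, MemLp (ε t) 2 P
  mean : ∀ t, P[ε t] = 0
  stationary : ∀ s t h, cov[ε (s + h), ε (t + h); P] = cov[ε s, ε t; P]

/-- Power given `J_tot = k`: the conditional probability, given that exactly `k` of the `J` pooled
sections are usable, that the assignments and errors satisfy `R`. -/
def condPower {Ω : Type*} [MeasurableSpace Ω] (P : Measure Ω) (W : ℕ → Ω → Bool)
    (ε : ℤ → Ω → ℝ) (r J k : ℕ) (R : (ℕ → Bool) → (ℤ → ℝ) → Prop) : ℝ :=
  (ProbabilityTheory.cond P {ω | numUsable r J (fun i => W i ω) = k}).real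
    {ω | R (fun i => W i ω) (fun t => ε t ω)}

end

end Switchback

namespace Switchback

/-! ### Expectations over a Bernoulli(`p`) random subset -/

/-! Since `m₀ ≤ m`, every lag entering a focal outcome of a usable section stays inside that
section. The section mean is therefore `μ + errMean j + τ * Z_j`, a baseline `x j` plus `τ = tauTot
m₀ β` times the label (`focalMean_eq_shift`). Given the set `S` of usable sections, the labels are
independent Bernoulli(`p`) and independent of the errors (`measureReal_usable_inter`). The power is
thus an average over the errors of a probability over a random subset `A ⊆ S`, and the main work is
done for fixed numbers `x j`.

The only requirement on `x` is `Balanced`: the average of `x j ^ 2` is close to `s + μ ^ 2`, and no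
term is comparable to `√k`, where `k = S.card`. `errMean_balanced` shows that this has high
probability, with a bound depending on `S` only through its size. The proof approximates the AR(1)
section means in `L²` by bounded variables with finite range of dependence.

Uniformity in the effect comes from splitting at `|τ| * √k = H`. For `|τ| * √k ≤ H`, a
Lindeberg-type central limit theorem (`clt_htSum`) and Chebyshev bounds for the studentizing
denominator give a normal limit with unit variance and mean `τ√k / √((s + μ²)/(p(1-p)))`
(`tStat_shift_clt`). The observed means remain balanced under such a small effect, so the same
theorem with zero effect makes the randomization law standard normal and pins the critical value to
the normal quantile (`power_local`). There `τ → 0`, so `sigmaTotSq` tends to `1` and the denominator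
of `muTot` to its value at `0` (`powerApprox_local`).

For larger `|τ| * √k` both sides are saturated. The randomization law has second moment at most
`1/(p(1-p))` whatever the outcomes are (`bexp_tStat_sq_le`), while the observed statistic is large
with the sign of `τ` (`tStat_distant`). The power and `powerApprox` are then both near `1` or both
near `0`. Hence `sigmaTotSq` can differ appreciably from `1` only where it has no influence on the
limit, and uniformity needs no sharper analysis at fixed effects.

Both forms of the test are treated together: rejection by `p`-value implies rejection by critical
value, so a lower bound for the former and an upper bound for the latter suffice. -/

/-- Expectation of `f A`, where `A ⊆ S` contains each `j ∈ S` independently with probability `p`. -/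
noncomputable def bexp (p : ℝ) (S : Finset ℕ) (f : Finset ℕ → ℝ) : ℝ :=
  ∑ A ∈ S.powerset, p ^ A.card * (1 - p) ^ (S.card - A.card) * f A

open Classical in
/-- Probability that a Bernoulli(`p`) random subset of `S` satisfies `C`. -/
noncomputable def bprob (p : ℝ) (S : Finset ℕ) (C : Finset ℕ → Prop) : ℝ :=
  bexp p S (fun A => if C A then 1 else 0)

theorem bexp_congr {p : ℝ} {S : Finset ℕ} {f g : Finset ℕ → ℝ} (h : ∀ A ⊆ S, f A = g A) :
    bexp p S f = bexp p S g :=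
  Finset.sum_congr rfl fun A hA => by rw [h A (Finset.mem_powerset.1 hA)]

theorem bexp_add (p : ℝ) (S : Finset ℕ) (f g : Finset ℕ → ℝ) :
    bexp p S (fun A => f A + g A) = bexp p S f + bexp p S g := by
  simp only [bexp, mul_add, Finset.sum_add_distrib]

theorem bexp_mul_left (p : ℝ) (S : Finset ℕ) (c : ℝ) (f : Finset ℕ → ℝ) :
    bexp p S (fun A => c * f A) = c * bexp p S f := by
  simp only [bexp, Finset.mul_sum]
  exact Finset.sum_congr rfl fun A _ => by ring

theorem bexp_sub (p : ℝ) (S : Finset ℕ) (f g : Finset ℕ → ℝ) :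
    bexp p S (fun A => f A - g A) = bexp p S f - bexp p S g := by
  simp only [bexp, mul_sub, Finset.sum_sub_distrib]

theorem bexp_insert (p : ℝ) {S : Finset ℕ} {a : ℕ} (ha : a ∉ S) (f : Finset ℕ → ℝ) :
    bexp p (insert a S) f
      = p * bexp p S (fun A => f (insert a A)) + (1 - p) * bexp p S f := by
  unfold bexp
  rw [Finset.sum_powerset_insert ha, add_comm, Finset.mul_sum, Finset.mul_sum]
  congr 1
  · refine Finset.sum_congr rfl fun A hA => ?_
    have hA' := Finset.mem_powerset.1 hA
    rw [Finset.card_insert_of_notMem ha, Finset.card_insert_of_notMem (fun h => ha (hA' h)),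
      Nat.add_sub_add_right]
    ring
  · refine Finset.sum_congr rfl fun A hA => ?_
    have hA' := Finset.card_le_card (Finset.mem_powerset.1 hA)
    rw [Finset.card_insert_of_notMem ha, Nat.succ_sub hA', pow_succ]
    ring

theorem bexp_const (p : ℝ) (S : Finset ℕ) (c : ℝ) : bexp p S (fun _ => c) = c := by
  induction S using Finset.induction_on with
  | empty => simp [bexp]
  | insert a S ha ih => rw [bexp_insert p ha, ih]; ring

theorem bexp_mono {p : ℝ} (hp0 : 0 ≤ p) (hp1 : p ≤ 1) {S : Finset ℕ} {f g : Finset ℕ → ℝ}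
    (h : ∀ A ⊆ S, f A ≤ g A) : bexp p S f ≤ bexp p S g := by
  have : 0 ≤ 1 - p := by linarith
  exact Finset.sum_le_sum fun A hA =>
    mul_le_mul_of_nonneg_left (h A (Finset.mem_powerset.1 hA)) (by positivity)

theorem decide_mem_insert_of_ne {A : Finset ℕ} {a j : ℕ} (h : j ≠ a) :
    decide (j ∈ insert a A) = decide (j ∈ A) := by
  simp [h]

theorem sum_decide_insert {S A : Finset ℕ} {a : ℕ} (ha : a ∉ S) (ξ : ℕ → Bool → ℝ) :
    ∑ j ∈ S, ξ j (decide (j ∈ insert a A)) = ∑ j ∈ S, ξ j (decide (j ∈ A)) :=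
  Finset.sum_congr rfl fun j hj => by
    rw [decide_mem_insert_of_ne (fun h : j = a => ha (h ▸ hj))]

/-- Second moment of a sum of independent centred terms. -/
theorem bexp_sq_sum (p : ℝ) (S : Finset ℕ) (ξ : ℕ → Bool → ℝ)
    (h : ∀ j ∈ S, p * ξ j true + (1 - p) * ξ j false = 0) (c : ℝ) :
    bexp p S (fun A => (c + ∑ j ∈ S, ξ j (decide (j ∈ A))) ^ 2)
      = c ^ 2 + ∑ j ∈ S, (p * ξ j true ^ 2 + (1 - p) * ξ j false ^ 2) := by
  -- The constant `c` is generalized so that each of the two values of the new term can be absorbed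
  -- into it; the cross term `2 * c * E ξ` vanishes by centring.
  induction S using Finset.induction_on generalizing c with
  | empty => simp [bexp]
  | insert a S ha ih =>
    rw [bexp_insert p ha]
    simp only [Finset.sum_insert ha, sum_decide_insert ha]
    have h1 : bexp p S (fun A => (c + (ξ a (decide (a ∈ insert a A)) +
        ∑ j ∈ S, ξ j (decide (j ∈ A)))) ^ 2) = bexp p S (fun A => ((c + ξ a true) +
        ∑ j ∈ S, ξ j (decide (j ∈ A))) ^ 2) := bexp_congr fun A _ => by simp [add_assoc]
    have h2 : bexp p S (fun A => (c + (ξ a (decide (a ∈ A)) +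
        ∑ j ∈ S, ξ j (decide (j ∈ A)))) ^ 2) = bexp p S (fun A => ((c + ξ a false) +
        ∑ j ∈ S, ξ j (decide (j ∈ A))) ^ 2) := by
      refine bexp_congr fun A hA => ?_
      have : a ∉ A := fun h => ha (hA h)
      simp [this, add_assoc]
    have h3 := h a (Finset.mem_insert_self _ _)
    have hS : ∀ j ∈ S, p * ξ j true + (1 - p) * ξ j false = 0 :=
      fun j hj => h j (Finset.mem_insert_of_mem hj)
    rw [h1, h2, ih hS, ih hS]
    linear_combination 2 * c * h3

theorem bprob_le_bexp {p : ℝ} (hp0 : 0 ≤ p) (hp1 : p ≤ 1) {S : Finset ℕ}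
    {C : Finset ℕ → Prop} {f : Finset ℕ → ℝ} (hf : ∀ A ⊆ S, 0 ≤ f A)
    (h : ∀ A ⊆ S, C A → 1 ≤ f A) : bprob p S C ≤ bexp p S f := by
  refine bexp_mono hp0 hp1 fun A hA => ?_
  split_ifs with hC
  · exact h A hA hC
  · exact hf A hA

theorem bprob_mono {p : ℝ} (hp0 : 0 ≤ p) (hp1 : p ≤ 1) {S : Finset ℕ}
    {C D : Finset ℕ → Prop} (h : ∀ A ⊆ S, C A → D A) : bprob p S C ≤ bprob p S D := by
  refine bprob_le_bexp hp0 hp1 (fun A _ => by split_ifs <;> simp) fun A hA hC => ?_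
  rw [if_pos (h A hA hC)]

theorem bprob_congr {p : ℝ} {S : Finset ℕ} {C D : Finset ℕ → Prop}
    (h : ∀ A ⊆ S, (C A ↔ D A)) : bprob p S C = bprob p S D :=
  bexp_congr fun A hA => by have := h A hA; by_cases hC : C A <;> simp_all

theorem bprob_nonneg {p : ℝ} (hp0 : 0 ≤ p) (hp1 : p ≤ 1) (S : Finset ℕ)
    (C : Finset ℕ → Prop) : 0 ≤ bprob p S C := by
  rw [← bexp_const p S 0]
  exact bexp_mono hp0 hp1 fun A _ => by split_ifs <;> simp

theorem bprob_not (p : ℝ) (S : Finset ℕ) (C : Finset ℕ → Prop) :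
    bprob p S (fun A => ¬ C A) = 1 - bprob p S C := by
  rw [← bexp_const p S 1, bprob, bprob, ← bexp_sub]
  exact bexp_congr fun A _ => by by_cases h : C A <;> simp [h]

theorem bprob_le_one {p : ℝ} (hp0 : 0 ≤ p) (hp1 : p ≤ 1) (S : Finset ℕ)
    (C : Finset ℕ → Prop) : bprob p S C ≤ 1 := by
  have := bprob_nonneg hp0 hp1 S (fun A => ¬ C A)
  rw [bprob_not] at this; linarith

theorem bprob_le_add {p : ℝ} (hp0 : 0 ≤ p) (hp1 : p ≤ 1) {S : Finset ℕ}
    {C D E : Finset ℕ → Prop} (h : ∀ A ⊆ S, C A → D A ∨ E A) :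
    bprob p S C ≤ bprob p S D + bprob p S E := by
  rw [bprob, bprob, bprob, ← bexp_add]
  refine bexp_mono hp0 hp1 fun A hA => ?_
  have := h A hA
  by_cases h1 : C A <;> by_cases h2 : D A <;> by_cases h3 : E A <;> simp_all

/-- Chebyshev's inequality. -/
theorem bprob_le_sq_div {p : ℝ} (hp0 : 0 ≤ p) (hp1 : p ≤ 1) {S : Finset ℕ}
    {C : Finset ℕ → Prop} {f : Finset ℕ → ℝ} {t : ℝ} (ht : 0 < t)
    (h : ∀ A ⊆ S, C A → t ≤ |f A|) :
    bprob p S C ≤ bexp p S (fun A => f A ^ 2) / t ^ 2 := by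
  rw [div_eq_inv_mul, ← bexp_mul_left]
  refine bprob_le_bexp hp0 hp1 (fun A _ => by positivity) fun A hA hC => ?_
  rw [← sq_abs (f A), inv_mul_eq_div, one_le_div (by positivity)]
  exact pow_le_pow_left₀ ht.le (h A hA hC) 2

/-! ### The studentized statistic -/

/-- Horvitz–Thompson weight of a section with label `b`. -/
noncomputable def htWeight (p : ℝ) (b : Bool) : ℝ := ind b / p - (1 - ind b) / (1 - p)

theorem htWeight_true (p : ℝ) : htWeight p true = 1 / p := by simp [htWeight, ind]

theorem htWeight_false (p : ℝ) : htWeight p false = -(1 / (1 - p)) := by simp [htWeight, ind]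

theorem htWeight_mean {p : ℝ} (hp0 : 0 < p) (hp1 : p < 1) :
    p * htWeight p true + (1 - p) * htWeight p false = 0 := by
  have : 1 - p ≠ 0 := by linarith
  rw [htWeight_true, htWeight_false]; field_simp; ring

theorem htWeight_sq_mean {p : ℝ} (hp0 : 0 < p) (hp1 : p < 1) :
    p * htWeight p true ^ 2 + (1 - p) * htWeight p false ^ 2 = 1 / (p * (1 - p)) := by
  have : 1 - p ≠ 0 := by linarith
  rw [htWeight_true, htWeight_false]; field_simp; ring

theorem one_le_htWeight_sq {p : ℝ} (hp0 : 0 < p) (hp1 : p < 1) (b : Bool) :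
    1 ≤ htWeight p b ^ 2 := by
  have h1 : 0 < 1 - p := by linarith
  cases b
  · rw [htWeight_false, neg_sq]
    exact one_le_pow₀ (by rw [le_div_iff₀ h1]; linarith)
  · rw [htWeight_true]
    exact one_le_pow₀ (by rw [le_div_iff₀ hp0]; linarith)

/-- Unnormalized Horvitz–Thompson sum. -/
noncomputable def htSum (p : ℝ) (S : Finset ℕ) (y : ℕ → ℝ) (z : ℕ → Bool) : ℝ :=
  ∑ j ∈ S, htWeight p (z j) * y j

/-- Sum of squares of the Horvitz–Thompson terms. -/
noncomputable def htSqSum (p : ℝ) (S : Finset ℕ) (y : ℕ → ℝ) (z : ℕ → Bool) : ℝ :=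
  ∑ j ∈ S, htWeight p (z j) ^ 2 * y j ^ 2

theorem htSqSum_nonneg (p : ℝ) (S : Finset ℕ) (y : ℕ → ℝ) (z : ℕ → Bool) :
    0 ≤ htSqSum p S y z := Finset.sum_nonneg fun _ _ => by positivity

/-- An indicator times its complement is zero, so `vUp` is a sum of squared Horvitz–Thompson terms,
and the factors `1 / S.card` cancel. For empty `S` both sides are `0 / 0 = 0`. -/
theorem tStat_eq (p : ℝ) (S : Finset ℕ) (y : ℕ → ℝ) (z : ℕ → Bool) :
    tStat p S y z = htSum p S y z / √(htSqSum p S y z) := by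
  have h1 : htEst p S y z = (1 / (S.card : ℝ)) * htSum p S y z := by
    unfold htEst htSum htWeight
    congr 1
    exact Finset.sum_congr rfl fun j _ => by ring
  have h2 : vUp p S y z = (1 / (S.card : ℝ)) ^ 2 * htSqSum p S y z := by
    unfold vUp htSqSum htWeight
    rw [one_div_pow]
    congr 1
    refine Finset.sum_congr rfl fun j _ => ?_
    cases z j <;> simp [ind] <;> ring
  rw [tStat, h1, h2, Real.sqrt_mul (by positivity), Real.sqrt_sq (by positivity)]
  rcases S.eq_empty_or_nonempty with rfl | hS
  · simp [htSum]
  · have : (S.card : ℝ) ≠ 0 := by simpa using hS.ne_empty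
    rw [mul_div_mul_left _ _ (by positivity)]

theorem tStat_congr {p : ℝ} {S : Finset ℕ} {y y' : ℕ → ℝ} {z z' : ℕ → Bool}
    (hy : ∀ j ∈ S, y j = y' j) (hz : ∀ j ∈ S, z j = z' j) :
    tStat p S y z = tStat p S y' z' := by
  rw [tStat_eq, tStat_eq]
  have h1 : htSum p S y z = htSum p S y' z' :=
    Finset.sum_congr rfl fun j hj => by rw [hy j hj, hz j hj]
  have h2 : htSqSum p S y z = htSqSum p S y' z' :=
    Finset.sum_congr rfl fun j hj => by rw [hy j hj, hz j hj]
  rw [h1, h2]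

theorem randProb_congr {p : ℝ} {S : Finset ℕ} {y y' : ℕ → ℝ} (hy : ∀ j ∈ S, y j = y' j)
    (C : ℝ → Prop) : randProb p S y C = randProb p S y' C := by
  refine bprob_congr fun A _ => ?_
  rw [tStat_congr hy (fun _ _ => rfl)]

/-- The critical value is at most `t` exactly when the distribution function at `t` is at least
`1 - α`. -/
theorem critValue_le_iff {p α : ℝ} (hp0 : 0 < p) (hp1 : p < 1) (hα0 : 0 < α) (hα1 : α < 1)
    (S : Finset ℕ) (y : ℕ → ℝ) (t : ℝ) :
    critValue p α S y ≤ t ↔ 1 - α ≤ randProb p S y (fun s => s ≤ t) := by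
  classical
  set F : ℝ → ℝ := fun t => randProb p S y (fun s => s ≤ t) with hF
  set T : Finset ℕ → ℝ := fun A => tStat p S y (fun j => decide (j ∈ A)) with hT
  have hmono : Monotone F := fun a b hab =>
    bprob_mono hp0.le hp1.le fun A _ h => le_trans h hab
  -- The bound `M` makes the set under `sInf` nonempty and bounded below; otherwise `sInf` would
  -- take the default value `0`.
  obtain ⟨M, hM⟩ : ∃ M : ℝ, ∀ A ∈ S.powerset, |T A| < M := by
    refine ⟨∑ A ∈ S.powerset, |T A| + 1, fun A hA => ?_⟩
    have := Finset.single_le_sum (f := fun A => |T A|) (fun _ _ => abs_nonneg _) hA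
    linarith
  have hne : F M = 1 := by
    rw [← bexp_const p S 1]
    refine bexp_congr fun A hA => if_pos ?_
    exact (le_abs_self _).trans (hM A (Finset.mem_powerset.2 hA)).le
  have hbd : F (-M) = 0 := by
    rw [← bexp_const p S 0]
    refine bexp_congr fun A hA => if_neg ?_
    have := neg_abs_le (T A)
    have h2 := hM A (Finset.mem_powerset.2 hA)
    change ¬ T A ≤ -M
    linarith
  have hbb : BddBelow {t | 1 - α ≤ F t} := by
    refine ⟨-M, fun t ht => ?_⟩
    by_contra hlt
    have := hmono (not_le.1 hlt).le
    have h3 : 1 - α ≤ F t := ht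
    linarith
  change sInf {t | 1 - α ≤ F t} ≤ t ↔ 1 - α ≤ F t
  constructor
  · intro h
    -- right continuity of the step function `F`
    obtain ⟨ε, hε, hstep⟩ : ∃ ε > 0, ∀ t' , t' < t + ε → F t' ≤ F t := by
      obtain ⟨ε, hε, h'⟩ : ∃ ε > 0, ∀ A ∈ S.powerset, t < T A → t + ε ≤ T A := by
        rcases ((S.powerset.filter (fun A => t < T A)).image T).eq_empty_or_nonempty with h0 | h0
        · refine ⟨1, one_pos, fun A hA hlt => ?_⟩
          have : T A ∈ ((S.powerset.filter (fun A => t < T A)).image T) :=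
            Finset.mem_image_of_mem _ (Finset.mem_filter.2 ⟨hA, hlt⟩)
          simp [h0] at this
        · refine ⟨Finset.min' _ h0 - t, ?_, fun A hA hlt => ?_⟩
          · have := Finset.min'_mem _ h0
            obtain ⟨A, hA, hA2⟩ := Finset.mem_image.1 this
            have := (Finset.mem_filter.1 hA).2
            rw [← hA2]; linarith
          · have := Finset.min'_le _ (T A)
              (Finset.mem_image_of_mem T (Finset.mem_filter.2 ⟨hA, hlt⟩ :
                A ∈ S.powerset.filter (fun A => t < T A)))
            linarith
      refine ⟨ε, hε, fun t' ht' => bprob_mono hp0.le hp1.le fun A hA hle => ?_⟩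
      by_contra hlt
      have := h' A (Finset.mem_powerset.2 hA) (not_le.1 hlt)
      change T A ≤ t' at hle
      linarith
    obtain ⟨t', ht', hlt⟩ := (csInf_lt_iff hbb ⟨M, by
      change 1 - α ≤ F M
      linarith⟩).1 (lt_of_le_of_lt h (lt_add_of_pos_right t hε))
    exact le_trans ht' (hstep t' hlt)
  · exact fun h => csInf_le hbb h

/-! ### A central limit theorem for weighted sums of Horvitz–Thompson weights -/

open Classical in
/-- Law of `X A` for a Bernoulli(`p`) random subset `A` of `S`. -/
noncomputable def blaw (p : ℝ) (S : Finset ℕ) (X : Finset ℕ → ℝ) : Measure ℝ :=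
  ∑ A ∈ S.powerset,
    ENNReal.ofReal (p ^ A.card * (1 - p) ^ (S.card - A.card)) • Measure.dirac (X A)

theorem blaw_apply {p : ℝ} (hp0 : 0 ≤ p) (hp1 : p ≤ 1) (S : Finset ℕ) (X : Finset ℕ → ℝ)
    {B : Set ℝ} (hB : MeasurableSet B) :
    blaw p S X B = ENNReal.ofReal (bprob p S (fun A => X A ∈ B)) := by
  have h1 : 0 ≤ 1 - p := by linarith
  rw [blaw, bprob, bexp, ENNReal.ofReal_sum_of_nonneg
    (fun A _ => mul_nonneg (by positivity) (by split_ifs <;> simp))]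
  simp only [Measure.coe_finsetSum, Finset.sum_apply, Measure.smul_apply, smul_eq_mul]
  refine Finset.sum_congr rfl fun A _ => ?_
  rw [Measure.dirac_apply' _ hB]
  by_cases h : X A ∈ B <;> simp [h]

theorem isProbabilityMeasure_blaw {p : ℝ} (hp0 : 0 ≤ p) (hp1 : p ≤ 1) (S : Finset ℕ)
    (X : Finset ℕ → ℝ) : IsProbabilityMeasure (blaw p S X) := by
  constructor
  rw [blaw_apply hp0 hp1 S X MeasurableSet.univ]
  have : bprob p S (fun A => X A ∈ Set.univ) = 1 := by
    rw [← bexp_const p S 1]; exact bexp_congr fun A _ => if_pos trivial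
  rw [this, ENNReal.ofReal_one]

theorem charFun_blaw {p : ℝ} (hp0 : 0 ≤ p) (hp1 : p ≤ 1) (S : Finset ℕ) (X : Finset ℕ → ℝ)
    (θ : ℝ) : charFun (blaw p S X) θ = ∑ A ∈ S.powerset,
      (p : ℂ) ^ A.card * (1 - p : ℂ) ^ (S.card - A.card) * Complex.exp (θ * X A * Complex.I) := by
  have h1 : 0 ≤ 1 - p := by linarith
  rw [charFun_apply_real, blaw, integral_finsetSum_measure]
  · refine Finset.sum_congr rfl fun A _ => ?_
    rw [integral_smul_measure, integral_dirac, ENNReal.toReal_ofReal (by positivity)]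
    simp [Complex.real_smul]
  · intro A _
    exact (integrable_dirac (by simp)).smul_measure ENNReal.ofReal_ne_top

/-- Independence of the labels appears as the expansion `Finset.prod_add`: multiplying out a product
of two-term factors gives one summand for each subset `A`. -/
theorem charFun_blaw_sum {p : ℝ} (hp0 : 0 ≤ p) (hp1 : p ≤ 1) (S : Finset ℕ)
    (a : ℕ → Bool → ℝ) (θ : ℝ) :
    charFun (blaw p S (fun A => ∑ j ∈ S, a j (decide (j ∈ A)))) θ
      = ∏ j ∈ S, ((p : ℂ) * Complex.exp (θ * a j true * Complex.I)
          + (1 - p : ℂ) * Complex.exp (θ * a j false * Complex.I)) := by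
  rw [charFun_blaw hp0 hp1, Finset.prod_add]
  refine Finset.sum_congr rfl fun A hA => ?_
  have hA := Finset.mem_powerset.1 hA
  rw [Finset.prod_mul_distrib, Finset.prod_mul_distrib, Finset.prod_const, Finset.prod_const,
    Finset.card_sdiff_of_subset hA, ← Complex.exp_sum, ← Complex.exp_sum]
  rw [show (p : ℂ) ^ A.card * Complex.exp (∑ x ∈ A, θ * a x true * Complex.I) *
    ((1 - p : ℂ) ^ (S.card - A.card) * Complex.exp (∑ x ∈ S \ A, θ * a x false * Complex.I))
    = (p : ℂ) ^ A.card * (1 - p : ℂ) ^ (S.card - A.card) *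
      (Complex.exp (∑ x ∈ A, θ * a x true * Complex.I) *
        Complex.exp (∑ x ∈ S \ A, θ * a x false * Complex.I)) by ring, ← Complex.exp_add]
  congr 2
  rw [← Finset.sum_sdiff hA, Complex.ofReal_add, Complex.ofReal_sum, Complex.ofReal_sum, mul_add,
    add_mul, add_comm]
  congr 1
  · rw [Finset.mul_sum, Finset.sum_mul]
    exact Finset.sum_congr rfl fun j hj => by simp [hj]
  · rw [Finset.mul_sum, Finset.sum_mul]
    exact Finset.sum_congr rfl fun j hj => by simp [(Finset.mem_sdiff.1 hj).2]

/-- Replace the factors one at a time; the remaining factors have norm at most one. -/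
theorem norm_prod_sub_prod_le {ι : Type*} (S : Finset ι) (f g : ι → ℂ)
    (hf : ∀ j ∈ S, ‖f j‖ ≤ 1) (hg : ∀ j ∈ S, ‖g j‖ ≤ 1) :
    ‖∏ j ∈ S, f j - ∏ j ∈ S, g j‖ ≤ ∑ j ∈ S, ‖f j - g j‖ := by
  classical
  induction S using Finset.induction_on with
  | empty => simp
  | insert a S ha ih =>
    rw [Finset.prod_insert ha, Finset.prod_insert ha, Finset.sum_insert ha]
    have ih' := ih (fun j hj => hf j (Finset.mem_insert_of_mem hj))
      (fun j hj => hg j (Finset.mem_insert_of_mem hj))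
    have hgp : ‖∏ j ∈ S, g j‖ ≤ 1 := by
      rw [norm_prod]
      exact Finset.prod_le_one (fun _ _ => norm_nonneg _)
        (fun j hj => hg j (Finset.mem_insert_of_mem hj))
    have h1 := hf a (Finset.mem_insert_self _ _)
    calc ‖f a * ∏ j ∈ S, f j - g a * ∏ j ∈ S, g j‖
        = ‖f a * (∏ j ∈ S, f j - ∏ j ∈ S, g j) + (f a - g a) * ∏ j ∈ S, g j‖ := by ring_nf
      _ ≤ ‖f a‖ * ‖∏ j ∈ S, f j - ∏ j ∈ S, g j‖ + ‖f a - g a‖ * ‖∏ j ∈ S, g j‖ := by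
          refine (norm_add_le _ _).trans ?_
          rw [norm_mul, norm_mul]
      _ ≤ 1 * ‖∏ j ∈ S, f j - ∏ j ∈ S, g j‖ + ‖f a - g a‖ * 1 := by gcongr
      _ ≤ _ := by linarith

theorem norm_exp_sub_quadratic_le {u : ℝ} (hu : |u| ≤ 1) :
    ‖Complex.exp (u * Complex.I) - (1 + u * Complex.I - u ^ 2 / 2)‖ ≤ 3 * |u| ^ 3 := by
  have h := Complex.norm_exp_sub_sum_le_norm_mul_exp (u * Complex.I) 3
  have e : ∑ m ∈ Finset.range 3, ((u : ℂ) * Complex.I) ^ m / (m.factorial : ℂ)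
      = 1 + u * Complex.I - u ^ 2 / 2 := by
    simp [Finset.sum_range_succ, mul_pow]; ring
  rw [e] at h
  have hn : ‖(u : ℂ) * Complex.I‖ = |u| := by simp
  rw [hn] at h
  refine h.trans ?_
  rw [mul_comm]
  gcongr
  exact (Real.exp_le_exp.2 hu).trans (Real.exp_one_lt_d9.le.trans (by norm_num))

/-- The weight has mean `0` and second moment `1 / (p * (1 - p))`, so the second-order Taylor terms
cancel against those of the Gaussian. The constant `4` is `3` from the two oscillating exponentials,
averaged with weights `p` and `1 - p`, plus `1` from the Gaussian factor. -/
theorem norm_two_point_charFun_sub_le {p : ℝ} (hp0 : 0 < p) (hp1 : p < 1) {y : ℝ}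
    (hy : 1 / (p * (1 - p)) * |y| ≤ 1) :
    ‖((p : ℂ) * Complex.exp ((y * htWeight p true : ℝ) * Complex.I)
      + (1 - p : ℂ) * Complex.exp ((y * htWeight p false : ℝ) * Complex.I))
      - Complex.exp (-(1 / (p * (1 - p)) * y ^ 2 / 2 : ℝ))‖
      ≤ 4 * (1 / (p * (1 - p)) * |y|) ^ 3 := by
  set v := 1 / (p * (1 - p)) with hv
  have h1p : 0 < 1 - p := by linarith
  have hv0 : 0 < v := by positivity
  have hv1 : 1 ≤ v := by
    rw [hv, le_div_iff₀ (by positivity)]; nlinarith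
  have hw : ∀ b, |htWeight p b| ≤ v := by
    intro b
    cases b
    · rw [htWeight_false, abs_neg, abs_of_pos (by positivity), hv]
      exact one_div_le_one_div_of_le (by positivity) (by nlinarith)
    · rw [htWeight_true, abs_of_pos (by positivity), hv]
      exact one_div_le_one_div_of_le (by positivity) (by nlinarith)
  have hyw : ∀ b, |y * htWeight p b| ≤ v * |y| := fun b => by
    rw [abs_mul, mul_comm]; gcongr; exact hw b
  have hA : ∀ b, ‖Complex.exp ((y * htWeight p b : ℝ) * Complex.I) -
      (1 + (y * htWeight p b : ℝ) * Complex.I - (y * htWeight p b : ℝ) ^ 2 / 2)‖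
      ≤ 3 * (v * |y|) ^ 3 := fun b =>
    (norm_exp_sub_quadratic_le ((hyw b).trans hy)).trans (by gcongr; exact hyw b)
  have hx0 : 0 ≤ v * y ^ 2 / 2 := by positivity
  have hyle : |y| ≤ 1 := by nlinarith [abs_nonneg y]
  have hB : ‖Complex.exp (-(v * y ^ 2 / 2 : ℝ)) - (1 - (v * y ^ 2 / 2 : ℝ))‖
      ≤ (v * |y|) ^ 3 := by
    have hx1 : |(-(v * y ^ 2 / 2))| ≤ 1 := by
      rw [abs_neg, abs_of_nonneg hx0, ← sq_abs]
      nlinarith [abs_nonneg y]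
    have := Real.abs_exp_sub_one_sub_id_le hx1
    have e : Complex.exp (-(v * y ^ 2 / 2 : ℝ)) - (1 - (v * y ^ 2 / 2 : ℝ))
        = ((Real.exp (-(v * y ^ 2 / 2)) - 1 - (-(v * y ^ 2 / 2)) : ℝ) : ℂ) := by
      push_cast; ring
    rw [e, Complex.norm_real, Real.norm_eq_abs]
    refine this.trans ?_
    rw [neg_sq, ← sq_abs y]
    have h3 : (v * |y| ^ 2 / 2) ^ 2 = (v ^ 2 * |y| ^ 3) * (|y| / 4) := by ring
    have h4 : (v * |y|) ^ 3 = (v ^ 2 * |y| ^ 3) * v := by ring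
    rw [h3, h4]
    gcongr
    linarith
  have hmean := htWeight_mean hp0 hp1
  have hsq := htWeight_sq_mean hp0 hp1
  have key : ((p : ℂ) * Complex.exp ((y * htWeight p true : ℝ) * Complex.I)
      + (1 - p : ℂ) * Complex.exp ((y * htWeight p false : ℝ) * Complex.I))
      - Complex.exp (-(v * y ^ 2 / 2 : ℝ))
      = (p : ℂ) * (Complex.exp ((y * htWeight p true : ℝ) * Complex.I) -
        (1 + (y * htWeight p true : ℝ) * Complex.I - (y * htWeight p true : ℝ) ^ 2 / 2))
      + ((1 - p : ℝ) : ℂ) * (Complex.exp ((y * htWeight p false : ℝ) * Complex.I) -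
        (1 + (y * htWeight p false : ℝ) * Complex.I - (y * htWeight p false : ℝ) ^ 2 / 2))
      - (Complex.exp (-(v * y ^ 2 / 2 : ℝ)) - (1 - (v * y ^ 2 / 2 : ℝ))) := by
    have e1 : (p : ℂ) * htWeight p true + (1 - p) * htWeight p false = 0 := by
      exact_mod_cast congrArg (fun x : ℝ => (x : ℂ)) hmean
    have e2 : (p : ℂ) * htWeight p true ^ 2 + (1 - p) * htWeight p false ^ 2 = v := by
      rw [hv]; exact_mod_cast congrArg (fun x : ℝ => (x : ℂ)) hsq
    push_cast
    linear_combination y * Complex.I * e1 - y ^ 2 / 2 * e2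
  rw [key]
  refine (norm_sub_le _ _).trans ?_
  refine (add_le_add_left (norm_add_le _ _) _).trans ?_
  rw [norm_mul, norm_mul, Complex.norm_real, Complex.norm_real, Real.norm_of_nonneg hp0.le,
    Real.norm_of_nonneg h1p.le]
  have := hA true
  have := hA false
  nlinarith

/-- Characteristic function bound for a weighted sum of Horvitz–Thompson weights. -/
theorem norm_charFun_htSum_sub_le {p : ℝ} (hp0 : 0 < p) (hp1 : p < 1) {S : Finset ℕ}
    {x : ℕ → ℝ} {κ θ : ℝ} (hx : 1 / (p * (1 - p)) * ∑ j ∈ S, x j ^ 2 = 1)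
    (hκ : ∀ j ∈ S, |x j| ≤ κ) (hθ : 1 / (p * (1 - p)) * (|θ| * κ) ≤ 1) :
    ‖charFun (blaw p S (fun A => htSum p S x (fun j => decide (j ∈ A)))) θ
      - Complex.exp (-(θ ^ 2 / 2 : ℝ))‖ ≤ 4 * (1 / (p * (1 - p))) ^ 2 * |θ| ^ 3 * κ := by
  have h1p : 0 < 1 - p := by linarith
  set v := 1 / (p * (1 - p)) with hv
  have hv0 : 0 < v := by positivity
  unfold htSum
  rw [charFun_blaw_sum hp0.le hp1.le S (fun j b => htWeight p b * x j)]
  have e : Complex.exp (-(θ ^ 2 / 2 : ℝ)) =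
      ∏ j ∈ S, Complex.exp (-(v * (θ * x j) ^ 2 / 2 : ℝ)) := by
    simp only [← Complex.ofReal_neg]
    rw [← Complex.exp_sum, ← Complex.ofReal_sum]
    congr 2
    have : ∀ j ∈ S, -(v * (θ * x j) ^ 2 / 2) = -(θ ^ 2 / 2 * v) * x j ^ 2 :=
      fun j _ => by ring
    rw [Finset.sum_congr rfl this, ← Finset.mul_sum]
    linear_combination (θ ^ 2 / 2) * hx
  rw [e]
  refine (norm_prod_sub_prod_le S _ _ (fun j _ => ?_) fun j _ => ?_).trans ?_
  · refine (norm_add_le _ _).trans ?_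
    rw [norm_mul, norm_mul, show (1 - p : ℂ) = ((1 - p : ℝ) : ℂ) by push_cast; ring,
      Complex.norm_real, Complex.norm_real, Real.norm_of_nonneg hp0.le,
      Real.norm_of_nonneg h1p.le, ← Complex.ofReal_mul, ← Complex.ofReal_mul,
      Complex.norm_exp_ofReal_mul_I, Complex.norm_exp_ofReal_mul_I]
    linarith
  · rw [← Complex.ofReal_neg, Complex.norm_exp_ofReal, Real.exp_le_one_iff]
    have : 0 ≤ v * (θ * x j) ^ 2 / 2 := by positivity
    linarith
  -- One factor `|x j|` of the cubic error is bounded by `κ`; the two others are summed by the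
  -- normalization `hx`.
  · have hb : ∀ j ∈ S, ‖((p : ℂ) * Complex.exp (θ * (htWeight p true * x j : ℝ) * Complex.I)
        + (1 - p : ℂ) * Complex.exp (θ * (htWeight p false * x j : ℝ) * Complex.I))
        - Complex.exp (-(v * (θ * x j) ^ 2 / 2 : ℝ))‖ ≤ (4 * v ^ 3 * |θ| ^ 3 * κ) * x j ^ 2 := by
      intro j hj
      have hyj : v * |θ * x j| ≤ 1 := by
        refine le_trans ?_ hθ
        rw [abs_mul]; gcongr; exact hκ j hj
      have := norm_two_point_charFun_sub_le hp0 hp1 hyj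
      rw [← hv] at this
      have e1 : ∀ b, (θ : ℂ) * (htWeight p b * x j : ℝ) = (θ * x j * htWeight p b : ℝ) := by
        intro b; push_cast; ring
      rw [e1, e1]
      refine this.trans ?_
      rw [abs_mul, ← sq_abs (x j)]
      have : 4 * (v * (|θ| * |x j|)) ^ 3 = 4 * v ^ 3 * |θ| ^ 3 * |x j| * |x j| ^ 2 := by ring
      rw [this]
      gcongr
      exact hκ j hj
    refine (Finset.sum_le_sum hb).trans (le_of_eq ?_)
    rw [← Finset.mul_sum]
    linear_combination (4 * v ^ 2 * |θ| ^ 3 * κ) * hx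

/-! ### The standard normal distribution function -/

theorem Phi_eq_real (x : ℝ) : Phi x = (gaussianReal 0 1).real (Set.Iic x) := cdf_eq_real _ _

theorem Phi_mono : Monotone Phi := monotone_cdf _

theorem Phi_nonneg (x : ℝ) : 0 ≤ Phi x := cdf_nonneg _ _

theorem Phi_le_one (x : ℝ) : Phi x ≤ 1 := cdf_le_one _ _

theorem tendsto_Phi_atBot : Tendsto Phi atBot (𝓝 0) := tendsto_cdf_atBot _

theorem tendsto_Phi_atTop : Tendsto Phi atTop (𝓝 1) := tendsto_cdf_atTop _

theorem Phi_sub_eq {a b : ℝ} (h : a ≤ b) :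
    Phi b - Phi a = (gaussianReal 0 1).real (Set.Ioc a b) := by
  rw [Phi_eq_real, Phi_eq_real, ← Set.Iic_sdiff_Iic, measureReal_sdiff (Set.Iic_subset_Iic.2 h)
    measurableSet_Iic]

theorem Phi_strictMono : StrictMono Phi := by
  intro a b hab
  rw [← sub_pos, Phi_sub_eq hab.le, measureReal_def, ENNReal.toReal_pos_iff]
  refine ⟨pos_iff_ne_zero.2 fun h => ?_, measure_lt_top _ _⟩
  have := (gaussianReal_absolutelyContinuous' 0 (one_ne_zero : (1 : NNReal) ≠ 0)) h
  simp [hab.not_ge] at this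

theorem gaussianPDFReal_le_one (x : ℝ) : gaussianPDFReal 0 1 x ≤ 1 := by
  rw [gaussianPDFReal]
  have h1 : (√(2 * Real.pi * ((1 : NNReal) : ℝ)))⁻¹ ≤ 1 := by
    refine inv_le_one_of_one_le₀ (Real.one_le_sqrt.2 ?_)
    have := Real.pi_gt_three
    simp; linarith
  have h2 : Real.exp (-(x - 0) ^ 2 / (2 * ((1 : NNReal) : ℝ))) ≤ 1 := by
    rw [Real.exp_le_one_iff]
    have : 0 ≤ x ^ 2 := sq_nonneg x
    simp; linarith
  exact mul_le_one₀ h1 (Real.exp_pos _).le h2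

theorem Phi_sub_le {a b : ℝ} (h : a ≤ b) : Phi b - Phi a ≤ b - a := by
  rw [Phi_sub_eq h, measureReal_def]
  refine ENNReal.toReal_le_of_le_ofReal (by linarith) ?_
  rw [gaussianReal_apply 0 one_ne_zero]
  calc ∫⁻ x in Set.Ioc a b, gaussianPDF 0 1 x ≤ ∫⁻ _ in Set.Ioc a b, 1 := by
        refine lintegral_mono fun x => ?_
        rw [gaussianPDF, ← ENNReal.ofReal_one]
        exact ENNReal.ofReal_le_ofReal (gaussianPDFReal_le_one x)
    _ = ENNReal.ofReal (b - a) := by simp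

theorem abs_Phi_sub_le (a b : ℝ) : |Phi a - Phi b| ≤ |a - b| := by
  rcases le_total a b with h | h
  · rw [abs_sub_comm, abs_of_nonneg (sub_nonneg.2 (Phi_mono h)), abs_sub_comm,
      abs_of_nonneg (sub_nonneg.2 h)]
    exact Phi_sub_le h
  · rw [abs_of_nonneg (sub_nonneg.2 (Phi_mono h)), abs_of_nonneg (sub_nonneg.2 h)]
    exact Phi_sub_le h

theorem continuous_Phi : Continuous Phi := by
  have : LipschitzWith 1 Phi := LipschitzWith.of_dist_le_mul fun a b => by
    simpa [Real.dist_eq] using abs_Phi_sub_le a b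
  exact this.continuous

/-- The normal quantile is characterized by `Phi`. -/
theorem Phi_quantile {a : ℝ} (h0 : 0 < a) (h1 : a < 1) : Phi (quantile Phi a) = a := by
  obtain ⟨t, ht⟩ : ∃ t, Phi t = a := by
    obtain ⟨u, hu⟩ := (tendsto_Phi_atBot.eventually (gt_mem_nhds h0)).exists
    obtain ⟨w, hw⟩ := (tendsto_Phi_atTop.eventually (lt_mem_nhds h1)).exists
    obtain ⟨t, -, ht⟩ := intermediate_value_uIcc (continuous_Phi.continuousOn (s := Set.uIcc u w))
      (Set.mem_uIcc.2 (Or.inl ⟨hu.le, hw.le⟩))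
    exact ⟨t, ht⟩
  have : {s | a ≤ Phi s} = Set.Ici t := by
    ext s
    rw [Set.mem_ofPred_eq, ← ht, Phi_strictMono.le_iff_le, Set.mem_Ici]
  rw [quantile, this, csInf_Ici, ht]

/-! ### Central limit theorem in Kolmogorov distance -/

/-- The characteristic functions converge at rate `κ i`, so Lévy's continuity theorem gives weak
convergence. The normal law has no atom at `t`, so the distribution functions converge there. -/
theorem tendsto_bprob_htSum {p : ℝ} (hp0 : 0 < p) (hp1 : p < 1) (S : ℕ → Finset ℕ)
    (x : ℕ → ℕ → ℝ) (κ : ℕ → ℝ) (hκ : Tendsto κ atTop (𝓝 0))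
    (hx : ∀ i, 1 / (p * (1 - p)) * ∑ j ∈ S i, x i j ^ 2 = 1)
    (hxκ : ∀ i, ∀ j ∈ S i, |x i j| ≤ κ i) (t : ℝ) :
    Tendsto (fun i => bprob p (S i) (fun A => htSum p (S i) (x i) (fun j => decide (j ∈ A)) ≤ t))
      atTop (𝓝 (Phi t)) := by
  set X : ℕ → Finset ℕ → ℝ := fun i A => htSum p (S i) (x i) (fun j => decide (j ∈ A)) with hX
  have inst : ∀ i, IsProbabilityMeasure (blaw p (S i) (X i)) :=
    fun i => isProbabilityMeasure_blaw hp0.le hp1.le _ _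
  let ν : ℕ → ProbabilityMeasure ℝ := fun i => ⟨blaw p (S i) (X i), inst i⟩
  let γ : ProbabilityMeasure ℝ := ⟨gaussianReal 0 1, inferInstance⟩
  have hlim : Tendsto ν atTop (𝓝 γ) := by
    refine ProbabilityMeasure.tendsto_of_tendsto_charFun fun θ => ?_
    have hγ : charFun (γ : Measure ℝ) θ = Complex.exp (-(θ ^ 2 / 2 : ℝ)) := by
      change charFun (gaussianReal 0 1) θ = _
      rw [charFun_gaussianReal]
      congr 1; push_cast; ring
    rw [hγ, tendsto_iff_norm_sub_tendsto_zero]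
    have hlim0 : Tendsto (fun i => 4 * (1 / (p * (1 - p))) ^ 2 * |θ| ^ 3 * κ i) atTop (𝓝 0) := by
      simpa using hκ.const_mul (4 * (1 / (p * (1 - p))) ^ 2 * |θ| ^ 3)
    have hlim1 : Tendsto (fun i => 1 / (p * (1 - p)) * (|θ| * κ i)) atTop (𝓝 0) := by
      simpa using (hκ.const_mul |θ|).const_mul (1 / (p * (1 - p)))
    refine squeeze_zero' (Eventually.of_forall fun i => norm_nonneg _) ?_ hlim0
    filter_upwards [hlim1.eventually (gt_mem_nhds one_pos)] with i hi
    exact norm_charFun_htSum_sub_le hp0 hp1 (hx i) (hxκ i) hi.le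
  have hfr : γ (frontier (Set.Iic t)) = 0 := by
    rw [frontier_Iic]
    have : (gaussianReal 0 1) {t} = 0 :=
      (gaussianReal_absolutelyContinuous 0 one_ne_zero) (by simp)
    change ((gaussianReal 0 1) {t}).toNNReal = 0
    rw [this]; rfl
  have h := ProbabilityMeasure.tendsto_measure_of_null_frontier_of_tendsto hlim hfr
  have h' := (NNReal.continuous_coe.tendsto _).comp h
  refine (h'.congr fun i => ?_).trans_eq ?_
  · change (blaw p (S i) (X i) (Set.Iic t)).toReal = _
    rw [blaw_apply hp0.le hp1.le _ _ measurableSet_Iic,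
      ENNReal.toReal_ofReal (bprob_nonneg hp0.le hp1.le _ _)]
    rfl
  · rw [Phi_eq_real]; rfl

/-- Uniformity over `S` and `x` follows by contradiction: counterexamples with `κ = 1 / (i + 1)`
form a triangular array to which the sequential theorem applies. -/
theorem clt_htSum_at {p : ℝ} (hp0 : 0 < p) (hp1 : p < 1) (t : ℝ) {δ : ℝ} (hδ : 0 < δ) :
    ∀ᶠ κ in 𝓝[>] (0 : ℝ), ∀ (S : Finset ℕ) (x : ℕ → ℝ),
      1 / (p * (1 - p)) * ∑ j ∈ S, x j ^ 2 = 1 → (∀ j ∈ S, |x j| ≤ κ) →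
      |bprob p S (fun A => htSum p S x (fun j => decide (j ∈ A)) ≤ t) - Phi t| ≤ δ := by
  suffices h : ∃ κ > 0, ∀ (S : Finset ℕ) (x : ℕ → ℝ),
      1 / (p * (1 - p)) * ∑ j ∈ S, x j ^ 2 = 1 → (∀ j ∈ S, |x j| ≤ κ) →
      |bprob p S (fun A => htSum p S x (fun j => decide (j ∈ A)) ≤ t) - Phi t| ≤ δ by
    obtain ⟨κ, hκ, h⟩ := h
    filter_upwards [Ioo_mem_nhdsGT hκ] with κ' hκ' S x h1 h2
    exact h S x h1 fun j hj => (h2 j hj).trans hκ'.2.le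
  by_contra! hcon
  choose! S x h1 h2 h3 using fun i : ℕ => hcon (1 / ((i : ℝ) + 1)) (by positivity)
  have hlim := tendsto_bprob_htSum hp0 hp1 S x (fun i => 1 / ((i : ℝ) + 1))
    tendsto_one_div_add_atTop_nhds_zero_nat h1 h2 t
  obtain ⟨i, hi⟩ := (hlim.eventually (Metric.ball_mem_nhds _ hδ)).exists
  exact absurd (h3 i) (not_lt.2 (le_of_lt (by simpa [Real.dist_eq] using hi)))

/-- Central limit theorem, uniformly over the argument of the distribution functions. -/
theorem clt_htSum {p : ℝ} (hp0 : 0 < p) (hp1 : p < 1) {δ : ℝ} (hδ : 0 < δ) :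
    ∃ κ > 0, ∀ (S : Finset ℕ) (x : ℕ → ℝ),
      1 / (p * (1 - p)) * ∑ j ∈ S, x j ^ 2 = 1 → (∀ j ∈ S, |x j| ≤ κ) → ∀ t,
      |bprob p S (fun A => htSum p S x (fun j => decide (j ∈ A)) ≤ t) - Phi t| ≤ δ := by
  set η := δ / 2 with hη
  have hη0 : 0 < η := by positivity
  -- Pólya's argument: control the difference on a grid of mesh `η` covering `[-M, M]`, then
  -- interpolate by monotonicity. Since `Phi` is 1-Lipschitz, the grid error and the mesh together
  -- cost `2 * η = δ`.
  obtain ⟨M, hM1, hM2⟩ : ∃ M : ℝ, Phi (-M) < η ∧ 1 - η < Phi M :=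
    ((tendsto_neg_atTop_atBot.eventually (tendsto_Phi_atBot.eventually (gt_mem_nhds hη0))).and
      (tendsto_Phi_atTop.eventually (lt_mem_nhds (show 1 - η < 1 by linarith)))).exists
  set N := ⌈2 * M / η⌉₊ with hN
  have hall := (Filter.eventually_all_finset (Finset.range (N + 1))).2
    fun i _ => clt_htSum_at hp0 hp1 (-M + i * η) hη0
  obtain ⟨κ, hκ, hκ0⟩ := (hall.and self_mem_nhdsWithin).exists
  refine ⟨κ, hκ0, fun S x h1 h2 t => ?_⟩
  set F : ℝ → ℝ := fun t => bprob p S (fun A => htSum p S x (fun j => decide (j ∈ A)) ≤ t) with hF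
  have hFm : Monotone F := fun a b hab => bprob_mono hp0.le hp1.le fun A _ h => le_trans h hab
  have hF0 : ∀ t, 0 ≤ F t := fun t => bprob_nonneg hp0.le hp1.le _ _
  have hF1 : ∀ t, F t ≤ 1 := fun t => bprob_le_one hp0.le hp1.le _ _
  have hgrid : ∀ i : ℕ, i ≤ N → |F (-M + i * η) - Phi (-M + i * η)| ≤ η := fun i hi =>
    hκ i (Finset.mem_range.2 (by omega)) S x h1 h2
  change |F t - Phi t| ≤ δ
  have hP0 := Phi_nonneg t
  have hP1 := Phi_le_one t
  rcases lt_or_ge t (-M) with hlt | hge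
  · have g := abs_le.1 (hgrid 0 (Nat.zero_le _))
    simp only [Nat.cast_zero, zero_mul, add_zero] at g
    have := hFm hlt.le
    have := Phi_mono hlt.le
    have := hF0 t
    rw [abs_le]; constructor <;> linarith
  · set i := ⌊(t + M) / η⌋₊ with hi
    have hi1 : (i : ℝ) ≤ (t + M) / η := Nat.floor_le (div_nonneg (by linarith) hη0.le)
    have hi2 : (t + M) / η < i + 1 := Nat.lt_floor_add_one _
    rw [le_div_iff₀ hη0] at hi1
    rw [div_lt_iff₀ hη0] at hi2
    by_cases hiN : i + 1 ≤ N
    · have g1 := abs_le.1 (hgrid i (by omega))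
      have g2 := abs_le.1 (hgrid (i + 1) hiN)
      push_cast at g2
      have m1 := hFm (show -M + i * η ≤ t by linarith)
      have m2 := hFm (show t ≤ -M + (i + 1) * η by linarith)
      have m3 := Phi_mono (show -M + i * η ≤ t by linarith)
      have m4 := Phi_mono (show t ≤ -M + (i + 1) * η by linarith)
      have l1 := Phi_sub_le (show -M + i * η ≤ -M + (i + 1) * η by nlinarith)
      rw [abs_le]; constructor <;> nlinarith
    · have hiN' : (N : ℝ) ≤ i := by exact_mod_cast (by omega : N ≤ i)
      have hNM : 2 * M / η ≤ N := Nat.le_ceil _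
      rw [div_le_iff₀ hη0] at hNM
      have g := abs_le.1 (hgrid N le_rfl)
      have m1 := hFm (show -M + N * η ≤ t by nlinarith)
      have m2 := Phi_mono (show -M + N * η ≤ t by nlinarith)
      have m3 := Phi_mono (show M ≤ -M + N * η by linarith)
      have := hF1 t
      rw [abs_le]; constructor <;> linarith

/-! ### Local asymptotics of the studentized statistic for fixed section errors -/

/-- Labels encoded by the set of treated sections. -/
def lab (A : Finset ℕ) (j : ℕ) : Bool := decide (j ∈ A)

/-- Outcomes with baseline `x` and effect `τ` on the sections in `A`. -/
noncomputable def shift (x : ℕ → ℝ) (τ : ℝ) (A : Finset ℕ) (j : ℕ) : ℝ := x j + τ * ind (lab A j)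

/-- The second moment of `x` over `S` is close to `c₀` and no single term dominates. -/
def Balanced (c₀ κ : ℝ) (S : Finset ℕ) (x : ℕ → ℝ) : Prop :=
  |∑ j ∈ S, x j ^ 2 - S.card * c₀| ≤ κ * S.card ∧ ∀ j ∈ S, |x j| ≤ κ * √(S.card : ℝ)

theorem ind_nonneg (b : Bool) : 0 ≤ ind b := by cases b <;> simp [ind]

theorem ind_le_one (b : Bool) : ind b ≤ 1 := by cases b <;> simp [ind]

theorem ind_sq (b : Bool) : ind b ^ 2 = ind b := by cases b <;> simp [ind]

theorem htWeight_mul_ind (p : ℝ) (b : Bool) : htWeight p b * ind b = ind b / p := by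
  cases b <;> simp [ind, htWeight]

theorem abs_htWeight_le {p : ℝ} (hp0 : 0 < p) (hp1 : p < 1) (b : Bool) :
    |htWeight p b| ≤ 1 / (p * (1 - p)) := by
  have h1p : 0 < 1 - p := by linarith
  cases b
  · rw [htWeight_false, abs_neg, abs_of_pos (by positivity)]
    exact one_div_le_one_div_of_le (by positivity) (by nlinarith)
  · rw [htWeight_true, abs_of_pos (by positivity)]
    exact one_div_le_one_div_of_le (by positivity) (by nlinarith)

theorem htWeight_sq_le {p : ℝ} (hp0 : 0 < p) (hp1 : p < 1) (b : Bool) :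
    htWeight p b ^ 2 ≤ (1 / (p * (1 - p))) ^ 2 :=
  sq_le_sq' (neg_le_of_abs_le (abs_htWeight_le hp0 hp1 b))
    (le_of_abs_le (abs_htWeight_le hp0 hp1 b))

theorem htSum_shift (p : ℝ) (S : Finset ℕ) (x : ℕ → ℝ) (τ : ℝ) (A : Finset ℕ) :
    htSum p S (shift x τ A) (lab A)
      = htSum p S x (lab A) + τ * ∑ j ∈ S, ind (lab A j) / p := by
  unfold htSum shift
  rw [Finset.mul_sum, ← Finset.sum_add_distrib]
  refine Finset.sum_congr rfl fun j _ => ?_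
  rw [← htWeight_mul_ind]; ring

theorem bexp_htSum_sq {p : ℝ} (hp0 : 0 < p) (hp1 : p < 1) (S : Finset ℕ) (x : ℕ → ℝ) :
    bexp p S (fun A => htSum p S x (lab A) ^ 2) = 1 / (p * (1 - p)) * ∑ j ∈ S, x j ^ 2 := by
  have h := bexp_sq_sum p S (fun j b => htWeight p b * x j)
    (fun j _ => by linear_combination x j * htWeight_mean hp0 hp1) 0
  simp only [zero_add] at h
  refine h.trans ?_
  rw [Finset.mul_sum]
  simp only [zero_pow two_ne_zero, zero_add]
  exact Finset.sum_congr rfl fun j _ => by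
    linear_combination x j ^ 2 * htWeight_sq_mean hp0 hp1

theorem bexp_ind_sq {p : ℝ} (hp0 : 0 < p) (S : Finset ℕ) :
    bexp p S (fun A => (∑ j ∈ S, (ind (lab A j) / p - 1)) ^ 2) = S.card * ((1 - p) / p) := by
  have h := bexp_sq_sum p S (fun _ b => ind b / p - 1)
    (fun j _ => by simp [ind]; field_simp; ring) 0
  simp only [zero_add] at h
  refine h.trans ?_
  simp only [zero_pow two_ne_zero, zero_add, Finset.sum_const, nsmul_eq_mul, ind]
  congr 1
  simp
  field_simp
  ring

theorem bexp_htWeight_sq_sub_sq_le {p : ℝ} (hp0 : 0 < p) (hp1 : p < 1) (S : Finset ℕ)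
    (x : ℕ → ℝ) {B : ℝ} (hB : ∀ j ∈ S, |x j| ≤ B) :
    bexp p S (fun A => (∑ j ∈ S, (htWeight p (lab A j) ^ 2 - 1 / (p * (1 - p))) * x j ^ 2) ^ 2)
      ≤ (1 / (p * (1 - p))) ^ 4 * B ^ 2 * ∑ j ∈ S, x j ^ 2 := by
  have h1p : 0 < 1 - p := by linarith
  set v := 1 / (p * (1 - p)) with hv
  have hv0 : 0 < v := by positivity
  have hv1 : 1 ≤ v := by
    rw [hv, le_div_iff₀ (by positivity)]; nlinarith
  have h := bexp_sq_sum p S (fun j b => (htWeight p b ^ 2 - v) * x j ^ 2)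
    (fun j _ => by linear_combination x j ^ 2 * htWeight_sq_mean hp0 hp1) 0
  simp only [zero_add] at h
  refine h.trans_le ?_
  simp only [zero_pow two_ne_zero, zero_add]
  rw [Finset.mul_sum]
  refine Finset.sum_le_sum fun j hj => ?_
  have hw : ∀ b, (htWeight p b ^ 2 - v) ^ 2 ≤ v ^ 4 := by
    intro b
    have h2 : htWeight p b ^ 2 ≤ v ^ 2 := htWeight_sq_le hp0 hp1 b
    have h3 := one_le_htWeight_sq hp0 hp1 b
    have h4 : |htWeight p b ^ 2 - v| ≤ v ^ 2 := by
      rw [abs_le]; constructor <;> nlinarith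
    calc (htWeight p b ^ 2 - v) ^ 2 = |htWeight p b ^ 2 - v| ^ 2 := (sq_abs _).symm
      _ ≤ (v ^ 2) ^ 2 := by gcongr
      _ = v ^ 4 := by ring
  have hx : x j ^ 2 ≤ B ^ 2 := by
    rw [← sq_abs]; exact pow_le_pow_left₀ (abs_nonneg _) (hB j hj) 2
  calc p * ((htWeight p true ^ 2 - v) * x j ^ 2) ^ 2
        + (1 - p) * ((htWeight p false ^ 2 - v) * x j ^ 2) ^ 2
      = (p * (htWeight p true ^ 2 - v) ^ 2 + (1 - p) * (htWeight p false ^ 2 - v) ^ 2)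
          * (x j ^ 2 * x j ^ 2) := by ring
    _ ≤ (p * v ^ 4 + (1 - p) * v ^ 4) * (B ^ 2 * x j ^ 2) := by
        gcongr
        · exact hw _
        · exact hw _
    _ = v ^ 4 * B ^ 2 * x j ^ 2 := by ring

theorem abs_htSqSum_shift_sub_le {p : ℝ} (hp0 : 0 < p) (hp1 : p < 1) (S : Finset ℕ)
    (x : ℕ → ℝ) (τ : ℝ) (A : Finset ℕ) :
    |htSqSum p S (shift x τ A) (lab A) - htSqSum p S x (lab A)|
      ≤ (1 / (p * (1 - p))) ^ 2 * (|τ| * (S.card + ∑ j ∈ S, x j ^ 2) + S.card * τ ^ 2) := by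
  set v := 1 / (p * (1 - p)) with hv
  unfold htSqSum
  rw [← Finset.sum_sub_distrib]
  refine (Finset.abs_sum_le_sum_abs _ _).trans ?_
  have e : v ^ 2 * (|τ| * (S.card + ∑ j ∈ S, x j ^ 2) + S.card * τ ^ 2)
      = ∑ j ∈ S, v ^ 2 * (|τ| * (1 + x j ^ 2) + τ ^ 2) := by
    rw [← Finset.mul_sum, Finset.sum_add_distrib, ← Finset.mul_sum, Finset.sum_add_distrib]
    simp
  rw [e]
  refine Finset.sum_le_sum fun j _ => ?_
  rw [← mul_sub, abs_mul, abs_of_nonneg (sq_nonneg (htWeight p (lab A j)))]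
  refine mul_le_mul (htWeight_sq_le hp0 hp1 _) ?_ (abs_nonneg _) (by positivity)
  rw [shift]
  have h1 := ind_nonneg (lab A j)
  have h2 := ind_le_one (lab A j)
  have e2 : (x j + τ * ind (lab A j)) ^ 2 - x j ^ 2 = ind (lab A j) * (2 * τ * x j + τ ^ 2) := by
    linear_combination τ ^ 2 * ind_sq (lab A j)
  rw [e2, abs_mul, abs_of_nonneg h1]
  have h3 : |2 * τ * x j + τ ^ 2| ≤ |τ| * (1 + x j ^ 2) + τ ^ 2 := by
    refine (abs_add_le _ _).trans ?_
    rw [abs_mul, abs_mul, abs_two, abs_of_nonneg (sq_nonneg τ), ← sq_abs (x j)]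
    nlinarith [abs_nonneg τ, mul_nonneg (abs_nonneg τ) (sq_nonneg (|x j| - 1))]
  calc ind (lab A j) * |2 * τ * x j + τ ^ 2| ≤ 1 * |2 * τ * x j + τ ^ 2| := by gcongr
    _ ≤ _ := by linarith

/-- The event `T ≤ t` will be rewritten as `X ≤ (t * √V - h * ζ) / √R`, with `X` the normalized
baseline sum. Here `V` is the studentizing sum over `k`, `ζ` the normalized treated fraction and `R`
the baseline variance over `k`. Continuity at `(d, 1, d)` makes this random threshold nearly
constant. -/
theorem exists_threshold_close {d : ℝ} (hd : 0 < d) (t H : ℝ) {δ : ℝ} (hδ : 0 < δ) :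
    ∃ κ > 0, ∀ V ζ R h : ℝ, |V - d| ≤ κ → |ζ - 1| ≤ κ → |R - d| ≤ κ → |h| ≤ H →
      0 < V ∧ 0 < R ∧ |(t * √V - h * ζ) / √R - (t - h / √d)| ≤ δ := by
  have hsd : 0 < √d := Real.sqrt_pos.2 hd
  have c1 : Tendsto (fun w : ℝ × ℝ × ℝ => |t| * |√w.1 / √w.2.2 - 1|) (𝓝 (d, 1, d)) (𝓝 0) := by
    have : ContinuousAt (fun w : ℝ × ℝ × ℝ => |t| * |√w.1 / √w.2.2 - 1|) (d, 1, d) := by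
      have : √((d, (1 : ℝ), d) : ℝ × ℝ × ℝ).2.2 ≠ 0 := hsd.ne'
      fun_prop (disch := assumption)
    have h := this.tendsto
    simpa [div_self hsd.ne'] using h
  have c2 : Tendsto (fun w : ℝ × ℝ × ℝ => |H| * |w.2.1 / √w.2.2 - 1 / √d|) (𝓝 (d, 1, d))
      (𝓝 0) := by
    have : ContinuousAt (fun w : ℝ × ℝ × ℝ => |H| * |w.2.1 / √w.2.2 - 1 / √d|) (d, 1, d) := by
      have : √((d, (1 : ℝ), d) : ℝ × ℝ × ℝ).2.2 ≠ 0 := hsd.ne'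
      fun_prop (disch := assumption)
    have h := this.tendsto
    simpa using h
  have c3 : ∀ᶠ w : ℝ × ℝ × ℝ in 𝓝 (d, 1, d), 0 < w.1 :=
    (continuous_fst.tendsto _).eventually (lt_mem_nhds hd)
  have c4 : ∀ᶠ w : ℝ × ℝ × ℝ in 𝓝 (d, 1, d), 0 < w.2.2 :=
    ((continuous_snd.comp continuous_snd).tendsto (d, 1, d)).eventually (lt_mem_nhds hd)
  have hδ2 : 0 < δ / 2 := by positivity
  obtain ⟨κ, hκ, hall⟩ := Metric.eventually_nhds_iff.1
    ((c1.eventually (gt_mem_nhds hδ2)).and ((c2.eventually (gt_mem_nhds hδ2)).and (c3.and c4)))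
  refine ⟨κ / 2, by positivity, fun V ζ R h hV hζ hR hh => ?_⟩
  obtain ⟨h1, h2, h3, h4⟩ := hall (y := (V, ζ, R)) (by
    rw [Prod.dist_eq, Prod.dist_eq]
    simp only [Real.dist_eq]
    exact max_lt (by linarith) (max_lt (by linarith) (by linarith)))
  refine ⟨h3, h4, ?_⟩
  have e : (t * √V - h * ζ) / √R - (t - h / √d)
      = t * (√V / √R - 1) - h * (ζ / √R - 1 / √d) := by ring
  rw [e]
  refine (abs_sub _ _).trans ?_
  rw [abs_mul, abs_mul]
  have : |h| * |ζ / √R - 1 / √d| ≤ |H| * |ζ / √R - 1 / √d| := by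
    exact mul_le_mul_of_nonneg_right (hh.trans (le_abs_self _)) (abs_nonneg _)
  simp only at h1 h2
  linarith

set_option maxHeartbeats 1000000 in
/-- Local asymptotic normality of the studentized statistic given balanced baseline outcomes. -/
theorem tStat_shift_clt {p c₀ : ℝ} (hp0 : 0 < p) (hp1 : p < 1) (hc : 0 < c₀) (t H : ℝ)
    {δ : ℝ} (hδ : 0 < δ) :
    ∀ᶠ κ in 𝓝[>] (0 : ℝ), ∀ᶠ k : ℕ in atTop, ∀ (S : Finset ℕ) (x : ℕ → ℝ) (τ : ℝ),
      S.card = k → Balanced c₀ κ S x → |τ| * √(k : ℝ) ≤ H →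
      |bprob p S (fun A => tStat p S (shift x τ A) (lab A) ≤ t)
        - Phi (t - τ * √(k : ℝ) / √(1 / (p * (1 - p)) * c₀))| ≤ δ := by
  have h1p : 0 < 1 - p := by linarith
  set v := 1 / (p * (1 - p)) with hv
  have hv0 : 0 < v := by positivity
  set d := v * c₀ with hd
  have hd0 : 0 < d := by positivity
  -- Four errors of size `η`: the normal approximation, the displacement of the threshold and the
  -- two exceptional sets.
  set η := δ / 4 with hη
  have hη0 : 0 < η := by positivity
  obtain ⟨κ₁, hκ₁, hthr⟩ := exists_threshold_close hd0 t H hη0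
  obtain ⟨κ₂, hκ₂, hclt⟩ := clt_htSum hp0 hp1 hη0
  have lim : ∀ f : ℝ → ℝ, Continuous f → f 0 = 0 → ∀ b > 0, ∀ᶠ κ in 𝓝[>] (0 : ℝ), f κ < b := by
    intro f hf hf0 b hb
    have := (hf.tendsto 0).mono_left (nhdsWithin_le_nhds (s := Set.Ioi (0 : ℝ)))
    rw [hf0] at this
    exact this.eventually (gt_mem_nhds hb)
  -- The conditions on `κ` serve, in turn, to keep `v * Q / k` near `d`, to keep `Q` away from zero,
  -- to make the normalized terms small enough for the central limit theorem, and to make `bad₂`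
  -- improbable.
  filter_upwards [self_mem_nhdsWithin,
    lim (fun κ => v * κ) (by fun_prop) (by simp) (κ₁ / 4) (by positivity),
    lim (fun κ => κ) (by fun_prop) (by simp) (c₀ / 2) (by positivity),
    lim (fun κ => κ / √(d / 2)) (by fun_prop) (by simp) κ₂ hκ₂,
    lim (fun κ => v ^ 4 * κ ^ 2 * (c₀ + κ) / (κ₁ / 4) ^ 2) (by fun_prop) (by simp) η hη0]
    with κ hκ0 hκa hκb hκc hκd
  have hκ0 : 0 < κ := hκ0
  have hsq : Tendsto (fun k : ℕ => √(k : ℝ)) atTop atTop :=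
    Real.tendsto_sqrt_atTop.comp tendsto_natCast_atTop_atTop
  have limk1 : Tendsto (fun k : ℕ => v ^ 2 * (H / √(k : ℝ) * (1 + c₀ + κ) + H ^ 2 / k))
      atTop (𝓝 0) := by
    have a1 := (tendsto_const_nhds (x := H)).div_atTop hsq
    have a2 := (tendsto_const_nhds (x := H ^ 2)).div_atTop
      (tendsto_natCast_atTop_atTop (R := ℝ))
    simpa using ((a1.mul_const (1 + c₀ + κ)).add a2).const_mul (v ^ 2)
  have limk2 : Tendsto (fun k : ℕ => ((1 - p) / p / κ₁ ^ 2) / (k : ℝ)) atTop (𝓝 0) :=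
    tendsto_const_nhds.div_atTop tendsto_natCast_atTop_atTop
  filter_upwards [limk1.eventually (gt_mem_nhds (show 0 < κ₁ / 4 by positivity)),
    limk2.eventually (gt_mem_nhds hη0), eventually_gt_atTop 0] with k hk1 hk2 hk0
    S x τ hS hbal hτ
  obtain ⟨hb1, hb2⟩ := hbal
  rw [hS] at hb1 hb2
  have hkr : (0 : ℝ) < k := by exact_mod_cast hk0
  have hsk : 0 < √(k : ℝ) := Real.sqrt_pos.2 hkr
  have hsk2 : √(k : ℝ) ^ 2 = k := Real.sq_sqrt hkr.le
  have hH0 : 0 ≤ H := le_trans (by positivity) hτ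
  have hb1' := abs_le.1 hb1
  set Q := ∑ j ∈ S, x j ^ 2 with hQ
  have hQlow : k * (c₀ / 2) < Q := by nlinarith
  have hQup : Q ≤ k * (c₀ + κ) := by linarith
  have hQ0 : 0 < Q := lt_trans (by positivity) hQlow
  have hvQ : 0 < v * Q := by positivity
  have hsvQ : 0 < √(v * Q) := Real.sqrt_pos.2 hvQ
  set h := τ * √(k : ℝ) with hh
  have hhH : |h| ≤ H := by rw [hh, abs_mul, abs_of_pos hsk]; exact hτ
  -- the normalized sum
  set X : Finset ℕ → ℝ := fun A => htSum p S (fun j => x j / √(v * Q)) (lab A) with hX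
  have hXeq : ∀ A, htSum p S x (lab A) = X A * √(v * Q) := by
    intro A
    simp only [hX, htSum, Finset.sum_mul]
    refine Finset.sum_congr rfl fun j _ => ?_
    field_simp
  have hFX : ∀ s, |bprob p S (fun A => X A ≤ s) - Phi s| ≤ η := by
    refine hclt S (fun j => x j / √(v * Q)) ?_ fun j hj => ?_
    · simp only [div_pow, Real.sq_sqrt hvQ.le]
      rw [← Finset.sum_div, ← hQ, ← hv]
      field_simp
    · rw [abs_div, abs_of_pos hsvQ]
      have : √(k * (d / 2)) ≤ √(v * Q) := Real.sqrt_le_sqrt (by rw [hd]; nlinarith)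
      rw [Real.sqrt_mul hkr.le] at this
      have hd2 : 0 < √(d / 2) := Real.sqrt_pos.2 (by positivity)
      rw [div_lt_iff₀ hd2] at hκc
      rw [div_le_iff₀ hsvQ]
      calc |x j| ≤ κ * √(k : ℝ) := hb2 j hj
        _ ≤ κ₂ * √(d / 2) * √(k : ℝ) := by gcongr
        _ = κ₂ * (√(k : ℝ) * √(d / 2)) := by ring
        _ ≤ κ₂ * √(v * Q) := by gcongr
  -- the exceptional sets
  set bad₁ : Finset ℕ → Prop := fun A => κ₁ * k ≤ |∑ j ∈ S, (ind (lab A j) / p - 1)| with hbad₁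
  set bad₂ : Finset ℕ → Prop := fun A =>
    κ₁ / 4 * k ≤ |∑ j ∈ S, (htWeight p (lab A j) ^ 2 - v) * x j ^ 2| with hbad₂
  have hp1bad : bprob p S bad₁ ≤ η := by
    refine (bprob_le_sq_div hp0.le hp1.le (by positivity) fun A _ h => h).trans ?_
    rw [bexp_ind_sq hp0, hS]
    refine le_trans (le_of_eq ?_) hk2.le
    field_simp
  have hp2bad : bprob p S bad₂ ≤ η := by
    refine (bprob_le_sq_div hp0.le hp1.le (by positivity) fun A _ h => h).trans ?_
    have := bexp_htWeight_sq_sub_sq_le hp0 hp1 S x hb2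
    rw [← hv, ← hQ, mul_pow κ, hsk2] at this
    rw [div_le_iff₀ (by positivity)]
    refine this.trans ?_
    rw [div_lt_iff₀ (by positivity)] at hκd
    calc v ^ 4 * (κ ^ 2 * k) * Q ≤ v ^ 4 * (κ ^ 2 * k) * (k * (c₀ + κ)) := by gcongr
      _ = (v ^ 4 * κ ^ 2 * (c₀ + κ)) * k ^ 2 := by ring
      _ ≤ (η * (κ₁ / 4) ^ 2) * k ^ 2 := by gcongr
      _ = _ := by ring
  set tt := t - h / √d with htt
  -- Outside the exceptional sets, `T ≤ t` is a bound on `X` by a threshold `g` that depends on `A`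
  -- but stays within `η` of the constant `tt`. Monotonicity then removes the dependence on `A`.
  have main : ∀ A ⊆ S, ¬ bad₁ A → ¬ bad₂ A →
      ∃ g, |g - tt| ≤ η ∧ (tStat p S (shift x τ A) (lab A) ≤ t ↔ X A ≤ g) := by
    intro A _ hA1 hA2
    simp only [hbad₁, hbad₂, not_le] at hA1 hA2
    set V := htSqSum p S (shift x τ A) (lab A) with hV
    set ζ := (∑ j ∈ S, ind (lab A j) / p) / k with hζ
    have hζ1 : |ζ - 1| ≤ κ₁ := by
      have : ζ - 1 = (∑ j ∈ S, (ind (lab A j) / p - 1)) / k := by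
        rw [Finset.sum_sub_distrib, hζ]; simp [hS]; field_simp
      rw [this, abs_div, abs_of_pos hkr, div_le_iff₀ hkr]
      exact hA1.le
    have hR : |v * Q / k - d| ≤ κ₁ := by
      have : v * Q / k - d = v * ((Q - k * c₀) / k) := by rw [hd]; field_simp
      rw [this, abs_mul, abs_of_pos hv0, abs_div, abs_of_pos hkr]
      have : |Q - k * c₀| / k ≤ κ := by rw [div_le_iff₀ hkr]; exact hb1
      have := mul_le_mul_of_nonneg_left this hv0.le
      linarith
    have hVd : |V / k - d| ≤ κ₁ := by
      have b1 := abs_htSqSum_shift_sub_le hp0 hp1 S x τ A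
      rw [← hv, ← hV, ← hQ, hS] at b1
      have b2 : htSqSum p S x (lab A) - v * Q
          = ∑ j ∈ S, (htWeight p (lab A j) ^ 2 - v) * x j ^ 2 := by
        simp only [htSqSum, hQ, sub_mul, Finset.sum_sub_distrib, Finset.mul_sum]
      have b3 : |τ| ≤ H / √(k : ℝ) := by rwa [le_div_iff₀ hsk]
      have b4 : τ ^ 2 ≤ H ^ 2 / k := by
        rw [← sq_abs]
        refine (pow_le_pow_left₀ (abs_nonneg _) b3 2).trans (le_of_eq ?_)
        rw [div_pow, hsk2]
      have b5 : v ^ 2 * (|τ| * (k + Q) + k * τ ^ 2)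
          ≤ v ^ 2 * (H / √(k : ℝ) * (1 + c₀ + κ) + H ^ 2 / k) * k := by
        calc v ^ 2 * (|τ| * (k + Q) + k * τ ^ 2)
            ≤ v ^ 2 * (H / √(k : ℝ) * (k + k * (c₀ + κ)) + k * (H ^ 2 / k)) := by gcongr
          _ = _ := by ring
      have b6 : |V - d * k| ≤ κ₁ * k := by
        -- Three sources of error: the effect `τ`, the randomness of the labels (controlled off
        -- `bad₂`), and the imbalance of the baseline.
        have e : V - d * k = (V - htSqSum p S x (lab A)) + (htSqSum p S x (lab A) - v * Q)
            + v * (Q - k * c₀) := by rw [hd]; ring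
        rw [e, b2]
        refine (abs_add_three _ _ _).trans ?_
        rw [abs_mul v, abs_of_pos hv0]
        have c1 : v * |Q - k * c₀| ≤ v * (κ * k) := by gcongr
        have c2 : v ^ 2 * (H / √(k : ℝ) * (1 + c₀ + κ) + H ^ 2 / k) * k ≤ κ₁ / 4 * k := by
          gcongr
        have c3 : v * κ * k ≤ κ₁ / 4 * k := by gcongr
        have c4 : v * (κ * k) = v * κ * k := by ring
        have c5 : 0 < κ₁ * k := by positivity
        linarith
      have : V / k - d = (V - d * k) / k := by field_simp
      rw [this, abs_div, abs_of_pos hkr, div_le_iff₀ hkr]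
      exact b6
    obtain ⟨hV0, -, hg⟩ := hthr (V / k) ζ (v * Q / k) h hVd hζ1 hR hhH
    refine ⟨_, hg, ?_⟩
    have hVpos : 0 < V := by
      by_contra hcon
      have := div_nonpos_of_nonpos_of_nonneg (not_lt.1 hcon) hkr.le
      linarith
    have hsRk : √(v * Q / k) = √(v * Q) / √(k : ℝ) := Real.sqrt_div hvQ.le _
    have hsVk : √(V / k) = √V / √(k : ℝ) := Real.sqrt_div hVpos.le _
    rw [tStat_eq, ← hV, div_le_iff₀ (Real.sqrt_pos.2 hVpos), htSum_shift, hXeq A, hsRk, hsVk,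
      le_div_iff₀ (by positivity)]
    have e1 : τ * ∑ j ∈ S, ind (lab A j) / p = (h * ζ) * √(k : ℝ) := by
      rw [hh, hζ]
      have : τ * √(k : ℝ) * ((∑ j ∈ S, ind (lab A j) / p) / k) * √(k : ℝ)
        = τ * (∑ j ∈ S, ind (lab A j) / p) * (√(k : ℝ) ^ 2 / k) := by ring
      rw [this, hsk2, div_self hkr.ne', mul_one]
    rw [e1]
    constructor
    · intro hle
      rw [← mul_le_mul_iff_left₀ hsk]
      have e2 : X A * (√(v * Q) / √(k : ℝ)) * √(k : ℝ) = X A * √(v * Q) := by field_simp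
      have e3 : (t * (√V / √(k : ℝ)) - h * ζ) * √(k : ℝ) = t * √V - h * ζ * √(k : ℝ) := by
        field_simp
      rw [e2, e3]; linarith
    · intro hle
      rw [← mul_le_mul_iff_left₀ hsk] at hle
      have e2 : X A * (√(v * Q) / √(k : ℝ)) * √(k : ℝ) = X A * √(v * Q) := by field_simp
      have e3 : (t * (√V / √(k : ℝ)) - h * ζ) * √(k : ℝ) = t * √V - h * ζ * √(k : ℝ) := by
        field_simp
      rw [e2, e3] at hle; linarith
  have up : bprob p S (fun A => tStat p S (shift x τ A) (lab A) ≤ t)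
      ≤ bprob p S (fun A => X A ≤ tt + η) + (bprob p S bad₁ + bprob p S bad₂) := by
    refine (bprob_le_add (D := fun A => X A ≤ tt + η) (E := fun A => bad₁ A ∨ bad₂ A)
      hp0.le hp1.le fun A hA hT => ?_).trans
      (add_le_add_right (bprob_le_add hp0.le hp1.le fun A _ h => h) _)
    by_cases h1 : bad₁ A
    · exact Or.inr (Or.inl h1)
    by_cases h2 : bad₂ A
    · exact Or.inr (Or.inr h2)
    obtain ⟨g, hg, hiff⟩ := main A hA h1 h2
    have := (abs_le.1 hg).2
    exact Or.inl ((hiff.1 hT).trans (by linarith))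
  have lo : bprob p S (fun A => X A ≤ tt - η)
      ≤ bprob p S (fun A => tStat p S (shift x τ A) (lab A) ≤ t)
        + (bprob p S bad₁ + bprob p S bad₂) := by
    refine (bprob_le_add (D := fun A => tStat p S (shift x τ A) (lab A) ≤ t)
      (E := fun A => bad₁ A ∨ bad₂ A) hp0.le hp1.le fun A hA hT => ?_).trans
      (add_le_add_right (bprob_le_add hp0.le hp1.le fun A _ h => h) _)
    by_cases h1 : bad₁ A
    · exact Or.inr (Or.inl h1)
    by_cases h2 : bad₂ A
    · exact Or.inr (Or.inr h2)
    obtain ⟨g, hg, hiff⟩ := main A hA h1 h2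
    have := (abs_le.1 hg).1
    exact Or.inl (hiff.2 (hT.trans (by linarith)))
  have f1 := abs_le.1 (hFX (tt + η))
  have f2 := abs_le.1 (hFX (tt - η))
  have g1 := Phi_sub_le (show tt ≤ tt + η by linarith)
  have g2 := Phi_sub_le (show tt - η ≤ tt by linarith)
  rw [abs_le]
  constructor <;> linarith

/-! ### Rejection probabilities for fixed section errors -/

/-- The critical value form of the test rejects, for baseline outcomes `x`, effect `τ` and the set
`A` of treated sections. -/
def RejCrit (p α : ℝ) (S : Finset ℕ) (x : ℕ → ℝ) (τ : ℝ) (A : Finset ℕ) : Prop :=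
  critValue p α S (shift x τ A) ≤ tStat p S (shift x τ A) (lab A)

/-- The `p`-value form of the test rejects. -/
def RejPval (p α : ℝ) (S : Finset ℕ) (x : ℕ → ℝ) (τ : ℝ) (A : Finset ℕ) : Prop :=
  randProb p S (shift x τ A) (fun s => tStat p S (shift x τ A) (lab A) ≤ s) ≤ α

theorem randProb_le_of_imp {p : ℝ} (hp0 : 0 < p) (hp1 : p < 1) (S : Finset ℕ) (y : ℕ → ℝ)
    {C D : ℝ → Prop} (h : ∀ s, C s → D s) : randProb p S y C ≤ randProb p S y D :=
  bprob_mono hp0.le hp1.le fun _ _ => h _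

theorem randProb_not (p : ℝ) (S : Finset ℕ) (y : ℕ → ℝ) (C : ℝ → Prop) :
    randProb p S y (fun s => ¬ C s) = 1 - randProb p S y C := bprob_not _ _ _

/-- From `P(T* ≥ T) ≤ α` follows `P(T* < T) ≥ 1 - α`, hence `P(T* ≤ T) ≥ 1 - α`; only a tie at the
critical value separates the two forms. -/
theorem RejPval.rejCrit {p α : ℝ} (hp0 : 0 < p) (hp1 : p < 1) (hα0 : 0 < α) (hα1 : α < 1)
    {S : Finset ℕ} {x : ℕ → ℝ} {τ : ℝ} {A : Finset ℕ} (h : RejPval p α S x τ A) :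
    RejCrit p α S x τ A := by
  rw [RejCrit, critValue_le_iff hp0 hp1 hα0 hα1]
  rw [RejPval] at h
  have := randProb_le_of_imp hp0 hp1 S (shift x τ A)
    (C := fun s => ¬ tStat p S (shift x τ A) (lab A) ≤ s)
    (D := fun s => s ≤ tStat p S (shift x τ A) (lab A)) fun s hs => (not_le.1 hs).le
  rw [randProb_not] at this
  linarith

/-- Together with `lt_of_rejCrit` this replaces the data-dependent critical value by fixed
thresholds: above a point where the randomization distribution function has reached `1 - α` both
forms reject, and at or below a point where it has not, neither does. -/
theorem rejPval_of_lt {p α : ℝ} (hp0 : 0 < p) (hp1 : p < 1)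
    {S : Finset ℕ} {x : ℕ → ℝ} {τ b : ℝ} {A : Finset ℕ}
    (hb : 1 - α ≤ randProb p S (shift x τ A) (fun s => s ≤ b))
    (h : b < tStat p S (shift x τ A) (lab A)) : RejPval p α S x τ A := by
  have := randProb_le_of_imp hp0 hp1 S (shift x τ A)
    (C := fun s => tStat p S (shift x τ A) (lab A) ≤ s)
    (D := fun s => ¬ s ≤ b) fun s hs => not_le.2 (h.trans_le hs)
  rw [randProb_not] at this
  rw [RejPval]
  linarith

theorem lt_of_rejCrit {p α : ℝ} (hp0 : 0 < p) (hp1 : p < 1) (hα0 : 0 < α) (hα1 : α < 1)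
    {S : Finset ℕ} {x : ℕ → ℝ} {τ b : ℝ} {A : Finset ℕ}
    (hb : randProb p S (shift x τ A) (fun s => s ≤ b) < 1 - α)
    (h : RejCrit p α S x τ A) : b < tStat p S (shift x τ A) (lab A) := by
  rw [RejCrit, critValue_le_iff hp0 hp1 hα0 hα1] at h
  by_contra hcon
  have := randProb_le_of_imp hp0 hp1 S (shift x τ A)
    (C := fun s => s ≤ tStat p S (shift x τ A) (lab A)) (D := fun s => s ≤ b)
    fun s hs => hs.trans (not_lt.1 hcon)
  linarith

theorem shift_zero (x : ℕ → ℝ) (A : Finset ℕ) : shift x 0 A = x := by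
  funext j; simp [shift]

/-- Relabelling leaves the outcomes unchanged, so the randomization law is that of a zero-effect
experiment with `y` itself as baseline. -/
theorem randProb_clt {p c₀ : ℝ} (hp0 : 0 < p) (hp1 : p < 1) (hc : 0 < c₀) (t : ℝ)
    {δ : ℝ} (hδ : 0 < δ) :
    ∀ᶠ κ in 𝓝[>] (0 : ℝ), ∀ᶠ k : ℕ in atTop, ∀ (S : Finset ℕ) (y : ℕ → ℝ),
      S.card = k → Balanced c₀ κ S y → |randProb p S y (fun s => s ≤ t) - Phi t| ≤ δ := by
  filter_upwards [tStat_shift_clt hp0 hp1 hc t 0 hδ] with κ hκ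
  filter_upwards [hκ] with k hk S y hS hy
  have := hk S y 0 hS hy (by simp)
  simp only [shift_zero, zero_mul, zero_div, sub_zero] at this
  exact this

theorem abs_sum_shift_sq_sub_le (S : Finset ℕ) (x : ℕ → ℝ) (τ : ℝ) (A : Finset ℕ) :
    |∑ j ∈ S, shift x τ A j ^ 2 - ∑ j ∈ S, x j ^ 2|
      ≤ |τ| * (S.card + ∑ j ∈ S, x j ^ 2) + S.card * τ ^ 2 := by
  rw [← Finset.sum_sub_distrib]
  refine (Finset.abs_sum_le_sum_abs _ _).trans ?_
  have e : |τ| * (S.card + ∑ j ∈ S, x j ^ 2) + S.card * τ ^ 2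
      = ∑ j ∈ S, (|τ| * (1 + x j ^ 2) + τ ^ 2) := by
    rw [Finset.sum_add_distrib, ← Finset.mul_sum, Finset.sum_add_distrib]
    simp
  rw [e]
  refine Finset.sum_le_sum fun j _ => ?_
  rw [shift]
  have h1 := ind_nonneg (lab A j)
  have h2 := ind_le_one (lab A j)
  have e2 : (x j + τ * ind (lab A j)) ^ 2 - x j ^ 2 = ind (lab A j) * (2 * τ * x j + τ ^ 2) := by
    linear_combination τ ^ 2 * ind_sq (lab A j)
  rw [e2, abs_mul, abs_of_nonneg h1]
  have h3 : |2 * τ * x j + τ ^ 2| ≤ |τ| * (1 + x j ^ 2) + τ ^ 2 := by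
    refine (abs_add_le _ _).trans ?_
    rw [abs_mul, abs_mul, abs_two, abs_of_nonneg (sq_nonneg τ), ← sq_abs (x j)]
    nlinarith [abs_nonneg τ, mul_nonneg (abs_nonneg τ) (sq_nonneg (|x j| - 1))]
  calc ind (lab A j) * |2 * τ * x j + τ ^ 2| ≤ 1 * |2 * τ * x j + τ ^ 2| := by gcongr
    _ ≤ _ := by linarith

/-- An effect of order `1 / √k` changes the sum of squares by `O(√k)` and each term by `O(1 / √k)`,
negligible against `κ * k` and `κ * √k`. So the observed outcomes stay balanced whatever the labels
are. -/
theorem Balanced.shift_eventually {c₀ κ : ℝ} (hκ : 0 < κ) (H : ℝ) :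
    ∀ᶠ k : ℕ in atTop, ∀ (S : Finset ℕ) (x : ℕ → ℝ) (τ : ℝ) (A : Finset ℕ),
      S.card = k → Balanced c₀ κ S x → |τ| * √(k : ℝ) ≤ H →
      Balanced c₀ (2 * κ) S (shift x τ A) := by
  have hsq : Tendsto (fun k : ℕ => √(k : ℝ)) atTop atTop :=
    Real.tendsto_sqrt_atTop.comp tendsto_natCast_atTop_atTop
  have limk1 : Tendsto (fun k : ℕ => H / √(k : ℝ) * (1 + c₀ + κ) + H ^ 2 / k) atTop (𝓝 0) := by
    have a1 := (tendsto_const_nhds (x := H)).div_atTop hsq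
    have a2 := (tendsto_const_nhds (x := H ^ 2)).div_atTop
      (tendsto_natCast_atTop_atTop (R := ℝ))
    simpa using (a1.mul_const (1 + c₀ + κ)).add a2
  have limk2 : Tendsto (fun k : ℕ => H / (k : ℝ)) atTop (𝓝 0) :=
    tendsto_const_nhds.div_atTop tendsto_natCast_atTop_atTop
  filter_upwards [limk1.eventually (gt_mem_nhds hκ), limk2.eventually (gt_mem_nhds hκ),
    eventually_gt_atTop 0] with k h1 h2 hk0 S x τ A hS hb hτ
  have hkr : (0 : ℝ) < k := by exact_mod_cast hk0
  have hsk : 0 < √(k : ℝ) := Real.sqrt_pos.2 hkr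
  have hsk2 : √(k : ℝ) ^ 2 = k := Real.sq_sqrt hkr.le
  have hH0 : 0 ≤ H := le_trans (by positivity) hτ
  obtain ⟨hb1, hb2⟩ := hb
  rw [hS] at hb1 hb2
  have b3 : |τ| ≤ H / √(k : ℝ) := by rwa [le_div_iff₀ hsk]
  have b4 : τ ^ 2 ≤ H ^ 2 / k := by
    rw [← sq_abs]
    refine (pow_le_pow_left₀ (abs_nonneg _) b3 2).trans (le_of_eq ?_)
    rw [div_pow, hsk2]
  have hQup : ∑ j ∈ S, x j ^ 2 ≤ k * (c₀ + κ) := by linarith [(abs_le.1 hb1).2]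
  constructor
  · have b1 := abs_sum_shift_sq_sub_le S x τ A
    rw [hS] at b1 ⊢
    have b5 : |τ| * (k + ∑ j ∈ S, x j ^ 2) + k * τ ^ 2 ≤ κ * k := by
      calc |τ| * (k + ∑ j ∈ S, x j ^ 2) + k * τ ^ 2
          ≤ H / √(k : ℝ) * (k + k * (c₀ + κ)) + k * (H ^ 2 / k) := by gcongr
        _ = (H / √(k : ℝ) * (1 + c₀ + κ) + H ^ 2 / k) * k := by ring
        _ ≤ κ * k := by gcongr
    have := abs_sub_le (∑ j ∈ S, shift x τ A j ^ 2) (∑ j ∈ S, x j ^ 2) (k * c₀)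
    linarith
  · intro j hj
    rw [hS]
    have c1 : |shift x τ A j| ≤ |x j| + |τ| := by
      refine (abs_add_le _ _).trans ?_
      rw [abs_mul, abs_of_nonneg (ind_nonneg _)]
      have := mul_le_mul_of_nonneg_left (ind_le_one (lab A j)) (abs_nonneg τ)
      linarith
    have c2 : H / √(k : ℝ) ≤ κ * √(k : ℝ) := by
      rw [div_le_iff₀ hsk, mul_assoc, ← pow_two, hsk2]
      rw [div_lt_iff₀ hkr] at h2
      exact h2.le
    have := hb2 j hj
    linarith

theorem eventually_nhdsGT_two_mul {Q : ℝ → Prop} (h : ∀ᶠ κ in 𝓝[>] (0 : ℝ), Q κ) :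
    ∀ᶠ κ in 𝓝[>] (0 : ℝ), Q (2 * κ) := by
  have : Tendsto (fun κ : ℝ => 2 * κ) (𝓝[>] 0) (𝓝[>] 0) := by
    refine tendsto_nhdsWithin_iff.2 ⟨?_, ?_⟩
    · have : Tendsto (fun κ : ℝ => 2 * κ) (𝓝 0) (𝓝 0) := by
        simpa using (continuous_const_mul (2 : ℝ)).tendsto 0
      exact this.mono_left nhdsWithin_le_nhds
    · filter_upwards [self_mem_nhdsWithin] with κ hκ
      exact mul_pos two_pos (Set.mem_Ioi.1 hκ)
  exact this.eventually h

/-- Power of both forms of the test under local effects, given balanced baseline outcomes. -/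
theorem power_local {p c₀ α : ℝ} (hp0 : 0 < p) (hp1 : p < 1) (hc : 0 < c₀)
    (hα0 : 0 < α) (hα1 : α < 1) (H : ℝ) {δ : ℝ} (hδ : 0 < δ) :
    ∀ᶠ κ in 𝓝[>] (0 : ℝ), ∀ᶠ k : ℕ in atTop, ∀ (S : Finset ℕ) (x : ℕ → ℝ) (τ : ℝ),
      S.card = k → Balanced c₀ κ S x → |τ| * √(k : ℝ) ≤ H →
      1 - Phi (quantile Phi (1 - α) - τ * √(k : ℝ) / √(1 / (p * (1 - p)) * c₀)) - δ
        ≤ bprob p S (RejPval p α S x τ) ∧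
      bprob p S (RejCrit p α S x τ)
        ≤ 1 - Phi (quantile Phi (1 - α) - τ * √(k : ℝ) / √(1 / (p * (1 - p)) * c₀)) + δ := by
  set z := quantile Phi (1 - α) with hz
  have hPz : Phi z = 1 - α := Phi_quantile (by linarith) (by linarith)
  set η := δ / 2 with hη
  have hη0 : 0 < η := by positivity
  -- Strict monotonicity leaves a margin on each side of `1 - α`. Once the randomization
  -- distribution function is within half of these margins at `z - η` and `z + η`, the critical
  -- value is trapped between the two points.
  have hlo : Phi (z - η) < 1 - α := hPz ▸ Phi_strictMono (by linarith)
  have hhi : 1 - α < Phi (z + η) := hPz ▸ Phi_strictMono (by linarith)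
  -- The randomization law is needed at level `2 * κ`, because it involves the shifted outcomes and
  -- not the baseline.
  filter_upwards [self_mem_nhdsWithin,
    eventually_nhdsGT_two_mul (randProb_clt hp0 hp1 hc (z - η) (half_pos (sub_pos.2 hlo))),
    eventually_nhdsGT_two_mul (randProb_clt hp0 hp1 hc (z + η) (half_pos (sub_pos.2 hhi))),
    tStat_shift_clt hp0 hp1 hc (z - η) H hη0, tStat_shift_clt hp0 hp1 hc (z + η) H hη0]
    with κ hκ0 h1 h2 h3 h4
  filter_upwards [h1, h2, h3, h4, Balanced.shift_eventually hκ0 H]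
    with k g1 g2 g3 g4 g5 S x τ hS hbal hτ
  have g3 := abs_le.1 (g3 S x τ hS hbal hτ)
  have g4 := abs_le.1 (g4 S x τ hS hbal hτ)
  set w := τ * √(k : ℝ) / √(1 / (p * (1 - p)) * c₀) with hw
  have l1 := Phi_sub_le (show z - η - w ≤ z - w by linarith)
  have l2 := Phi_sub_le (show z - w ≤ z + η - w by linarith)
  have u1 : bprob p S (RejCrit p α S x τ)
      ≤ 1 - bprob p S (fun A => tStat p S (shift x τ A) (lab A) ≤ z - η) := by
    rw [← bprob_not]
    refine bprob_mono hp0.le hp1.le fun A _ hA => not_le.2 ?_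
    refine lt_of_rejCrit hp0 hp1 hα0 hα1 ?_ hA
    have := abs_le.1 (g1 S (shift x τ A) hS (g5 S x τ A hS hbal hτ))
    linarith
  have u2 : 1 - bprob p S (fun A => tStat p S (shift x τ A) (lab A) ≤ z + η)
      ≤ bprob p S (RejPval p α S x τ) := by
    rw [← bprob_not]
    refine bprob_mono hp0.le hp1.le fun A _ hA => ?_
    refine rejPval_of_lt hp0 hp1 (b := z + η) ?_ (not_le.1 hA)
    have := abs_le.1 (g2 S (shift x τ A) hS (g5 S x τ A hS hbal hτ))
    linarith
  constructor <;> linarith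

/-! ### The limiting power -/

theorem sigmaTotSq_pos {s p : ℝ} (hs : 0 < s) (hp0 : 0 < p) (hp1 : p < 1) (μ τ : ℝ) :
    0 < sigmaTotSq s p μ τ := by
  have : 0 < 1 - p := by linarith
  rw [sigmaTotSq]; positivity

/-- Denominator minus numerator equals `p * (1 - p) * τ ^ 2`. -/
theorem sigmaTotSq_le_one {s p : ℝ} (hs : 0 < s) (hp0 : 0 < p) (hp1 : p < 1) (μ τ : ℝ) :
    sigmaTotSq s p μ τ ≤ 1 := by
  have h1 : 0 < 1 - p := by linarith
  rw [sigmaTotSq, div_le_one (by positivity)]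
  nlinarith [mul_nonneg (mul_nonneg hp0.le h1.le) (sq_nonneg τ)]

theorem continuousAt_sigmaTotSq {s p : ℝ} (hs : 0 < s) (hp0 : 0 < p) (hp1 : p < 1) (μ τ : ℝ) :
    ContinuousAt (sigmaTotSq s p μ) τ := by
  have h1 : 0 < 1 - p := by linarith
  unfold sigmaTotSq
  have : s + p * μ ^ 2 + (1 - p) * (μ + τ) ^ 2 ≠ 0 := by positivity
  fun_prop (disch := assumption)

theorem sigmaTotSq_zero {s p : ℝ} (hs : 0 < s) (μ : ℝ) : sigmaTotSq s p μ 0 = 1 := by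
  rw [sigmaTotSq, div_eq_one_iff_eq]
  · ring
  · have : 0 < s + μ ^ 2 := by positivity
    ring_nf; positivity

theorem tendsto_sigmaTotSq {s p : ℝ} (hs : 0 < s) (hp0 : 0 < p) (hp1 : p < 1) (μ : ℝ) :
    Tendsto (fun τ => sigmaTotSq s p μ τ) (𝓝 0) (𝓝 1) := by
  simpa [sigmaTotSq_zero hs] using (continuousAt_sigmaTotSq hs hp0 hp1 μ 0).tendsto

/-- `sigmaTotSq` and the denominator of `muTot` are continuous at `τ = 0`, and here `|τ| ≤ H / √k`
tends to zero while `τ * √k` stays bounded. The arguments of `Phi` therefore converge uniformly in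
`τ`, and `Phi` is 1-Lipschitz. -/
theorem powerApprox_local {s p : ℝ} (hs : 0 < s) (hp0 : 0 < p) (hp1 : p < 1) (μ α H : ℝ)
    {δ : ℝ} (hδ : 0 < δ) :
    ∀ᶠ k : ℕ in atTop, ∀ τ : ℝ, |τ| * √(k : ℝ) ≤ H →
      |powerApprox s p μ τ α k
        - (1 - Phi (quantile Phi (1 - α) - τ * √(k : ℝ) / √(1 / (p * (1 - p)) * (s + μ ^ 2))))|
        ≤ δ := by
  have h1p : 0 < 1 - p := by linarith
  set z := quantile Phi (1 - α) with hz
  set D : ℝ → ℝ := fun τ => s / (p * (1 - p)) + (μ + τ) ^ 2 / p + μ ^ 2 / (1 - p) with hD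
  have hDpos : ∀ τ, 0 < D τ := fun τ => by simp only [hD]; positivity
  have hD0 : D 0 = 1 / (p * (1 - p)) * (s + μ ^ 2) := by simp only [hD]; field_simp; ring
  have hDc : Continuous D := by simp only [hD]; fun_prop
  have hσc : ContinuousAt (fun τ => √(sigmaTotSq s p μ τ)) 0 :=
    (continuousAt_sigmaTotSq hs hp0 hp1 μ 0).sqrt
  have hσ0 : √(sigmaTotSq s p μ 0) = 1 := by rw [sigmaTotSq_zero hs, Real.sqrt_one]
  have t1 : Tendsto (fun τ => |z| * |1 / √(sigmaTotSq s p μ τ) - 1|) (𝓝 0) (𝓝 0) := by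
    have : ContinuousAt (fun τ => |z| * |1 / √(sigmaTotSq s p μ τ) - 1|) 0 :=
      (((continuousAt_const.div hσc (by rw [hσ0]; norm_num)).sub
          continuousAt_const).abs).const_mul _
    simpa [hσ0] using this.tendsto
  have t2 : Tendsto (fun τ => |H| * |1 / √(D τ) / √(sigmaTotSq s p μ τ) - 1 / √(D 0)|)
      (𝓝 0) (𝓝 0) := by
    have : ContinuousAt (fun τ => |H| * |1 / √(D τ) / √(sigmaTotSq s p μ τ) - 1 / √(D 0)|) 0 :=
      ((((continuousAt_const.div hDc.continuousAt.sqrt (Real.sqrt_pos.2 (hDpos 0)).ne').div hσc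
        (by rw [hσ0]; norm_num)).sub
          continuousAt_const).abs).const_mul _
    simpa [hσ0] using this.tendsto
  obtain ⟨ε, hε, hball⟩ := Metric.eventually_nhds_iff.1
    ((t1.eventually (gt_mem_nhds (half_pos hδ))).and (t2.eventually (gt_mem_nhds (half_pos hδ))))
  have hsq : Tendsto (fun k : ℕ => √(k : ℝ)) atTop atTop :=
    Real.tendsto_sqrt_atTop.comp tendsto_natCast_atTop_atTop
  have hlim := (tendsto_const_nhds (x := H)).div_atTop hsq
  filter_upwards [hlim.eventually (gt_mem_nhds hε), eventually_gt_atTop 0] with k hk hk0 τ hτ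
  have hkr : (0 : ℝ) < k := by exact_mod_cast hk0
  have hsk : 0 < √(k : ℝ) := Real.sqrt_pos.2 hkr
  obtain ⟨b1, b2⟩ := hball (y := τ) (by
    rw [Real.dist_eq, sub_zero]
    exact lt_of_le_of_lt (by rwa [le_div_iff₀ hsk]) hk)
  rw [powerApprox, ← hz, ← hD0, sub_sub_sub_cancel_left]
  refine (abs_Phi_sub_le _ _).trans ?_
  have e : z - τ * √(k : ℝ) / √(D 0) - (z - muTot s p μ τ k) / √(sigmaTotSq s p μ τ)
      = -(z * (1 / √(sigmaTotSq s p μ τ) - 1))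
        + (τ * √(k : ℝ)) * (1 / √(D τ) / √(sigmaTotSq s p μ τ) - 1 / √(D 0)) := by
    rw [muTot]; ring
  rw [e]
  refine (abs_add_le _ _).trans ?_
  rw [abs_neg, abs_mul, abs_mul]
  have hh : |τ * √(k : ℝ)| ≤ |H| := by
    rw [abs_mul, abs_of_pos hsk]; exact hτ.trans (le_abs_self _)
  have := mul_le_mul_of_nonneg_right hh
    (abs_nonneg (1 / √(D τ) / √(sigmaTotSq s p μ τ) - 1 / √(D 0)))
  linarith

/-! ### Distant effects -/

theorem sum_sq_le_htSqSum {p : ℝ} (hp0 : 0 < p) (hp1 : p < 1) (S : Finset ℕ) (y : ℕ → ℝ)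
    (z : ℕ → Bool) : ∑ j ∈ S, y j ^ 2 ≤ htSqSum p S y z :=
  Finset.sum_le_sum fun j _ => by nlinarith [one_le_htWeight_sq hp0 hp1 (z j), sq_nonneg (y j)]

theorem htSqSum_le {p : ℝ} (hp0 : 0 < p) (hp1 : p < 1) (S : Finset ℕ) (y : ℕ → ℝ)
    (z : ℕ → Bool) : htSqSum p S y z ≤ (1 / (p * (1 - p))) ^ 2 * ∑ j ∈ S, y j ^ 2 := by
  rw [Finset.mul_sum]
  exact Finset.sum_le_sum fun j _ =>
    mul_le_mul_of_nonneg_right (htWeight_sq_le hp0 hp1 _) (sq_nonneg _)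

theorem htSum_eq_zero_of_htSqSum {p : ℝ} {S : Finset ℕ} {y : ℕ → ℝ} {z : ℕ → Bool}
    (h : htSqSum p S y z = 0) : htSum p S y z = 0 := by
  refine Finset.sum_eq_zero fun j hj => ?_
  have := (Finset.sum_eq_zero_iff_of_nonneg (fun j _ => by positivity)).1 h j hj
  rw [← mul_pow] at this
  exact pow_eq_zero_iff two_ne_zero |>.1 this

/-- All weights have absolute value at least one, so the studentizing sum is at least the non-random
`Q = ∑ y j ^ 2`, while the numerator has second moment `Q / (p * (1 - p))`. No balance is needed, so
this tail control survives arbitrarily large effects. -/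
theorem bexp_tStat_sq_le {p : ℝ} (hp0 : 0 < p) (hp1 : p < 1) (S : Finset ℕ) (y : ℕ → ℝ) :
    bexp p S (fun A => tStat p S y (lab A) ^ 2) ≤ 1 / (p * (1 - p)) := by
  have h1p : 0 < 1 - p := by linarith
  have hv0 : 0 < 1 / (p * (1 - p)) := by positivity
  set Q := ∑ j ∈ S, y j ^ 2 with hQ
  have hQ0 : 0 ≤ Q := Finset.sum_nonneg fun _ _ => sq_nonneg _
  have hle : ∀ A, tStat p S y (lab A) ^ 2 ≤ Q⁻¹ * htSum p S y (lab A) ^ 2 := by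
    intro A
    have h1 := sum_sq_le_htSqSum hp0 hp1 S y (lab A)
    rw [tStat_eq, div_pow, Real.sq_sqrt (htSqSum_nonneg _ _ _ _), inv_mul_eq_div]
    rcases hQ0.eq_or_lt with h0 | h0
    · have hz : htSqSum p S y (lab A) = 0 := by
        refine le_antisymm ((htSqSum_le hp0 hp1 S y _).trans ?_) (htSqSum_nonneg _ _ _ _)
        rw [← hQ, ← h0, mul_zero]
      rw [hz, htSum_eq_zero_of_htSqSum hz]; simp
    · gcongr
  refine (bexp_mono hp0.le hp1.le fun A _ => hle A).trans ?_
  rw [bexp_mul_left, bexp_htSum_sq hp0 hp1, ← hQ]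
  rcases hQ0.eq_or_lt with h0 | h0
  · rw [← h0]; simp; positivity
  · apply le_of_eq; field_simp

theorem randProb_abs_ge_le {p : ℝ} (hp0 : 0 < p) (hp1 : p < 1) (S : Finset ℕ) (y : ℕ → ℝ)
    {C : ℝ} (hC : 0 < C) {D : ℝ → Prop} (hD : ∀ s, D s → C ≤ |s|) :
    randProb p S y D ≤ 1 / (p * (1 - p)) / C ^ 2 := by
  refine (bprob_le_sq_div (f := fun A => tStat p S y (lab A)) hp0.le hp1.le hC
    fun A _ h => hD _ h).trans ?_
  gcongr
  exact bexp_tStat_sq_le hp0 hp1 S y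

/-- By the universal Chebyshev bound the randomization law puts mass at most `α` beyond `C`;
`not_rejCrit_of_small` is the mirror image. -/
theorem rejPval_of_large {p α C : ℝ} (hp0 : 0 < p) (hp1 : p < 1) (hC : 0 < C)
    (hCα : 1 / (p * (1 - p)) / C ^ 2 ≤ α)
    {S : Finset ℕ} {x : ℕ → ℝ} {τ : ℝ} {A : Finset ℕ}
    (h : C ≤ tStat p S (shift x τ A) (lab A)) : RejPval p α S x τ A :=
  (randProb_abs_ge_le hp0 hp1 S _ hC fun _ hs => (h.trans hs).trans (le_abs_self _)).trans hCα

theorem not_rejCrit_of_small {p α C : ℝ} (hp0 : 0 < p) (hp1 : p < 1) (hα0 : 0 < α) (hα1 : α < 1)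
    (hC : 0 < C) (hCα : 1 / (p * (1 - p)) / C ^ 2 < 1 - α)
    {S : Finset ℕ} {x : ℕ → ℝ} {τ : ℝ} {A : Finset ℕ}
    (h : tStat p S (shift x τ A) (lab A) ≤ -C) : ¬ RejCrit p α S x τ A := by
  rw [RejCrit, critValue_le_iff hp0 hp1 hα0 hα1, not_le]
  refine lt_of_le_of_lt (randProb_abs_ge_le hp0 hp1 S _ hC fun s hs => ?_) hCα
  exact (le_neg.1 (hs.trans h)).trans (neg_le_abs s)

set_option maxHeartbeats 600000 in
/-- Under distant effects the studentized statistic is far from zero, on the side of the effect. -/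
theorem tStat_distant {p c₀ : ℝ} (hp0 : 0 < p) (hp1 : p < 1) (hc : 0 < c₀) {C δ : ℝ}
    (hC : 0 < C) (hδ : 0 < δ) :
    ∃ H₀ : ℝ, ∀ H ≥ H₀, ∀ᶠ k : ℕ in atTop, ∀ (S : Finset ℕ) (x : ℕ → ℝ) (τ : ℝ),
      S.card = k → Balanced c₀ 1 S x → H ≤ |τ| * √(k : ℝ) →
      (0 < τ → bprob p S (fun A => ¬ C ≤ tStat p S (shift x τ A) (lab A)) ≤ δ) ∧
      (τ < 0 → bprob p S (fun A => ¬ tStat p S (shift x τ A) (lab A) ≤ -C) ≤ δ) := by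
  have h1p : 0 < 1 - p := by linarith
  set v := 1 / (p * (1 - p)) with hv
  have hv0 : 0 < v := by positivity
  set C₁ := 2 * (v * (c₀ + 1) + (1 - p) / p) with hC₁
  have hC₁0 : 0 < C₁ := by positivity
  set C₂ := 2 * v ^ 2 * (c₀ + 1) with hC₂
  have hC₂0 : 0 < C₂ := by positivity
  -- The entry `1` gives `H ≤ H ^ 2`, the second pays for Chebyshev's inequality on the numerator,
  -- and the third makes half the mean `k * τ` dominate `C` times the denominator.
  refine ⟨max 1 (max (8 * C₁ / δ) (8 * C ^ 2 * C₂)), fun H hH => ?_⟩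
  have hH1 : 1 ≤ H := (le_max_left _ _).trans hH
  have hH2 : 8 * C₁ / δ ≤ H := (le_max_left _ _).trans ((le_max_right _ _).trans hH)
  have hH3 : 8 * C ^ 2 * C₂ ≤ H := (le_max_right _ _).trans ((le_max_right _ _).trans hH)
  have hHsq : H ≤ H ^ 2 := by nlinarith
  filter_upwards [tendsto_natCast_atTop_atTop.eventually (eventually_ge_atTop (H ^ 2)),
    eventually_gt_atTop 0] with k hkH hk0 S x τ hS hbal hτ
  have hkr : (0 : ℝ) < k := by exact_mod_cast hk0
  have hsk : 0 < √(k : ℝ) := Real.sqrt_pos.2 hkr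
  have hsk2 : √(k : ℝ) ^ 2 = k := Real.sq_sqrt hkr.le
  have hτ2 : H ^ 2 ≤ k * τ ^ 2 := by
    have := pow_le_pow_left₀ (by linarith) hτ 2
    rw [mul_pow, sq_abs, hsk2] at this
    linarith
  have hτ0 : τ ≠ 0 := by
    rintro rfl
    simp at hτ2; nlinarith
  have hτp : 0 < |τ| := abs_pos.2 hτ0
  -- Average of `H ≤ k * τ ^ 2`, the distance assumption, and `H * τ ^ 2 ≤ k * τ ^ 2`, from `k ≥ H ^
  -- 2`. It treats small and large effects at once, since variance and denominator grow like `k * (1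
  -- + τ ^ 2)`.
  have hdist : H / 2 * (1 + τ ^ 2) ≤ k * τ ^ 2 := by
    have := mul_le_mul_of_nonneg_right (hHsq.trans hkH) (sq_nonneg τ)
    linarith
  have hQup : ∑ j ∈ S, x j ^ 2 ≤ k * (c₀ + 1) := by
    have := (abs_le.1 hbal.1).2
    rw [hS] at this; linarith
  set N : Finset ℕ → ℝ := fun A => htSum p S (shift x τ A) (lab A) with hN
  set E : Finset ℕ → ℝ := fun A => ∑ j ∈ S, (ind (lab A j) / p - 1) with hE
  have hNE : ∀ A, N A - k * τ = htSum p S x (lab A) + τ * E A := by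
    intro A
    simp only [hN, hE, htSum_shift, Finset.sum_sub_distrib, Finset.sum_const, hS, nsmul_eq_mul]
    ring
  have hsecond : bexp p S (fun A => (N A - k * τ) ^ 2) ≤ k * C₁ * (1 + τ ^ 2) := by
    have h1 : bexp p S (fun A => (N A - k * τ) ^ 2)
        ≤ bexp p S (fun A => 2 * htSum p S x (lab A) ^ 2 + 2 * τ ^ 2 * E A ^ 2) := by
      refine bexp_mono hp0.le hp1.le fun A _ => ?_
      rw [hNE]
      nlinarith [sq_nonneg (htSum p S x (lab A) - τ * E A)]
    refine h1.trans ?_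
    rw [bexp_add, bexp_mul_left, bexp_mul_left, bexp_htSum_sq hp0 hp1, bexp_ind_sq hp0, hS, ← hv]
    have h2 : v * ∑ j ∈ S, x j ^ 2 ≤ v * (k * (c₀ + 1)) := by gcongr
    have h3 : 0 ≤ k * (v * (c₀ + 1)) * τ ^ 2 := by positivity
    have h4 : 0 ≤ k * ((1 - p) / p) := by positivity
    have h5 : k * C₁ * (1 + τ ^ 2) = 2 * (v * (k * (c₀ + 1))) + 2 * (k * (v * (c₀ + 1)) * τ ^ 2)
      + 2 * (k * ((1 - p) / p)) + 2 * τ ^ 2 * (k * ((1 - p) / p)) := by rw [hC₁]; ring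
    rw [h5]
    linarith
  have hbad : bprob p S (fun A => k * |τ| / 2 ≤ |N A - k * τ|) ≤ δ := by
    refine (bprob_le_sq_div hp0.le hp1.le (by positivity) fun A _ h => h).trans ?_
    rw [div_le_iff₀ (by positivity)]
    refine hsecond.trans ?_
    rw [div_le_iff₀ hδ] at hH2
    have e : δ * (k * |τ| / 2) ^ 2 = k * (δ / 4 * (k * |τ| ^ 2)) := by ring
    rw [e, sq_abs]
    have : C₁ * (1 + τ ^ 2) ≤ δ / 4 * (k * τ ^ 2) := by
      calc C₁ * (1 + τ ^ 2) ≤ (H * δ / 8) * (1 + τ ^ 2) := by gcongr; linarith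
        _ = δ / 4 * (H / 2 * (1 + τ ^ 2)) := by ring
        _ ≤ _ := by gcongr
    calc k * C₁ * (1 + τ ^ 2) = k * (C₁ * (1 + τ ^ 2)) := by ring
      _ ≤ _ := by gcongr
  have hgood : ∀ A, |N A - k * τ| < k * |τ| / 2 →
      0 < √(htSqSum p S (shift x τ A) (lab A)) ∧
      C * √(htSqSum p S (shift x τ A) (lab A)) ≤ |N A| := by
    intro A hA
    have hNlow : k * |τ| / 2 ≤ |N A| := by
      have h1 := abs_sub_abs_le_abs_sub (k * τ) (N A)
      rw [abs_mul, abs_of_pos hkr, abs_sub_comm] at h1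
      linarith
    have hN0 : N A ≠ 0 := by
      intro h0
      rw [h0, abs_zero] at hNlow
      have : 0 < k * |τ| / 2 := by positivity
      linarith
    have hV0 : 0 < htSqSum p S (shift x τ A) (lab A) :=
      lt_of_le_of_ne (htSqSum_nonneg _ _ _ _) fun h => hN0 (htSum_eq_zero_of_htSqSum h.symm)
    refine ⟨Real.sqrt_pos.2 hV0, ?_⟩
    have hVup : htSqSum p S (shift x τ A) (lab A) ≤ k * C₂ * (1 + τ ^ 2) := by
      refine (htSqSum_le hp0 hp1 S _ _).trans ?_
      have h1 : ∑ j ∈ S, shift x τ A j ^ 2 ≤ ∑ j ∈ S, (2 * x j ^ 2 + 2 * τ ^ 2) := by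
        refine Finset.sum_le_sum fun j _ => ?_
        rw [shift]
        have h2 : (τ * ind (lab A j)) ^ 2 ≤ τ ^ 2 := by
          rw [mul_pow, ind_sq]
          exact mul_le_of_le_one_right (sq_nonneg _) (ind_le_one _)
        nlinarith [sq_nonneg (x j - τ * ind (lab A j))]
      rw [Finset.sum_add_distrib, ← Finset.mul_sum, Finset.sum_const, hS, nsmul_eq_mul] at h1
      have h2 : ∑ j ∈ S, shift x τ A j ^ 2 ≤ 2 * (c₀ + 1) * k * (1 + τ ^ 2) := by
        nlinarith [mul_nonneg (mul_nonneg hc.le hkr.le) (sq_nonneg τ)]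
      calc v ^ 2 * ∑ j ∈ S, shift x τ A j ^ 2 ≤ v ^ 2 * (2 * (c₀ + 1) * k * (1 + τ ^ 2)) := by
            gcongr
        _ = _ := by rw [hC₂]; ring
    refine le_trans (abs_le_of_sq_le_sq' ?_ (by positivity)).2 hNlow
    rw [mul_pow, Real.sq_sqrt hV0.le]
    have e : (k * |τ| / 2) ^ 2 = k * (k * |τ| ^ 2) / 4 := by ring
    rw [e, sq_abs]
    calc C ^ 2 * htSqSum p S (shift x τ A) (lab A) ≤ C ^ 2 * (k * C₂ * (1 + τ ^ 2)) := by gcongr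
      _ = k * ((8 * C ^ 2 * C₂) / 2 * (1 + τ ^ 2)) / 4 := by ring
      _ ≤ k * (H / 2 * (1 + τ ^ 2)) / 4 := by gcongr
      _ ≤ _ := by gcongr
  constructor
  · intro hpos
    refine (bprob_mono hp0.le hp1.le fun A _ hA => ?_).trans hbad
    by_contra hcon
    obtain ⟨h1, h2⟩ := hgood A (not_le.1 hcon)
    refine hA ?_
    rw [tStat_eq, le_div_iff₀ h1]
    have h3 := (abs_lt.1 (not_le.1 hcon)).1
    rw [abs_of_pos hpos] at h3
    have h4 : 0 < N A := by linarith [mul_pos hkr hpos]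
    rwa [abs_of_pos h4] at h2
  · intro hneg
    refine (bprob_mono hp0.le hp1.le fun A _ hA => ?_).trans hbad
    by_contra hcon
    obtain ⟨h1, h2⟩ := hgood A (not_le.1 hcon)
    refine hA ?_
    rw [tStat_eq, div_le_iff₀ h1]
    have h3 := (abs_lt.1 (not_le.1 hcon)).2
    rw [abs_of_neg hneg] at h3
    have h4 : N A < 0 := by linarith [mul_neg_of_pos_of_neg hkr hneg]
    rw [abs_of_neg h4] at h2
    change N A ≤ _
    linarith

theorem powerApprox_le_one (s p μ τ α : ℝ) (k : ℕ) : powerApprox s p μ τ α k ≤ 1 := by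
  have := Phi_nonneg ((quantile Phi (1 - α) - muTot s p μ τ k) / √(sigmaTotSq s p μ τ))
  rw [powerApprox]; linarith

theorem powerApprox_nonneg (s p μ τ α : ℝ) (k : ℕ) : 0 ≤ powerApprox s p μ τ α k := by
  have := Phi_le_one ((quantile Phi (1 - α) - muTot s p μ τ k) / √(sigmaTotSq s p μ τ))
  rw [powerApprox]; linarith

/-- The squared denominator of `muTot` is at most `C * (1 + τ ^ 2)`, so `|muTot|` exceeds `M + |z|`.
Dividing by a standard deviation at most one only moves the argument of `Phi` further out, beyond
`-M` or `M`. -/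
theorem powerApprox_distant {s p : ℝ} (hs : 0 < s) (hp0 : 0 < p) (hp1 : p < 1) (μ α : ℝ)
    {δ : ℝ} (hδ : 0 < δ) :
    ∃ H₀ : ℝ, ∀ H ≥ H₀, ∀ᶠ k : ℕ in atTop, ∀ τ : ℝ, H ≤ |τ| * √(k : ℝ) →
      (0 < τ → 1 - δ ≤ powerApprox s p μ τ α k) ∧ (τ < 0 → powerApprox s p μ τ α k ≤ δ) := by
  have h1p : 0 < 1 - p := by linarith
  set z := quantile Phi (1 - α) with hz
  set C := s / (p * (1 - p)) + 2 * μ ^ 2 / p + 2 / p + μ ^ 2 / (1 - p) with hC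
  have hC0 : 0 < C := by positivity
  obtain ⟨M, hM1, hM2, hM0⟩ : ∃ M : ℝ, Phi (-M) < δ ∧ 1 - δ < Phi M ∧ 0 ≤ M :=
    ((tendsto_neg_atTop_atBot.eventually (tendsto_Phi_atBot.eventually (gt_mem_nhds hδ))).and
      ((tendsto_Phi_atTop.eventually (lt_mem_nhds (show 1 - δ < 1 by linarith))).and
        (eventually_ge_atTop 0))).exists
  set B := M + |z| with hB
  have hB0 : 0 ≤ B := by positivity
  refine ⟨max 1 (2 * C * B ^ 2), fun H hH => ?_⟩
  have hH1 : 1 ≤ H := (le_max_left _ _).trans hH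
  have hH2 : 2 * C * B ^ 2 ≤ H := (le_max_right _ _).trans hH
  have hHsq : H ≤ H ^ 2 := by nlinarith
  filter_upwards [tendsto_natCast_atTop_atTop.eventually (eventually_ge_atTop (H ^ 2)),
    eventually_gt_atTop 0] with k hkH hk0 τ hτ
  have hkr : (0 : ℝ) < k := by exact_mod_cast hk0
  have hsk : 0 < √(k : ℝ) := Real.sqrt_pos.2 hkr
  have hsk2 : √(k : ℝ) ^ 2 = k := Real.sq_sqrt hkr.le
  have hτ2 : H ^ 2 ≤ k * τ ^ 2 := by
    have := pow_le_pow_left₀ (by linarith) hτ 2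
    rw [mul_pow, sq_abs, hsk2] at this
    linarith
  have hdist : H / 2 * (1 + τ ^ 2) ≤ k * τ ^ 2 := by
    have := mul_le_mul_of_nonneg_right (hHsq.trans hkH) (sq_nonneg τ)
    linarith
  set D := s / (p * (1 - p)) + (μ + τ) ^ 2 / p + μ ^ 2 / (1 - p) with hD
  have hD0 : 0 < D := by positivity
  have hDC : D ≤ C * (1 + τ ^ 2) := by
    have h1 : (μ + τ) ^ 2 / p ≤ (2 * μ ^ 2 + 2 * τ ^ 2) / p := by
      gcongr; nlinarith [sq_nonneg (μ - τ)]
    have h2 : C * (1 + τ ^ 2) = s / (p * (1 - p)) + (2 * μ ^ 2 + 2 * τ ^ 2) / p + μ ^ 2 / (1 - p)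
        + (s / (p * (1 - p)) + 2 * μ ^ 2 / p + μ ^ 2 / (1 - p)) * τ ^ 2 + 2 / p := by
      rw [hC]; ring
    rw [h2]
    have : 0 ≤ (s / (p * (1 - p)) + 2 * μ ^ 2 / p + μ ^ 2 / (1 - p)) * τ ^ 2 + 2 / p := by
      positivity
    linarith
  have hsD : 0 < √D := Real.sqrt_pos.2 hD0
  have hbig : B ≤ |τ| * √(k : ℝ) / √D := by
    rw [le_div_iff₀ hsD]
    refine (abs_le_of_sq_le_sq' ?_ (by positivity)).2
    rw [mul_pow, mul_pow, Real.sq_sqrt hD0.le, hsk2, sq_abs]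
    calc B ^ 2 * D ≤ B ^ 2 * (C * (1 + τ ^ 2)) := by gcongr
      _ = (2 * C * B ^ 2) / 2 * (1 + τ ^ 2) := by ring
      _ ≤ H / 2 * (1 + τ ^ 2) := by gcongr
      _ ≤ _ := by linarith
  have hσ0 : 0 < √(sigmaTotSq s p μ τ) := Real.sqrt_pos.2 (sigmaTotSq_pos hs hp0 hp1 μ τ)
  have hσ1 : √(sigmaTotSq s p μ τ) ≤ 1 := by
    rw [← Real.sqrt_one]; exact Real.sqrt_le_sqrt (sigmaTotSq_le_one hs hp0 hp1 μ τ)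
  have hz1 := le_abs_self z
  have hz2 := neg_abs_le z
  rw [powerApprox, ← hz]
  constructor
  · intro hpos
    rw [abs_of_pos hpos] at hbig
    have h1 : (z - muTot s p μ τ k) / √(sigmaTotSq s p μ τ) ≤ -M := by
      rw [div_le_iff₀ hσ0]
      change z - τ * √(k : ℝ) / √D ≤ _
      linarith [mul_le_of_le_one_right hM0 hσ1]
    have := Phi_mono h1
    linarith
  · intro hneg
    rw [abs_of_neg hneg] at hbig
    have h1 : M ≤ (z - muTot s p μ τ k) / √(sigmaTotSq s p μ τ) := by
      rw [le_div_iff₀ hσ0]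
      change _ ≤ z - τ * √(k : ℝ) / √D
      have : -τ * √(k : ℝ) / √D = -(τ * √(k : ℝ) / √D) := by ring
      linarith [mul_le_of_le_one_right hM0 hσ1]
    have := Phi_mono h1
    linarith

/-- Power of both forms of the test, uniformly over effects and balanced baseline outcomes. -/
theorem power_balanced {s p α : ℝ} (hs : 0 < s) (hp0 : 0 < p) (hp1 : p < 1)
    (hα0 : 0 < α) (hα1 : α < 1) (μ : ℝ) {δ : ℝ} (hδ : 0 < δ) :
    ∃ κ > 0, ∃ K : ℕ, ∀ (S : Finset ℕ) (x : ℕ → ℝ) (τ : ℝ),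
      K ≤ S.card → Balanced (s + μ ^ 2) κ S x →
      powerApprox s p μ τ α S.card - δ ≤ bprob p S (RejPval p α S x τ) ∧
      bprob p S (RejCrit p α S x τ) ≤ powerApprox s p μ τ α S.card + δ := by
  have h1p : 0 < 1 - p := by linarith
  have hc : 0 < s + μ ^ 2 := by positivity
  set v := 1 / (p * (1 - p)) with hv
  have hv0 : 0 < v := by positivity
  obtain ⟨C, hC0, hC1, hC2⟩ : ∃ C : ℝ, 0 < C ∧ v / C ^ 2 ≤ α ∧ v / C ^ 2 < 1 - α := by
    have hlim : Tendsto (fun C : ℝ => v / C ^ 2) atTop (𝓝 0) :=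
      tendsto_const_nhds.div_atTop (tendsto_pow_atTop two_ne_zero)
    obtain ⟨C, h1, h2, h3⟩ := ((hlim.eventually (gt_mem_nhds hα0)).and
      ((hlim.eventually (gt_mem_nhds (show 0 < 1 - α by linarith))).and
        (eventually_gt_atTop 0))).exists
    exact ⟨C, h3, h1.le, h2⟩
  obtain ⟨H₁, hH₁⟩ := tStat_distant hp0 hp1 hc hC0 hδ
  obtain ⟨H₂, hH₂⟩ := powerApprox_distant hs hp0 hp1 μ α hδ
  set H := max 1 (max H₁ H₂) with hH
  have e1 : H₁ ≤ H := (le_max_left _ _).trans (le_max_right _ _)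
  have e2 : H₂ ≤ H := (le_max_right _ _).trans (le_max_right _ _)
  have e3 : 1 ≤ H := le_max_left _ _
  -- The extra condition `κ < 1` makes the baseline balanced with constant `1`, which is what
  -- `tStat_distant` assumes.
  obtain ⟨κ, ⟨hloc, hκ0⟩, hκ1⟩ := (((power_local hp0 hp1 hc hα0 hα1 H (half_pos hδ)).and
    self_mem_nhdsWithin).and (Ioo_mem_nhdsGT (one_pos (α := ℝ)))).exists
  obtain ⟨K, hK⟩ := eventually_atTop.1 (hloc.and ((hH₁ H e1).and ((hH₂ H e2).and
    (powerApprox_local hs hp0 hp1 μ α H (half_pos hδ)))))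
  refine ⟨κ, hκ0, K, fun S x τ hS hbal => ?_⟩
  obtain ⟨k1, k2, k3, k4⟩ := hK S.card hS
  rcases le_total (|τ| * √(S.card : ℝ)) H with hτ | hτ
  · obtain ⟨a1, a2⟩ := k1 S x τ rfl hbal hτ
    have a3 := abs_le.1 (k4 τ hτ)
    constructor <;> linarith
  · have hbal1 : Balanced (s + μ ^ 2) 1 S x := by
      refine ⟨hbal.1.trans ?_, fun j hj => (hbal.2 j hj).trans ?_⟩
      · have := hκ1.2.le
        gcongr
      · have := hκ1.2.le
        gcongr
    obtain ⟨a1, a2⟩ := k2 S x τ rfl hbal1 hτ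
    obtain ⟨b1, b2⟩ := k3 τ hτ
    have hp := powerApprox_le_one s p μ τ α S.card
    have hn := powerApprox_nonneg s p μ τ α S.card
    -- For each sign one of the two bounds is trivial, and the other compares two quantities within
    -- `δ` of `0` or of `1`; `τ = 0` is excluded by `1 ≤ H`.
    rcases lt_trichotomy τ 0 with hneg | rfl | hpos
    · have c1 := a2 hneg
      have c2 := b2 hneg
      have c3 := bprob_nonneg hp0.le hp1.le S (RejPval p α S x τ)
      have c4 : bprob p S (RejCrit p α S x τ) ≤ δ :=
        (bprob_mono hp0.le hp1.le fun A _ hA hT =>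
          not_rejCrit_of_small hp0 hp1 hα0 hα1 hC0 hC2 hT hA).trans c1
      constructor <;> linarith
    · simp at hτ; linarith
    · have c1 := a1 hpos
      have c2 := b1 hpos
      have c3 := bprob_le_one hp0.le hp1.le S (RejCrit p α S x τ)
      rw [bprob_not] at c1
      have c4 : bprob p S (fun A => C ≤ tStat p S (shift x τ A) (lab A))
          ≤ bprob p S (RejPval p α S x τ) :=
        bprob_mono hp0.le hp1.le fun A _ hA => rejPval_of_large hp0 hp1 hC0 hC1 hA
      constructor <;> linarith

/-! ### A law of large numbers for weakly dependent sections -/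

theorem abs_covariance_sq_le {Ω : Type*} [MeasurableSpace Ω] {P : Measure Ω}
    [IsProbabilityMeasure P] {f g : Ω → ℝ} {B : ℝ} (hf : Measurable f) (hg : Measurable g)
    (hfB : ∀ ω, |f ω| ≤ B) (hgB : ∀ ω, |g ω| ≤ B) :
    |cov[fun ω => f ω ^ 2, fun ω => g ω ^ 2; P]| ≤ B ^ 4 := by
  have hB : 0 ≤ B := by
    obtain ⟨ω⟩ := nonempty_of_isProbabilityMeasure P
    exact (abs_nonneg _).trans (hfB ω)
  have hf2 : ∀ ω, f ω ^ 2 ≤ B ^ 2 := fun ω => by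
    rw [← sq_abs]; exact pow_le_pow_left₀ (abs_nonneg _) (hfB ω) 2
  have hg2 : ∀ ω, g ω ^ 2 ≤ B ^ 2 := fun ω => by
    rw [← sq_abs]; exact pow_le_pow_left₀ (abs_nonneg _) (hgB ω) 2
  have mf : MemLp (fun ω => f ω ^ 2) 2 P := MemLp.of_bound (by fun_prop) (B ^ 2)
    (ae_of_all _ fun ω => by rw [Real.norm_of_nonneg (sq_nonneg _)]; exact hf2 ω)
  have mg : MemLp (fun ω => g ω ^ 2) 2 P := MemLp.of_bound (by fun_prop) (B ^ 2)
    (ae_of_all _ fun ω => by rw [Real.norm_of_nonneg (sq_nonneg _)]; exact hg2 ω)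
  have bound : ∀ {h : Ω → ℝ} {C : ℝ}, Integrable h P → (∀ ω, 0 ≤ h ω) → (∀ ω, h ω ≤ C) →
      0 ≤ ∫ ω, h ω ∂P ∧ ∫ ω, h ω ∂P ≤ C := by
    intro h C hi h0 hC
    refine ⟨integral_nonneg h0, (integral_mono hi (integrable_const C) hC).trans ?_⟩
    simp
  rw [covariance_eq_sub mf mg]
  obtain ⟨a0, a1⟩ := bound (mf.integrable (by norm_num)) (fun ω => sq_nonneg _) hf2
  obtain ⟨b0, b1⟩ := bound (mg.integrable (by norm_num)) (fun ω => sq_nonneg _) hg2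
  obtain ⟨c0, c1⟩ := bound (h := fun ω => f ω ^ 2 * g ω ^ 2) (C := B ^ 4)
    (mf.integrable_mul mg) (fun ω => by positivity) (fun ω => by
      calc f ω ^ 2 * g ω ^ 2 ≤ B ^ 2 * B ^ 2 :=
            mul_le_mul (hf2 ω) (hg2 ω) (sq_nonneg _) (sq_nonneg _)
        _ = B ^ 4 := by ring)
  have d : (∫ ω, f ω ^ 2 ∂P) * (∫ ω, g ω ^ 2 ∂P) ≤ B ^ 2 * B ^ 2 :=
    mul_le_mul a1 b1 b0 (sq_nonneg _)
  have d0 : 0 ≤ (∫ ω, f ω ^ 2 ∂P) * (∫ ω, g ω ^ 2 ∂P) := mul_nonneg a0 b0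
  change |∫ ω, f ω ^ 2 * g ω ^ 2 ∂P - (∫ ω, f ω ^ 2 ∂P) * (∫ ω, g ω ^ 2 ∂P)| ≤ B ^ 4
  rw [abs_le]
  constructor <;> nlinarith

/-- Each index has nonzero covariance with at most `2 * M + 1` others, and each covariance is at
most `B ^ 4`; the variance thus grows linearly in `S.card`. -/
theorem variance_sum_sq_le {Ω : Type*} [MeasurableSpace Ω] {P : Measure Ω}
    [IsProbabilityMeasure P] {b : ℕ → Ω → ℝ} {B : ℝ} {M : ℕ} (S : Finset ℕ)
    (hb : ∀ j, Measurable (b j)) (hB : ∀ j ω, |b j ω| ≤ B)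
    (hind : ∀ i ∈ S, ∀ j ∈ S, i + M < j → IndepFun (b i) (b j) P) :
    Var[fun ω => ∑ j ∈ S, b j ω ^ 2; P] ≤ S.card * (2 * M + 1) * B ^ 4 := by
  have mb : ∀ j, MemLp (fun ω => b j ω ^ 2) 2 P := fun j =>
    MemLp.of_bound ((hb j).pow_const 2).aestronglyMeasurable (B ^ 2) (ae_of_all _ fun ω => by
      rw [Real.norm_of_nonneg (sq_nonneg _), ← sq_abs]
      exact pow_le_pow_left₀ (abs_nonneg _) (hB j ω) 2)
  have h := variance_sum' (μ := P) (s := S) (X := fun j ω => b j ω ^ 2) (fun j _ => mb j)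
  have e : (∑ j ∈ S, fun ω => b j ω ^ 2) = fun ω => ∑ j ∈ S, b j ω ^ 2 := by
    funext ω; simp
  rw [e] at h
  rw [h]
  have hzero : ∀ i ∈ S, ∀ j ∈ S, i + M < j →
      cov[fun ω => b i ω ^ 2, fun ω => b j ω ^ 2; P] = 0 := fun i hi j hj hij =>
    ((hind i hi j hj hij).comp (φ := fun x : ℝ => x ^ 2) (ψ := fun x : ℝ => x ^ 2)
      (by fun_prop) (by fun_prop)).covariance_eq_zero (mb i) (mb j)
  have hB4 : 0 ≤ B ^ 4 := by positivity
  have hrow : ∀ i ∈ S, ∑ j ∈ S, cov[fun ω => b i ω ^ 2, fun ω => b j ω ^ 2; P]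
      ≤ (2 * M + 1) * B ^ 4 := by
    intro i hi
    calc ∑ j ∈ S, cov[fun ω => b i ω ^ 2, fun ω => b j ω ^ 2; P]
        ≤ ∑ j ∈ S, if j ∈ Finset.Icc (i - M) (i + M) then B ^ 4 else 0 := by
          refine Finset.sum_le_sum fun j hj => ?_
          split_ifs with hmem
          · exact (le_abs_self _).trans (abs_covariance_sq_le (hb i) (hb j) (hB i) (hB j))
          · rw [Finset.mem_Icc, not_and_or] at hmem
            rcases hmem with h1 | h1
            · rw [covariance_comm, hzero j hj i hi (by omega)]
            · rw [hzero i hi j hj (by omega)]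
      _ = (S.filter (· ∈ Finset.Icc (i - M) (i + M))).card * B ^ 4 := by
          rw [← Finset.sum_filter, Finset.sum_const, nsmul_eq_mul]
      _ ≤ (2 * M + 1) * B ^ 4 := by
          gcongr
          have : (S.filter (· ∈ Finset.Icc (i - M) (i + M))).card
              ≤ (Finset.Icc (i - M) (i + M)).card :=
            Finset.card_le_card fun j hj => (Finset.mem_filter.1 hj).2
          rw [Nat.card_Icc] at this
          exact_mod_cast this.trans (by omega : i + M + 1 - (i - M) ≤ 2 * M + 1)
  refine (Finset.sum_le_sum hrow).trans (le_of_eq ?_)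
  rw [Finset.sum_const, nsmul_eq_mul]; ring

theorem measureReal_ge_le_div {Ω : Type*} [MeasurableSpace Ω] {P : Measure Ω} {f : Ω → ℝ}
    (hf : Integrable f P) (h0 : ∀ ω, 0 ≤ f ω) {t c : ℝ} (ht : 0 < t) (hc : ∫ ω, f ω ∂P ≤ c) :
    P.real {ω | t ≤ f ω} ≤ c / t := by
  rw [le_div_iff₀ ht, mul_comm]
  exact (mul_meas_ge_le_integral_of_nonneg (ae_of_all _ h0) hf t).trans hc

/-- If every `ξ j` has second moment `c₀` and the `ξ j` can be approximated in `L²` by bounded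
variables with finite range of dependence, then `ξ` is balanced on all large finite sets. -/
theorem measureReal_not_balanced_le {Ω : Type*} [MeasurableSpace Ω] {P : Measure Ω}
    [IsProbabilityMeasure P] {ξ : ℕ → Ω → ℝ} {I : Set ℕ} {c₀ : ℝ}
    (hξ : ∀ j ∈ I, MemLp (ξ j) 2 P) (hc : ∀ j ∈ I, ∫ ω, ξ j ω ^ 2 ∂P = c₀)
    (happ : ∀ κ > 0, ∃ (B : ℝ) (M : ℕ) (b : ℕ → Ω → ℝ), (∀ j, Measurable (b j)) ∧
      (∀ j ω, |b j ω| ≤ B) ∧ (∀ j ∈ I, ∫ ω, (ξ j ω - b j ω) ^ 2 ∂P ≤ κ) ∧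
      ∀ i ∈ I, ∀ j ∈ I, i + M < j → IndepFun (b i) (b j) P)
    {κ : ℝ} (hκ : 0 < κ) {δ : ℝ} (hδ : 0 < δ) :
    ∃ K : ℕ, ∀ S : Finset ℕ, (∀ j ∈ S, j ∈ I) → K ≤ S.card →
      P.real {ω | ¬ Balanced c₀ κ S (fun j => ξ j ω)} ≤ δ := by
  rcases I.eq_empty_or_nonempty with rfl | ⟨j₀, hj₀⟩
  · refine ⟨1, fun S hS hcard => ?_⟩
    obtain ⟨j, hj⟩ := Finset.card_pos.1 (by omega : 0 < S.card)
    exact absurd (hS j hj) (Set.notMem_empty _)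
  have hc0 : 0 ≤ c₀ := by rw [← hc j₀ hj₀]; exact integral_nonneg fun ω => sq_nonneg _
  -- `l` is the `L²` distance to the approximation. The three smallness conditions bound the bias of
  -- the mean square and the two Markov probabilities `p1` and `p3`.
  obtain ⟨l, hl0, hl1, hla, hlb, hlc⟩ : ∃ l : ℝ, 0 < l ∧ l ≤ 1 ∧ l * (c₀ + 2) < κ / 3 ∧
      l * (c₀ + 2) / (κ / 3) < δ / 3 ∧ l ^ 2 / (κ ^ 2 / 4) < δ / 3 := by
    have lim : ∀ f : ℝ → ℝ, Continuous f → f 0 = 0 → ∀ b > 0,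
        ∀ᶠ l in 𝓝[>] (0 : ℝ), f l < b := by
      intro f hf hf0 b hb
      have := (hf.tendsto 0).mono_left (nhdsWithin_le_nhds (s := Set.Ioi (0 : ℝ)))
      rw [hf0] at this
      exact this.eventually (gt_mem_nhds hb)
    obtain ⟨l, h1, h2, h3, h4⟩ := ((show ∀ᶠ l in 𝓝[>] (0 : ℝ), l ∈ Set.Ioo (0 : ℝ) 1 from
      Ioo_mem_nhdsGT one_pos).and
      ((lim (fun l => l * (c₀ + 2)) (by fun_prop) (by simp) (κ / 3) (by positivity)).and
      ((lim (fun l => l * (c₀ + 2) / (κ / 3)) (by fun_prop) (by simp) (δ / 3)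
        (by positivity)).and
      (lim (fun l => l ^ 2 / (κ ^ 2 / 4)) (by fun_prop) (by simp) (δ / 3)
        (by positivity))))).exists
    exact ⟨l, h1.1, h1.2.le, h2, h3, h4⟩
  obtain ⟨B, M, b, hbm, hbB, hbR, hbi⟩ := happ (l ^ 2) (by positivity)
  have hlim : Tendsto (fun k : ℕ => (2 * M + 1) * B ^ 4 / (κ / 3) ^ 2 / (k : ℝ)) atTop (𝓝 0) :=
    tendsto_const_nhds.div_atTop tendsto_natCast_atTop_atTop
  obtain ⟨K, hK⟩ := eventually_atTop.1 ((hlim.eventually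
    (gt_mem_nhds (show 0 < δ / 3 by positivity))).and
    ((tendsto_natCast_atTop_atTop.eventually (eventually_ge_atTop (4 * B ^ 2 / κ ^ 2))).and
      (eventually_gt_atTop 0)))
  refine ⟨K, fun S hS hcard => ?_⟩
  obtain ⟨hK1, hK2, hK0⟩ := hK _ hcard
  set k := S.card with hk
  have hkr : (0 : ℝ) < k := by exact_mod_cast hK0
  have hsk2 : √(k : ℝ) ^ 2 = k := Real.sq_sqrt hkr.le
  have mb : ∀ j, MemLp (b j) 2 P := fun j => MemLp.of_bound (hbm j).aestronglyMeasurable B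
    (ae_of_all _ fun ω => by rw [Real.norm_eq_abs]; exact hbB j ω)
  have iξ : ∀ j ∈ S, Integrable (fun ω => ξ j ω ^ 2) P := fun j hj => (hξ j (hS j hj)).integrable_sq
  have ib : ∀ j, Integrable (fun ω => b j ω ^ 2) P := fun j => (mb j).integrable_sq
  have iR : ∀ j ∈ S, Integrable (fun ω => (ξ j ω - b j ω) ^ 2) P := fun j hj =>
    ((hξ j (hS j hj)).sub (mb j)).integrable_sq
  have idiff : ∀ j ∈ S, Integrable (fun ω => |ξ j ω ^ 2 - b j ω ^ 2|) P := fun j hj =>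
    ((iξ j hj).sub (ib j)).abs
  have hdiff : ∀ j ∈ S, ∫ ω, |ξ j ω ^ 2 - b j ω ^ 2| ∂P ≤ l * (c₀ + 2) := by
    intro j hj
    have hpt : ∀ ω, |ξ j ω ^ 2 - b j ω ^ 2|
        ≤ l * ξ j ω ^ 2 + (1 / l + 1) * (ξ j ω - b j ω) ^ 2 := by
      intro ω
      have e : ξ j ω ^ 2 - b j ω ^ 2 = (ξ j ω - b j ω) * (2 * ξ j ω - (ξ j ω - b j ω)) := by ring
      set R := ξ j ω - b j ω
      -- Weighted arithmetic–geometric inequality: with `E R² ≤ l²` it turns an `L²` error into an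
      -- `L¹` error of squares of order `l`.
      have h1 : 2 * |R| * |ξ j ω| ≤ l * ξ j ω ^ 2 + 1 / l * R ^ 2 := by
        rw [← sq_abs (ξ j ω), ← sq_abs R]
        have h3 : 0 ≤ (1 / l) * (l * |ξ j ω| - |R|) ^ 2 := by positivity
        have h4 : (1 / l) * (l * |ξ j ω| - |R|) ^ 2
          = l * |ξ j ω| ^ 2 + 1 / l * |R| ^ 2 - 2 * |R| * |ξ j ω| := by field_simp; ring
        linarith
      rw [e, abs_mul]
      have h2 : |2 * ξ j ω - R| ≤ 2 * |ξ j ω| + |R| := by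
        refine (abs_sub _ _).trans ?_
        rw [abs_mul, abs_two]
      have h5 := mul_le_mul_of_nonneg_left h2 (abs_nonneg R)
      have h6 : |R| * |R| = R ^ 2 := by rw [← pow_two, sq_abs]
      linarith
    refine (integral_mono (idiff j hj) (((iξ j hj).const_mul l).add
      ((iR j hj).const_mul (1 / l + 1))) hpt).trans ?_
    rw [integral_add' ((iξ j hj).const_mul l) ((iR j hj).const_mul (1 / l + 1)),
      integral_const_mul, integral_const_mul, hc j (hS j hj)]
    have h7 := mul_le_mul_of_nonneg_left (hbR j (hS j hj)) (show 0 ≤ 1 / l + 1 by positivity)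
    have h8 : (1 / l + 1) * l ^ 2 = l + l ^ 2 := by field_simp
    have h9 : l ^ 2 ≤ l := by nlinarith
    linarith
  -- the three exceptional events
  have p1 : P.real {ω | κ / 3 * k ≤ ∑ j ∈ S, |ξ j ω ^ 2 - b j ω ^ 2|} ≤ δ / 3 := by
    refine (measureReal_ge_le_div (integrable_finsetSum _ idiff)
      (fun ω => Finset.sum_nonneg fun j _ => abs_nonneg _) (by positivity)
      (c := k * (l * (c₀ + 2))) ?_).trans ?_
    · rw [integral_finsetSum _ idiff]
      refine (Finset.sum_le_sum hdiff).trans (le_of_eq ?_)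
      rw [Finset.sum_const, nsmul_eq_mul]
    · refine le_trans (le_of_eq ?_) hlb.le
      field_simp
  have p3 : P.real {ω | κ ^ 2 / 4 * k ≤ ∑ j ∈ S, (ξ j ω - b j ω) ^ 2} ≤ δ / 3 := by
    refine (measureReal_ge_le_div (integrable_finsetSum _ iR)
      (fun ω => Finset.sum_nonneg fun j _ => sq_nonneg _) (by positivity)
      (c := k * l ^ 2) ?_).trans ?_
    · rw [integral_finsetSum _ iR]
      refine (Finset.sum_le_sum fun j hj => hbR j (hS j hj)).trans (le_of_eq ?_)
      rw [Finset.sum_const, nsmul_eq_mul]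
    · refine le_trans (le_of_eq ?_) hlc.le
      field_simp
  set m := ∑ j ∈ S, ∫ ω, b j ω ^ 2 ∂P with hm
  have p2 : P.real {ω | κ / 3 * k ≤ |∑ j ∈ S, b j ω ^ 2 - m|} ≤ δ / 3 := by
    have hL : MemLp (fun ω => ∑ j ∈ S, b j ω ^ 2) 2 P :=
      memLp_finsetSum _ fun j _ => MemLp.of_bound ((hbm j).pow_const 2).aestronglyMeasurable
        (B ^ 2) (ae_of_all _ fun ω => by
          rw [Real.norm_of_nonneg (sq_nonneg _), ← sq_abs]
          exact pow_le_pow_left₀ (abs_nonneg _) (hbB j ω) 2)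
    have hmean : P[fun ω => ∑ j ∈ S, b j ω ^ 2] = m := integral_finsetSum _ fun j _ => ib j
    have hv := variance_sum_sq_le (P := P) S hbm hbB
      fun i hi j hj hij => hbi i (hS i hi) j (hS j hj) hij
    have hch := meas_ge_le_variance_div_sq hL (show 0 < κ / 3 * k by positivity)
    rw [hmean] at hch
    rw [measureReal_def]
    refine (ENNReal.toReal_mono ENNReal.ofReal_ne_top hch).trans ?_
    rw [ENNReal.toReal_ofReal (div_nonneg (variance_nonneg _ _) (sq_nonneg _))]
    refine le_trans ?_ hK1.le
    rw [div_le_iff₀ (by positivity)]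
    rw [← hk] at hv
    refine hv.trans (le_of_eq ?_)
    field_simp
  have hD3 : |m - k * c₀| ≤ κ / 3 * k := by
    have e : m - k * c₀ = ∑ j ∈ S, ∫ ω, (b j ω ^ 2 - ξ j ω ^ 2) ∂P := by
      rw [hm, hk, ← nsmul_eq_mul, ← Finset.sum_const, ← Finset.sum_sub_distrib]
      refine Finset.sum_congr rfl fun j hj => ?_
      rw [integral_sub (ib j) (iξ j hj), hc j (hS j hj)]
    rw [e]
    refine (Finset.abs_sum_le_sum_abs _ _).trans ?_
    have : ∀ j ∈ S, |∫ ω, (b j ω ^ 2 - ξ j ω ^ 2) ∂P| ≤ l * (c₀ + 2) := fun j hj => by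
      refine (abs_integral_le_integral_abs).trans (le_trans (le_of_eq ?_) (hdiff j hj))
      simp only [abs_sub_comm]
    refine (Finset.sum_le_sum this).trans ?_
    rw [Finset.sum_const, nsmul_eq_mul, mul_comm]
    gcongr
  have hsub : {ω | ¬ Balanced c₀ κ S (fun j => ξ j ω)} ⊆
      ({ω | κ / 3 * k ≤ ∑ j ∈ S, |ξ j ω ^ 2 - b j ω ^ 2|} ∪
        {ω | κ / 3 * k ≤ |∑ j ∈ S, b j ω ^ 2 - m|}) ∪
        {ω | κ ^ 2 / 4 * k ≤ ∑ j ∈ S, (ξ j ω - b j ω) ^ 2} := by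
    intro ω hω
    by_contra hcon
    simp only [Set.mem_union, not_or, Set.mem_ofPred_eq, not_le] at hcon
    obtain ⟨⟨h1, h2⟩, h3⟩ := hcon
    refine hω ⟨?_, fun j hj => ?_⟩
    · have e : ∑ j ∈ S, ξ j ω ^ 2 - S.card * c₀ = (∑ j ∈ S, (ξ j ω ^ 2 - b j ω ^ 2))
          + (∑ j ∈ S, b j ω ^ 2 - m) + (m - k * c₀) := by
        rw [Finset.sum_sub_distrib]; ring
      rw [e]
      refine (abs_add_three _ _ _).trans ?_
      have := Finset.abs_sum_le_sum_abs (fun j => ξ j ω ^ 2 - b j ω ^ 2) S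
      linarith
    -- The maximum needs no higher moments: `ξ² ≤ 2b² + 2(ξ - b)²`, where `b²` is bounded by a
    -- constant and the residual by the whole sum of residuals, each at most `κ² k / 4`.
    · have hRj : (ξ j ω - b j ω) ^ 2 ≤ ∑ j ∈ S, (ξ j ω - b j ω) ^ 2 :=
        Finset.single_le_sum (f := fun j => (ξ j ω - b j ω) ^ 2) (fun _ _ => sq_nonneg _) hj
      have hbj : b j ω ^ 2 ≤ B ^ 2 := by
        rw [← sq_abs]; exact pow_le_pow_left₀ (abs_nonneg _) (hbB j ω) 2
      rw [div_le_iff₀ (by positivity)] at hK2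
      refine (abs_le_of_sq_le_sq' ?_ (by positivity)).2
      rw [mul_pow, hsk2, sq_abs]
      nlinarith [sq_nonneg (ξ j ω - 2 * b j ω)]
  refine (measureReal_mono hsub).trans ((measureReal_union_le _ _).trans ?_)
  have := measureReal_union_le (μ := P) {ω | κ / 3 * k ≤ ∑ j ∈ S, |ξ j ω ^ 2 - b j ω ^ 2|}
    {ω | κ / 3 * k ≤ |∑ j ∈ S, b j ω ^ 2 - m|}
  linarith

/-! ### The stationary AR(1) process -/

section AR1

variable {Ω : Type*} [MeasurableSpace Ω] {P : Measure Ω}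

theorem covariance_congr_left {X X' Y : Ω → ℝ} (h : X =ᵐ[P] X') :
    cov[X, Y; P] = cov[X', Y; P] := by
  rw [covariance, covariance, integral_congr_ae h]
  exact integral_congr_ae (h.mono fun ω hω => by simp only [hω])

theorem two_mul_abs_covariance_le [IsProbabilityMeasure P] {X Y : Ω → ℝ}
    (hX : MemLp X 2 P) (hY : MemLp Y 2 P) :
    2 * |cov[X, Y; P]| ≤ Var[X; P] + Var[Y; P] := by
  have h1 := variance_nonneg (X + Y) P
  have h2 := variance_nonneg (X - Y) P
  rw [variance_add hX hY] at h1
  rw [variance_sub hX hY] at h2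
  have : |cov[X, Y; P]| ≤ (Var[X; P] + Var[Y; P]) / 2 := abs_le.2 ⟨by linarith, by linarith⟩
  linarith

variable {ρ σu : ℝ} {u ε : ℤ → Ω → ℝ}

namespace IsStationaryAR1

theorem memLp_innov (h : IsStationaryAR1 P ρ σu u ε) (t : ℤ) : MemLp (u t) 2 P :=
  (h.innov_ident t).memLp_iff.2 h.innov_memLp

theorem variance_innov (h : IsStationaryAR1 P ρ σu u ε) (t : ℤ) : Var[u t; P] = σu ^ 2 :=
  (h.innov_ident t).variance_eq.trans h.innov_var

theorem variance_eq (h : IsStationaryAR1 P ρ σu u ε) (t : ℤ) : Var[ε t; P] = Var[ε 0; P] := by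
  have := h.stationary 0 0 t
  rw [zero_add, covariance_self (h.measurable _).aemeasurable,
    covariance_self (h.measurable _).aemeasurable] at this
  exact this

theorem recursion' (h : IsStationaryAR1 P ρ σu u ε) (t : ℤ) :
    ε t =ᵐ[P] ρ • ε (t - 1) + u t :=
  (h.recursion t).mono fun ω hω => by simpa using hω

theorem memLp_sum (h : IsStationaryAR1 P ρ σu u ε) (a : ℤ) (n : ℕ) :
    MemLp (fun ω => ∑ i ∈ Finset.range n, ε (a + i) ω) 2 P :=
  memLp_finsetSum _ fun _ _ => h.memLp _

theorem iterate (h : IsStationaryAR1 P ρ σu u ε) (t : ℤ) (M : ℕ) :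
    ∀ᵐ ω ∂P, ε t ω = ∑ l ∈ Finset.range M, ρ ^ l * u (t - l) ω + ρ ^ M * ε (t - M) ω := by
  induction M with
  | zero => simp
  | succ M ih =>
    filter_upwards [ih, h.recursion (t - M)] with ω h1 h2
    rw [h1, h2, Finset.sum_range_succ]
    push_cast
    rw [show t - (M : ℤ) - 1 = t - (M + 1) by ring]
    ring

theorem covariance_innov (h : IsStationaryAR1 P ρ σu u ε) {s t : ℤ} (hst : s ≠ t) :
    cov[u s, u t; P] = 0 :=
  (h.innov_indep.indepFun hst).covariance_eq_zero (h.memLp_innov s) (h.memLp_innov t)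

variable [IsProbabilityMeasure P]

theorem covariance_step (h : IsStationaryAR1 P ρ σu u ε) (t : ℤ) {Y : Ω → ℝ}
    (hY : MemLp Y 2 P) :
    cov[ε t, Y; P] = ρ * cov[ε (t - 1), Y; P] + cov[u t, Y; P] := by
  rw [covariance_congr_left (h.recursion' t),
    covariance_add_left ((h.memLp _).const_smul ρ) (h.memLp_innov t) hY, covariance_smul_left]

/-- Innovations are uncorrelated with the past of the process. -/
theorem covariance_past_innov (h : IsStationaryAR1 P ρ σu u ε) (hρ : |ρ| < 1) {s t : ℤ}
    (hst : s < t) : cov[ε s, u t; P] = 0 := by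
  -- Causality is not assumed. Running the recursion backwards gains a factor `ρ ^ M`, and by
  -- stationarity the remaining covariance is bounded, so it must vanish.
  have hstep : ∀ M : ℕ, cov[ε s, u t; P] = ρ ^ M * cov[ε (s - M), u t; P] := by
    intro M
    induction M with
    | zero => simp
    | succ M ih =>
      rw [ih, h.covariance_step (s - M) (h.memLp_innov t), h.covariance_innov (by omega)]
      push_cast
      rw [show s - (M : ℤ) - 1 = s - (M + 1) by ring]
      ring
  have hb : ∀ M : ℕ, |cov[ε s, u t; P]| ≤ |ρ| ^ M * (Var[ε 0; P] + σu ^ 2) := by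
    intro M
    rw [hstep M, abs_mul, abs_pow]
    gcongr
    have h1 := two_mul_abs_covariance_le (h.memLp (s - M)) (h.memLp_innov t)
    rw [h.variance_eq, h.variance_innov] at h1
    have h2 := abs_nonneg (cov[ε (s - M), u t; P])
    linarith
  have hlim : Tendsto (fun M : ℕ => |ρ| ^ M * (Var[ε 0; P] + σu ^ 2)) atTop (𝓝 0) := by
    simpa using (tendsto_pow_atTop_nhds_zero_of_lt_one (abs_nonneg ρ) hρ).mul_const
      (Var[ε 0; P] + σu ^ 2)
  exact abs_eq_zero.1 (le_antisymm (ge_of_tendsto' hlim hb) (abs_nonneg _))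

theorem covariance_innov_self (h : IsStationaryAR1 P ρ σu u ε) (hρ : |ρ| < 1) (t : ℤ) :
    cov[ε t, u t; P] = σu ^ 2 := by
  rw [h.covariance_step t (h.memLp_innov t), h.covariance_past_innov hρ (by omega),
    covariance_self (h.innov_measurable t).aemeasurable, h.variance_innov]
  ring

theorem variance_stationary (h : IsStationaryAR1 P ρ σu u ε) (hρ : |ρ| < 1) :
    Var[ε 0; P] = σu ^ 2 / (1 - ρ ^ 2) := by
  -- The recursion is applied in each argument of the covariance; the mixed term vanishes because
  -- the innovation is uncorrelated with the past.
  have h1 : Var[ε 0; P] = ρ ^ 2 * Var[ε 0; P] + σu ^ 2 := by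
    have e := h.covariance_step 0 (h.memLp 0)
    rw [covariance_self (h.measurable 0).aemeasurable, covariance_comm (u 0),
      h.covariance_innov_self hρ, covariance_comm, h.covariance_step 0 (h.memLp (0 - 1)),
      covariance_comm (u 0), h.covariance_past_innov hρ (by omega),
      covariance_self (h.measurable _).aemeasurable, h.variance_eq (0 - 1)] at e
    linarith
  have h2 : 0 < 1 - ρ ^ 2 := by
    have := sq_lt_one_iff_abs_lt_one ρ |>.2 hρ
    linarith
  rw [eq_div_iff h2.ne']
  linarith

theorem covariance_lag (h : IsStationaryAR1 P ρ σu u ε) (hρ : |ρ| < 1) (t : ℤ) (l : ℕ) :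
    cov[ε (t + l), ε t; P] = ρ ^ l * Var[ε 0; P] := by
  induction l with
  | zero =>
    simp only [Nat.cast_zero, add_zero, pow_zero, one_mul]
    rw [covariance_self (h.measurable t).aemeasurable, h.variance_eq]
  | succ l ih =>
    rw [h.covariance_step _ (h.memLp t), covariance_comm (u _),
      h.covariance_past_innov hρ (by push_cast; omega)]
    push_cast
    rw [show t + ((l : ℤ) + 1) - 1 = t + l by ring, ih]
    ring

/-- Adding one more error contributes its variance and twice the sum of the lag covariances `ρ ^ l *
Var[ε 0]` for `1 ≤ l ≤ n`; this raises every coefficient `n - l` by one. -/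
theorem variance_sum (h : IsStationaryAR1 P ρ σu u ε) (hρ : |ρ| < 1) (a : ℤ) (n : ℕ) :
    Var[fun ω => ∑ i ∈ Finset.range n, ε (a + i) ω; P]
      = Var[ε 0; P] * ((n : ℝ) + 2 * ∑ l ∈ Finset.Ico 1 n, ((n : ℝ) - (l : ℝ)) * ρ ^ l) := by
  induction n with
  | zero =>
    have h0 : Var[(0 : Ω → ℝ); P] = 0 := ProbabilityTheory.variance_zero P
    simp only [Finset.range_zero, Finset.sum_empty]
    exact h0.trans (by simp)
  | succ n ih =>
    have hcov : cov[fun ω => ∑ i ∈ Finset.range n, ε (a + i) ω, ε (a + n); P]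
        = Var[ε 0; P] * ∑ l ∈ Finset.Ico 1 (n + 1), ρ ^ l := by
      rw [covariance_fun_sum_left' (fun i _ => h.memLp _) (h.memLp _)]
      have : ∀ i ∈ Finset.range n, cov[ε (a + i), ε (a + n); P]
          = Var[ε 0; P] * ρ ^ (n - 1 - i + 1) := by
        intro i hi
        have hi' := Finset.mem_range.1 hi
        have e : a + (n : ℤ) = (a + i) + ((n - 1 - i + 1 : ℕ) : ℤ) := by omega
        rw [covariance_comm, e, h.covariance_lag hρ]
        ring
      rw [Finset.sum_congr rfl this, ← Finset.mul_sum,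
        Finset.sum_range_reflect (fun l => ρ ^ (l + 1)) n, Finset.sum_Ico_eq_sum_range]
      simp [add_comm]
    simp only [Finset.sum_range_succ]
    rw [variance_fun_add (h.memLp_sum a n) (h.memLp _), ih, hcov, h.variance_eq (a + n)]
    have e1 : ∑ l ∈ Finset.Ico 1 (n + 1), (((n + 1 : ℕ) : ℝ) - (l : ℝ)) * ρ ^ l
        = ∑ l ∈ Finset.Ico 1 n, ((n : ℝ) - (l : ℝ)) * ρ ^ l
          + ∑ l ∈ Finset.Ico 1 (n + 1), ρ ^ l := by
      have e2 : ∑ l ∈ Finset.Ico 1 (n + 1), ((n : ℝ) - (l : ℝ)) * ρ ^ l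
          = ∑ l ∈ Finset.Ico 1 n, ((n : ℝ) - (l : ℝ)) * ρ ^ l := by
        rcases Nat.eq_zero_or_pos n with rfl | hn
        · simp
        · rw [Finset.sum_Ico_succ_top hn]; simp
      rw [← e2, ← Finset.sum_add_distrib]
      exact Finset.sum_congr rfl fun l _ => by push_cast; ring
    rw [e1]
    push_cast
    ring

theorem variance_mean (h : IsStationaryAR1 P ρ σu u ε) (hρ : |ρ| < 1) (a : ℤ) (n : ℕ) :
    Var[fun ω => (∑ i ∈ Finset.range n, ε (a + i) ω) / (n : ℝ); P] = ar1MeanVar σu ρ n := by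
  have e : (fun ω => (∑ i ∈ Finset.range n, ε (a + i) ω) / (n : ℝ))
      = fun ω => (1 / (n : ℝ)) * ∑ i ∈ Finset.range n, ε (a + i) ω := by
    funext ω; ring
  rw [e, variance_const_mul, h.variance_sum hρ, h.variance_stationary hρ, ar1MeanVar]
  ring

/-- Positivity is not visible in the closed form when `ρ < 0`. The sum of the errors has covariance
`σu ^ 2` with the last innovation, so nonnegativity of the variance of their difference gives `Var ≥
σu ^ 2` for the sum. -/
theorem ar1MeanVar_pos (h : IsStationaryAR1 P ρ σu u ε) (hρ : |ρ| < 1) (hσ : 0 < σu) {n : ℕ}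
    (hn : 0 < n) : 0 < ar1MeanVar σu ρ n := by
  obtain ⟨n, rfl⟩ : ∃ l, n = l + 1 := ⟨n - 1, by omega⟩
  have hcov : cov[fun ω => ∑ i ∈ Finset.range (n + 1), ε ((0 : ℤ) + i) ω, u (n : ℤ); P]
      = σu ^ 2 := by
    rw [covariance_fun_sum_left' (fun i _ => h.memLp _) (h.memLp_innov _),
      Finset.sum_range_succ, Finset.sum_eq_zero, zero_add, zero_add, h.covariance_innov_self hρ]
    intro i hi
    have := Finset.mem_range.1 hi
    exact h.covariance_past_innov hρ (by omega)
  have h1 := variance_nonneg ((fun ω => ∑ i ∈ Finset.range (n + 1), ε ((0 : ℤ) + i) ω)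
    - u (n : ℤ)) P
  rw [variance_sub (h.memLp_sum 0 (n + 1)) (h.memLp_innov _), hcov, h.variance_innov] at h1
  have h2 : 0 < Var[fun ω => ∑ i ∈ Finset.range (n + 1), ε ((0 : ℤ) + i) ω; P] := by
    have : 0 < σu ^ 2 := by positivity
    linarith
  rw [← h.variance_mean hρ 0 (n + 1)]
  have e : (fun ω => (∑ i ∈ Finset.range (n + 1), ε ((0 : ℤ) + i) ω) / ((n + 1 : ℕ) : ℝ))
      = fun ω => (1 / ((n + 1 : ℕ) : ℝ)) * ∑ i ∈ Finset.range (n + 1), ε ((0 : ℤ) + i) ω := by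
    funext ω; ring
  rw [e, variance_const_mul]
  positivity

end IsStationaryAR1

end AR1

/-! ### Section means of the errors -/

/-- Truncation at level `B`. -/
noncomputable def clamp (B x : ℝ) : ℝ := max (-B) (min B x)

theorem measurable_clamp (B : ℝ) : Measurable (clamp B) := by unfold clamp; fun_prop

theorem abs_clamp_le {B : ℝ} (hB : 0 ≤ B) (x : ℝ) : |clamp B x| ≤ B :=
  abs_le.2 ⟨le_max_left _ _, max_le (by linarith) (min_le_left _ _)⟩

theorem clamp_of_abs_le {B x : ℝ} (h : |x| ≤ B) : clamp B x = x := by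
  rw [clamp, min_eq_right (abs_le.1 h).2, max_eq_right (abs_le.1 h).1]

theorem abs_sub_clamp_le {B : ℝ} (hB : 0 ≤ B) (x : ℝ) : |x - clamp B x| ≤ |x| := by
  unfold clamp
  rcases le_total x B with h1 | h1
  · rw [min_eq_right h1]
    rcases le_total (-B) x with h2 | h2
    · rw [max_eq_right h2]; simp
    · rw [max_eq_left h2, abs_of_nonpos (by linarith), abs_of_nonpos (by linarith)]; linarith
  · rw [min_eq_left h1, max_eq_right (by linarith), abs_of_nonneg (by linarith),
      abs_of_nonneg (by linarith)]
    linarith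

/-- An inequality, because for `j = 0` truncated subtraction makes the focal set empty; the bounds
on truncated means are needed for every index. -/
theorem card_focal_le (L r m j : ℕ) : (focal L r m j).card ≤ r * L - m := by
  rw [focal, Nat.card_Icc]
  rcases Nat.eq_zero_or_pos j with rfl | hj
  · simp
  · obtain ⟨i, rfl⟩ : ∃ i, j = i + 1 := ⟨j - 1, by omega⟩
    rw [Nat.add_sub_cancel, add_mul, one_mul]
    omega

theorem sum_focal {L r m j : ℕ} (hm : m < r * L) (hj : 1 ≤ j) (f : ℤ → ℝ) :
    ∑ t ∈ focal L r m j, f (t : ℤ)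
      = ∑ i ∈ Finset.range (r * L - m), f ((((j - 1) * (r * L) + 1 + m : ℕ) : ℤ) + i) := by
  obtain ⟨i, rfl⟩ : ∃ i, j = i + 1 := ⟨j - 1, by omega⟩
  rw [focal, Nat.add_sub_cancel, ← Finset.Ico_succ_right_eq_Icc, Finset.sum_Ico_eq_sum_range]
  have : Order.succ ((i + 1) * (r * L)) - (i * (r * L) + 1 + m) = r * L - m := by
    rw [Order.succ_eq_add_one, add_mul, one_mul]; omega
  rw [this]
  exact Finset.sum_congr rfl fun l _ => by push_cast; rfl

/-- Time indices of the innovations entering the truncated mean of section `j`. -/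
noncomputable def window (L r M j : ℕ) : Finset ℤ :=
  Finset.Icc ((((j - 1) * (r * L) : ℕ) : ℤ) + 1 - M) ((j * (r * L) : ℕ) : ℤ)

/-- The section mean of an AR(1) process with innovations `e`, truncated to `M` lags and to
innovations bounded by `B`. -/
noncomputable def truncMean (L r m M : ℕ) (ρ B : ℝ) (e : ℤ → ℝ) (j : ℕ) : ℝ :=
  (∑ t ∈ focal L r m j, ∑ l ∈ Finset.range M, ρ ^ l * clamp B (e ((t : ℤ) - l)))
    / ((r * L - m : ℕ) : ℝ)

theorem sub_mem_window {L r m M j t l : ℕ} (ht : t ∈ focal L r m j) (hl : l ∈ Finset.range M) :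
    (t : ℤ) - l ∈ window L r M j := by
  rw [focal, Finset.mem_Icc] at ht
  have := Finset.mem_range.1 hl
  rw [window, Finset.mem_Icc]
  omega

/-- A section has at least one period, so more than `M` sections of separation leave room for the
`M` lags. -/
theorem disjoint_window {L r m M i j : ℕ} (hm : m < r * L) (hij : i + M < j) :
    Disjoint (window L r M i) (window L r M j) := by
  have h1 : (i + M) * (r * L) ≤ (j - 1) * (r * L) := Nat.mul_le_mul_right _ (by omega)
  have h2 : M ≤ M * (r * L) := Nat.le_mul_of_pos_right _ (by omega)
  rw [add_mul] at h1
  rw [Finset.disjoint_left]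
  intro x hx hx'
  rw [window, Finset.mem_Icc] at hx hx'
  omega

theorem measurable_truncMean (L r m M : ℕ) (ρ B : ℝ) (j : ℕ) :
    Measurable (fun e : ℤ → ℝ => truncMean L r m M ρ B e j) := by
  unfold truncMean
  refine Measurable.div_const (Finset.measurable_sum _ fun t _ => Finset.measurable_sum _
    fun l _ => Measurable.const_mul ((measurable_clamp B).comp (measurable_pi_apply _)) _) _

theorem abs_truncMean_le {L r m : ℕ} (hm : m < r * L) (M : ℕ) {ρ B : ℝ} (hρ : |ρ| ≤ 1)
    (hB : 0 ≤ B) (e : ℤ → ℝ) (j : ℕ) : |truncMean L r m M ρ B e j| ≤ M * B := by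
  have hn : (0 : ℝ) < ((r * L - m : ℕ) : ℝ) := by exact_mod_cast Nat.sub_pos_of_lt hm
  have hcard : ((focal L r m j).card : ℝ) ≤ ((r * L - m : ℕ) : ℝ) := by
    exact_mod_cast card_focal_le L r m j
  rw [truncMean, abs_div, abs_of_pos hn, div_le_iff₀ hn]
  have hin : ∀ t ∈ focal L r m j,
      |∑ l ∈ Finset.range M, ρ ^ l * clamp B (e ((t : ℤ) - l))| ≤ M * B := by
    intro t _
    refine (Finset.abs_sum_le_sum_abs _ _).trans ?_
    have : ∀ l ∈ Finset.range M, |ρ ^ l * clamp B (e ((t : ℤ) - l))| ≤ B := fun l _ => by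
      rw [abs_mul, abs_pow]
      exact (mul_le_of_le_one_left (abs_nonneg _) (pow_le_one₀ (abs_nonneg _) hρ)).trans
        (abs_clamp_le hB _)
    refine (Finset.sum_le_sum this).trans (le_of_eq ?_)
    simp
  refine (Finset.abs_sum_le_sum_abs _ _).trans ((Finset.sum_le_sum hin).trans ?_)
  rw [Finset.sum_const, nsmul_eq_mul, mul_comm]
  gcongr

section

variable {Ω : Type*} [MeasurableSpace Ω] {P : Measure Ω}
  {ρ σu : ℝ} {u ε : ℤ → Ω → ℝ}

/-- Mean of the errors over the focal periods of section `j`. -/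
noncomputable def errMean (L r m : ℕ) (e : ℤ → ℝ) (j : ℕ) : ℝ :=
  (∑ t ∈ focal L r m j, e (t : ℤ)) / ((r * L - m : ℕ) : ℝ)

namespace IsStationaryAR1

theorem memLp_errMean (h : IsStationaryAR1 P ρ σu u ε) (L r m j : ℕ) :
    MemLp (fun ω => errMean L r m (fun t => ε t ω) j) 2 P := by
  have e : (fun ω => errMean L r m (fun t => ε t ω) j)
      = fun ω => ((r * L - m : ℕ) : ℝ)⁻¹ * ∑ t ∈ focal L r m j, ε (t : ℤ) ω := by
    funext ω; rw [errMean, div_eq_inv_mul]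
  rw [e]
  exact (memLp_finsetSum _ fun t _ => h.memLp _).const_mul _

theorem tendsto_truncation (h : IsStationaryAR1 P ρ σu u ε) :
    Tendsto (fun N : ℕ => ∫ ω, (u 0 ω - clamp N (u 0 ω)) ^ 2 ∂P) atTop (𝓝 0) := by
  have hm : Measurable (u 0) := h.innov_measurable 0
  have h0 : (0 : ℝ) = ∫ _, (0 : ℝ) ∂P := by simp
  rw [h0]
  refine tendsto_integral_of_dominated_convergence (fun ω => u 0 ω ^ 2) (fun N => ?_)
    h.innov_memLp.integrable_sq (fun N => ae_of_all _ fun ω => ?_) (ae_of_all _ fun ω => ?_)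
  · exact ((hm.sub ((measurable_clamp _).comp hm)).pow_const 2).aestronglyMeasurable
  · rw [Real.norm_of_nonneg (sq_nonneg _), ← sq_abs, ← sq_abs (u 0 ω)]
    exact pow_le_pow_left₀ (abs_nonneg _) (abs_sub_clamp_le N.cast_nonneg _) 2
  · refine tendsto_const_nhds.congr' ?_
    filter_upwards [tendsto_natCast_atTop_atTop.eventually (eventually_ge_atTop |u 0 ω|)]
      with N hN
    rw [clamp_of_abs_le hN]; simp

/-- The truncated mean is built from innovations, not from `ε`, so it depends only on those in its
window, and disjoint windows give exact independence. Extension by zero displays it as a measurable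
function of the windowed innovations. -/
theorem indepFun_truncMean (h : IsStationaryAR1 P ρ σu u ε) {L r m : ℕ} (hm : m < r * L)
    (M : ℕ) (B : ℝ) {i j : ℕ} (hij : i + M < j) :
    IndepFun (fun ω => truncMean L r m M ρ B (fun t => u t ω) i)
      (fun ω => truncMean L r m M ρ B (fun t => u t ω) j) P := by
  classical
  let ext : (W : Finset ℤ) → (W → ℝ) → ℤ → ℝ := fun W v t => if ht : t ∈ W then v ⟨t, ht⟩ else 0
  have hext : ∀ W, Measurable (ext W) := fun W => by
    refine measurable_pi_iff.2 fun t => ?_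
    by_cases ht : t ∈ W
    · simp only [ext, dif_pos ht]; fun_prop
    · simp only [ext, dif_neg ht]; fun_prop
  have hfac : ∀ k ω, truncMean L r m M ρ B (fun t => u t ω) k
      = truncMean L r m M ρ B (ext (window L r M k) (fun i => u i ω)) k := by
    intro k ω
    simp only [truncMean]
    congr 1
    refine Finset.sum_congr rfl fun t ht => Finset.sum_congr rfl fun l hl => ?_
    simp only [ext, dif_pos (sub_mem_window ht hl)]
  have hind := h.innov_indep.indepFun_finset _ _ (disjoint_window hm hij) h.innov_measurable
  have := hind.comp ((measurable_truncMean L r m M ρ B i).comp (hext _))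
    ((measurable_truncMean L r m M ρ B j).comp (hext _))
  simp only [hfac]
  exact this

variable [IsProbabilityMeasure P]

theorem integral_errMean_sq (h : IsStationaryAR1 P ρ σu u ε) (hρ : |ρ| < 1) {L r m : ℕ}
    (hm : m < r * L) (μ : ℝ) {j : ℕ} (hj : 1 ≤ j) :
    ∫ ω, (μ + errMean L r m (fun t => ε t ω) j) ^ 2 ∂P
      = ar1MeanVar σu ρ (r * L - m) + μ ^ 2 := by
  set η : Ω → ℝ := fun ω => errMean L r m (fun t => ε t ω) j with hη
  have hL := h.memLp_errMean L r m j
  have hi : Integrable η P := hL.integrable (by norm_num)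
  have h0 : ∫ ω, η ω ∂P = 0 := by
    simp only [hη, errMean]
    rw [integral_div, integral_finsetSum _ fun t _ => (h.memLp _).integrable (by norm_num)]
    simp [h.mean]
  have hv : ∫ ω, η ω ^ 2 ∂P = ar1MeanVar σu ρ (r * L - m) := by
    rw [← h.variance_mean hρ (((j - 1) * (r * L) + 1 + m : ℕ) : ℤ),
      ← variance_of_integral_eq_zero hL.aestronglyMeasurable.aemeasurable h0]
    congr 1
    funext ω
    simp only [errMean]
    rw [sum_focal hm hj (fun t => ε t ω)]
  have e : ∀ ω, (μ + η ω) ^ 2 = μ ^ 2 + (2 * μ * η ω + η ω ^ 2) := fun ω => by ring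
  have i1 : Integrable (fun ω => 2 * μ * η ω) P := hi.const_mul _
  have i2 : Integrable (fun ω => η ω ^ 2) P := hL.integrable_sq
  have i3 : Integrable (fun ω => 2 * μ * η ω + η ω ^ 2) P := i1.add i2
  change ∫ ω, (μ + η ω) ^ 2 ∂P = _
  simp_rw [e]
  rw [integral_add (integrable_const _) i3, integral_add i1 i2, integral_const_mul, h0, hv]
  simp
  ring

/-- In the expansion of `ε t` into `M` innovations and a remainder, the error splits into `ρ ^ M * ε
(t - M)` and the clipped parts of the innovations. Cauchy–Schwarz is used over the lags and over the
focal periods, whose number cancels against `n`. -/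
theorem integral_errMean_sub_truncMean_sq_le (h : IsStationaryAR1 P ρ σu u ε) (hρ : |ρ| ≤ 1)
    {L r m : ℕ} (hm : m < r * L) (M N : ℕ) (j : ℕ) :
    ∫ ω, (errMean L r m (fun t => ε t ω) j - truncMean L r m M ρ N (fun t => u t ω) j) ^ 2 ∂P
      ≤ 2 * (|ρ| ^ M) ^ 2 * Var[ε 0; P]
        + 2 * M * (M * ∫ ω, (u 0 ω - clamp N (u 0 ω)) ^ 2 ∂P) := by
  set n : ℝ := ((r * L - m : ℕ) : ℝ) with hn
  have hn0 : 0 < n := by rw [hn]; exact_mod_cast Nat.sub_pos_of_lt hm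
  have hcard : ((focal L r m j).card : ℝ) ≤ n := by
    rw [hn]; exact_mod_cast card_focal_le L r m j
  set τ := ∫ ω, (u 0 ω - clamp N (u 0 ω)) ^ 2 ∂P with hτ
  have hτ0 : 0 ≤ τ := integral_nonneg fun ω => sq_nonneg _
  have hclampL : ∀ t, MemLp (fun ω => clamp N (u t ω)) 2 P := fun t =>
    MemLp.of_bound ((measurable_clamp _).comp (h.innov_measurable t)).aestronglyMeasurable N
      (ae_of_all _ fun ω => by rw [Real.norm_eq_abs]; exact abs_clamp_le N.cast_nonneg _)
  have iu : ∀ t, Integrable (fun ω => (u t ω - clamp N (u t ω)) ^ 2) P := fun t =>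
    ((h.memLp_innov t).sub (hclampL t)).integrable_sq
  have eu : ∀ t, ∫ ω, (u t ω - clamp N (u t ω)) ^ 2 ∂P = τ := fun t =>
    ((h.innov_ident t).comp (u := fun x => (x - clamp N x) ^ 2)
      ((measurable_id.sub (measurable_clamp _)).pow_const 2)).integral_eq
  have iε : ∀ t, Integrable (fun ω => ε t ω ^ 2) P := fun t => (h.memLp t).integrable_sq
  have eε : ∀ t, ∫ ω, ε t ω ^ 2 ∂P = Var[ε 0; P] := fun t => by
    rw [← h.variance_eq t, variance_of_integral_eq_zero (h.measurable t).aemeasurable (h.mean t)]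
  set G : Ω → ℝ := fun ω => (1 / n) * ∑ t ∈ focal L r m j,
    (2 * (|ρ| ^ M) ^ 2 * ε ((t : ℤ) - M) ω ^ 2
      + 2 * M * ∑ l ∈ Finset.range M,
        (u ((t : ℤ) - l) ω - clamp N (u ((t : ℤ) - l) ω)) ^ 2) with hG
  have i1 : ∀ t : ℕ, Integrable (fun ω => 2 * (|ρ| ^ M) ^ 2 * ε ((t : ℤ) - M) ω ^ 2) P :=
    fun t => (iε _).const_mul _
  have i2 : ∀ t : ℕ, Integrable (fun ω => 2 * M * ∑ l ∈ Finset.range M,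
      (u ((t : ℤ) - l) ω - clamp N (u ((t : ℤ) - l) ω)) ^ 2) P :=
    fun t => (integrable_finsetSum _ fun l _ => iu _).const_mul _
  have i3 : ∀ t ∈ focal L r m j, Integrable (fun ω => 2 * (|ρ| ^ M) ^ 2 * ε ((t : ℤ) - M) ω ^ 2
      + 2 * M * ∑ l ∈ Finset.range M,
        (u ((t : ℤ) - l) ω - clamp N (u ((t : ℤ) - l) ω)) ^ 2) P :=
    fun t _ => (i1 t).add (i2 t)
  have iG : Integrable G P := (integrable_finsetSum _ i3).const_mul _
  have eG : ∫ ω, G ω ∂P ≤ 2 * (|ρ| ^ M) ^ 2 * Var[ε 0; P] + 2 * M * (M * τ) := by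
    have et : ∀ t ∈ focal L r m j, ∫ ω, (2 * (|ρ| ^ M) ^ 2 * ε ((t : ℤ) - M) ω ^ 2
        + 2 * M * ∑ l ∈ Finset.range M,
          (u ((t : ℤ) - l) ω - clamp N (u ((t : ℤ) - l) ω)) ^ 2) ∂P
        = 2 * (|ρ| ^ M) ^ 2 * Var[ε 0; P] + 2 * M * (M * τ) := by
      intro t _
      rw [integral_add (i1 t) (i2 t), integral_const_mul, integral_const_mul, eε,
        integral_finsetSum _ fun l _ => iu _]
      simp [eu]
    simp only [hG]
    rw [integral_const_mul, integral_finsetSum _ i3,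
      Finset.sum_congr rfl et, Finset.sum_const, nsmul_eq_mul, ← mul_assoc, one_div_mul_eq_div]
    refine mul_le_of_le_one_left ?_ ((div_le_one hn0).2 hcard)
    have := variance_nonneg (ε 0) P
    positivity
  refine (integral_mono_ae ?_ iG ?_).trans eG
  · refine MemLp.integrable_sq ((h.memLp_errMean L r m j).sub (MemLp.of_bound ?_ (M * N)
      (ae_of_all _ fun ω => ?_)))
    · exact ((measurable_truncMean L r m M ρ N j).comp
        (measurable_pi_iff.2 h.innov_measurable)).aestronglyMeasurable
    · rw [Real.norm_eq_abs]
      exact abs_truncMean_le hm M hρ N.cast_nonneg _ j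
  · filter_upwards [ae_all_iff.2 fun t : ℕ => h.iterate (t : ℤ) M] with ω hω
    have e : errMean L r m (fun t => ε t ω) j - truncMean L r m M ρ N (fun t => u t ω) j
        = (∑ t ∈ focal L r m j, (ρ ^ M * ε ((t : ℤ) - M) ω + ∑ l ∈ Finset.range M,
          ρ ^ l * (u ((t : ℤ) - l) ω - clamp N (u ((t : ℤ) - l) ω)))) / n := by
      rw [errMean, truncMean, ← sub_div, ← Finset.sum_sub_distrib]
      congr 1
      refine Finset.sum_congr rfl fun t _ => ?_
      rw [hω t]
      simp only [mul_sub, Finset.sum_sub_distrib]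
      ring
    have hpt : ∀ t ∈ focal L r m j, (ρ ^ M * ε ((t : ℤ) - M) ω + ∑ l ∈ Finset.range M,
          ρ ^ l * (u ((t : ℤ) - l) ω - clamp N (u ((t : ℤ) - l) ω))) ^ 2
        ≤ 2 * (|ρ| ^ M) ^ 2 * ε ((t : ℤ) - M) ω ^ 2 + 2 * M * ∑ l ∈ Finset.range M,
          (u ((t : ℤ) - l) ω - clamp N (u ((t : ℤ) - l) ω)) ^ 2 := by
      intro t _
      set a := ρ ^ M * ε ((t : ℤ) - M) ω with ha
      set c := ∑ l ∈ Finset.range M,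
          ρ ^ l * (u ((t : ℤ) - l) ω - clamp N (u ((t : ℤ) - l) ω)) with hc
      have h1 : c ^ 2 ≤ M * ∑ l ∈ Finset.range M,
          (u ((t : ℤ) - l) ω - clamp N (u ((t : ℤ) - l) ω)) ^ 2 := by
        refine (sq_sum_le_card_mul_sum_sq (s := Finset.range M)).trans ?_
        rw [Finset.card_range]
        refine mul_le_mul_of_nonneg_left (Finset.sum_le_sum fun l _ => ?_) M.cast_nonneg
        rw [mul_pow]
        refine mul_le_of_le_one_left (sq_nonneg _) ?_
        rw [← sq_abs, abs_pow]
        exact pow_le_one₀ (by positivity) (pow_le_one₀ (abs_nonneg _) hρ)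
      have h2 : a ^ 2 = (|ρ| ^ M) ^ 2 * ε ((t : ℤ) - M) ω ^ 2 := by
        rw [ha, mul_pow, ← abs_pow, sq_abs]
      nlinarith [sq_nonneg (a - c)]
    simp only [e, hG]
    rw [div_pow, div_le_iff₀ (by positivity)]
    refine (sq_sum_le_card_mul_sum_sq (s := focal L r m j)).trans ?_
    have hs := Finset.sum_le_sum hpt
    have e2 : ∀ x : ℝ, 1 / n * x * n ^ 2 = n * x := fun x => by field_simp
    rw [e2]
    exact mul_le_mul hcard hs (Finset.sum_nonneg fun _ _ => sq_nonneg _) hn0.le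

/-- With high probability the section means are balanced, uniformly over large sets of sections. -/
theorem errMean_balanced (h : IsStationaryAR1 P ρ σu u ε) (hρ : |ρ| < 1) {L r m : ℕ}
    (hm : m < r * L) (μ : ℝ) {κ : ℝ} (hκ : 0 < κ) {δ : ℝ} (hδ : 0 < δ) :
    ∃ K : ℕ, ∀ S : Finset ℕ, (∀ j ∈ S, 1 ≤ j) → K ≤ S.card →
      P.real {ω | ¬ Balanced (ar1MeanVar σu ρ (r * L - m) + μ ^ 2) κ S
        (fun j => μ + errMean L r m (fun t => ε t ω) j)} ≤ δ := by
  refine measureReal_not_balanced_le (I := {j | 1 ≤ j})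
    (ξ := fun j ω => μ + errMean L r m (fun t => ε t ω) j)
    (fun j _ => (memLp_const μ).add (h.memLp_errMean L r m j))
    (fun j hj => h.integral_errMean_sq hρ hm μ hj) (fun η hη => ?_) hκ hδ
  have hV := variance_nonneg (ε 0) P
  have l1 : Tendsto (fun M : ℕ => 2 * (|ρ| ^ M) ^ 2 * Var[ε 0; P]) atTop (𝓝 0) := by
    have := (((tendsto_pow_atTop_nhds_zero_of_lt_one (abs_nonneg ρ) hρ).pow 2).const_mul
      2).mul_const Var[ε 0; P]
    simpa using this
  -- Order matters: the number of lags `M` is fixed first, and the clipping level `N` is chosen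
  -- depending on it, because the clipping error carries a factor `M ^ 2`.
  obtain ⟨M, hM⟩ := (l1.eventually (gt_mem_nhds (half_pos hη))).exists
  have l2 : Tendsto (fun N : ℕ => 2 * M * (M * ∫ ω, (u 0 ω - clamp N (u 0 ω)) ^ 2 ∂P)) atTop
      (𝓝 0) := by
    simpa using (h.tendsto_truncation.const_mul (M : ℝ)).const_mul (2 * (M : ℝ))
  obtain ⟨N, hN⟩ := (l2.eventually (gt_mem_nhds (half_pos hη))).exists
  refine ⟨|μ| + M * N, M, fun j ω => μ + truncMean L r m M ρ N (fun t => u t ω) j,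
    fun j => ?_, fun j ω => ?_, fun j _ => ?_, fun i _ j _ hij => ?_⟩
  · exact ((measurable_truncMean L r m M ρ N j).comp
      (measurable_pi_iff.2 h.innov_measurable)).const_add μ
  · exact (abs_add_le _ _).trans (add_le_add_right
      (abs_truncMean_le hm M hρ.le N.cast_nonneg _ j) _)
  · have := h.integral_errMean_sub_truncMean_sq_le hρ.le hm M N j
    simp only [add_sub_add_left_eq_sub]
    linarith
  · exact (h.indepFun_truncMean hm M N hij).comp (measurable_const_add μ) (measurable_const_add μ)

end IsStationaryAR1

end

/-! ### The design -/

/-- All blocks of section `j` receive the assignment `b`. -/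
def allEq (r j : ℕ) (b : Bool) : Set (ℕ → Bool) := {w | ∀ k ∈ sectionBlocks r j, w k = b}

/-- The sections in `A` are constant at `true`, those in `S \ A` constant at `false`, and the others
are not constant. -/
def cellAt (r : ℕ) (S A : Finset ℕ) (j : ℕ) : Set (ℕ → Bool) :=
  if j ∈ A then allEq r j true
  else if j ∈ S then allEq r j false
  else (allEq r j true ∪ allEq r j false)ᶜ

theorem first_mem_sectionBlocks {r j : ℕ} (hr : 1 ≤ r) (hj : 1 ≤ j) :
    (j - 1) * r + 1 ∈ sectionBlocks r j := by
  obtain ⟨i, rfl⟩ : ∃ i, j = i + 1 := ⟨j - 1, by omega⟩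
  rw [sectionBlocks, Finset.mem_Icc, Nat.add_sub_cancel, add_mul, one_mul]
  omega

theorem card_sectionBlocks {r j : ℕ} (hj : 1 ≤ j) : (sectionBlocks r j).card = r := by
  obtain ⟨i, rfl⟩ : ∃ i, j = i + 1 := ⟨j - 1, by omega⟩
  rw [sectionBlocks, Nat.card_Icc, Nat.add_sub_cancel, add_mul, one_mul]
  omega

theorem mem_allEq_label {r j : ℕ} {w : ℕ → Bool} (hr : 1 ≤ r) (hj : 1 ≤ j)
    (h : IsConst r w j) : w ∈ allEq r j (label r w j) :=
  fun k hk => h k hk _ (first_mem_sectionBlocks hr hj)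

theorem label_of_allEq {r j : ℕ} {w : ℕ → Bool} {b : Bool} (hr : 1 ≤ r) (hj : 1 ≤ j)
    (h : w ∈ allEq r j b) : label r w j = b := h _ (first_mem_sectionBlocks hr hj)

theorem isConst_of_allEq {r j : ℕ} {w : ℕ → Bool} {b : Bool} (h : w ∈ allEq r j b) :
    IsConst r w j := fun k hk k' hk' => (h k hk).trans (h k' hk').symm

theorem mem_usable {r J j : ℕ} {w : ℕ → Bool} :
    j ∈ usable r J w ↔ (1 ≤ j ∧ j ≤ J) ∧ IsConst r w j := by
  classical simp only [usable, Finset.mem_filter, Finset.mem_Icc]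

/-- Fixing the usable set and its labels imposes a separate condition on each section; this product
form is what independence can use. -/
theorem cell_iff {r J : ℕ} (hr : 1 ≤ r) {S A : Finset ℕ} (hS : S ⊆ Finset.Icc 1 J) (hA : A ⊆ S)
    (w : ℕ → Bool) :
    (usable r J w = S ∧ ∀ j ∈ S, label r w j = lab A j)
      ↔ ∀ j ∈ Finset.Icc 1 J, w ∈ cellAt r S A j := by
  constructor
  · rintro ⟨rfl, hl⟩ j hj
    have hj1 := (Finset.mem_Icc.1 hj).1
    unfold cellAt
    split_ifs with h1 h2
    · have := mem_allEq_label hr hj1 (mem_usable.1 (hA h1)).2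
      rwa [hl j (hA h1), lab, decide_eq_true h1] at this
    · have := mem_allEq_label hr hj1 (mem_usable.1 h2).2
      rwa [hl j h2, lab, decide_eq_false h1] at this
    · rintro (h | h)
      · exact h2 (mem_usable.2 ⟨Finset.mem_Icc.1 hj, isConst_of_allEq h⟩)
      · exact h2 (mem_usable.2 ⟨Finset.mem_Icc.1 hj, isConst_of_allEq h⟩)
  · intro h
    have key : ∀ j ∈ S, w ∈ allEq r j (lab A j) := by
      intro j hj
      have := h j (hS hj)
      unfold cellAt at this
      by_cases h1 : j ∈ A
      · rw [if_pos h1] at this; rwa [lab, decide_eq_true h1]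
      · rw [if_neg h1, if_pos hj] at this; rwa [lab, decide_eq_false h1]
    refine ⟨Finset.ext fun j => ⟨fun hj => ?_, fun hj => ?_⟩, fun j hj => ?_⟩
    · by_contra hcon
      obtain ⟨h1, h2⟩ := mem_usable.1 hj
      have := h j (Finset.mem_Icc.2 h1)
      rw [cellAt, if_neg (fun h => hcon (hA h)), if_neg hcon] at this
      have h3 := mem_allEq_label hr h1.1 h2
      cases hb : label r w j
      · exact this (Or.inr (hb ▸ h3))
      · exact this (Or.inl (hb ▸ h3))
    · exact mem_usable.2 ⟨Finset.mem_Icc.1 (hS hj), isConst_of_allEq (key j hj)⟩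
    · exact label_of_allEq hr (Finset.mem_Icc.1 (hS hj)).1 (key j hj)

theorem allEq_eq_iInter (r j : ℕ) (b : Bool) :
    allEq r j b = ⋂ k ∈ sectionBlocks r j, {w : ℕ → Bool | w k = b} := by
  ext w; simp [allEq]

theorem measurableSet_allEq (r j : ℕ) (b : Bool) : MeasurableSet (allEq r j b) := by
  rw [allEq_eq_iInter]
  exact Finset.measurableSet_biInter _ fun k _ =>
    measurableSet_eq_fun (measurable_pi_apply k) measurable_const

theorem measurableSet_cellAt (r : ℕ) (S A : Finset ℕ) (j : ℕ) :
    MeasurableSet (cellAt r S A j) := by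
  unfold cellAt
  split_ifs
  · exact measurableSet_allEq _ _ _
  · exact measurableSet_allEq _ _ _
  · exact ((measurableSet_allEq _ _ _).union (measurableSet_allEq _ _ _)).compl

/-- The cell of the design where the usable sections are `S` and the treated ones among them `A`. -/
def cell (r J : ℕ) (S A : Finset ℕ) : Set (ℕ → Bool) :=
  {w | usable r J w = S ∧ ∀ j ∈ S, label r w j = lab A j}

theorem cell_eq {r J : ℕ} (hr : 1 ≤ r) {S A : Finset ℕ} (hS : S ⊆ Finset.Icc 1 J) (hA : A ⊆ S) :
    cell r J S A = ⋂ j ∈ Finset.Icc 1 J, cellAt r S A j := by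
  ext w
  rw [cell, Set.mem_ofPred_eq, cell_iff hr hS hA]
  simp only [Set.mem_iInter]

theorem measurableSet_cell {r J : ℕ} (hr : 1 ≤ r) {S A : Finset ℕ} (hS : S ⊆ Finset.Icc 1 J)
    (hA : A ⊆ S) : MeasurableSet (cell r J S A) := by
  rw [cell_eq hr hS hA]
  exact Finset.measurableSet_biInter _ fun j _ => measurableSet_cellAt _ _ _ _

section

variable {Ω : Type*} [MeasurableSpace Ω] {P : Measure Ω}

/-- Events about different sections are independent. -/
theorem measure_iInter_sections {W : ℕ → Ω → Bool} (hWm : ∀ k, Measurable (W k))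
    (hW : iIndepFun W P) (r : ℕ) {F : ℕ → Set Ω}
    (hF : ∀ j, MeasurableSet[⨆ k ∈ (sectionBlocks r j : Set ℕ),
      MeasurableSpace.comap (W k) inferInstance] (F j)) (J : ℕ) :
    P (⋂ j ∈ Finset.Icc 1 J, F j) = ∏ j ∈ Finset.Icc 1 J, P (F j) := by
  have := hW.isProbabilityMeasure
  -- The first `J` sections use only blocks up to `J * r`, which are disjoint from the blocks of
  -- section `J + 1`.
  have hpast : ∀ J : ℕ, MeasurableSet[⨆ k ∈ (Finset.Icc 1 (J * r) : Set ℕ),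
      MeasurableSpace.comap (W k) inferInstance] (⋂ j ∈ Finset.Icc 1 J, F j) := by
    intro J
    refine Finset.measurableSet_biInter _ fun j hj => ?_
    refine (biSup_mono (f := fun k => MeasurableSpace.comap (W k) inferInstance)
      fun k hk => ?_ : _ ≤ _) _ (hF j)
    rw [Finset.mem_coe, sectionBlocks, Finset.mem_Icc] at hk
    rw [Finset.mem_coe, Finset.mem_Icc]
    have h1 := (Finset.mem_Icc.1 hj).2
    have h2 : j * r ≤ J * r := Nat.mul_le_mul_right _ h1
    omega
  induction J with
  | zero => simp
  | succ J ih =>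
    rw [← Finset.insert_Icc_right_eq_Icc_add_one (by omega : 1 ≤ J + 1),
      Finset.prod_insert (by simp), Finset.set_biInter_insert, ← ih]
    have hind := indep_iSup_of_disjoint (μ := P) (fun k => (hWm k).comap_le)
      ((iIndepFun_iff_iIndep _ _ _).1 hW)
      (S := (sectionBlocks r (J + 1) : Set ℕ)) (T := (Finset.Icc 1 (J * r) : Set ℕ)) (by
        rw [Set.disjoint_left]
        intro k hk hk'
        rw [Finset.mem_coe, sectionBlocks, Finset.mem_Icc, Nat.add_sub_cancel] at hk
        rw [Finset.mem_coe, Finset.mem_Icc] at hk'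
        omega)
    exact (Indep_iff _ _ _).1 hind _ _ (hF (J + 1)) (hpast J)

end

/-! ### Probabilities of the design -/

/-- The probability that a section is usable. -/
noncomputable def usableProb (r : ℕ) (q : ℝ) : ℝ := q ^ r + (1 - q) ^ r

theorem usableProb_pos {q : ℝ} (hq0 : 0 < q) (hq1 : q < 1) (r : ℕ) : 0 < usableProb r q := by
  have : 0 < 1 - q := by linarith
  unfold usableProb; positivity

theorem usableProb_le_one {q : ℝ} (hq0 : 0 < q) (hq1 : q < 1) {r : ℕ} (hr : 1 ≤ r) :
    usableProb r q ≤ 1 := by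
  have h1 := pow_le_of_le_one hq0.le hq1.le (by omega : r ≠ 0)
  have h2 := pow_le_of_le_one (by linarith : 0 ≤ 1 - q) (by linarith) (by omega : r ≠ 0)
  unfold usableProb; linarith

theorem pooledProb_pos {q : ℝ} (hq0 : 0 < q) (hq1 : q < 1) (r : ℕ) : 0 < pooledProb r q := by
  have : 0 < 1 - q := by linarith
  unfold pooledProb; positivity

theorem pooledProb_lt_one {q : ℝ} (hq0 : 0 < q) (hq1 : q < 1) (r : ℕ) : pooledProb r q < 1 := by
  have : 0 < 1 - q := by linarith
  have : 0 < (1 - q) ^ r := by positivity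
  rw [pooledProb, div_lt_one (by positivity)]
  linarith

theorem usableProb_mul_pooledProb {q : ℝ} (hq0 : 0 < q) (hq1 : q < 1) (r : ℕ) :
    usableProb r q * pooledProb r q = q ^ r :=
  mul_div_cancel₀ _ (usableProb_pos hq0 hq1 r).ne'

theorem usableProb_mul_one_sub {q : ℝ} (hq0 : 0 < q) (hq1 : q < 1) (r : ℕ) :
    usableProb r q * (1 - pooledProb r q) = (1 - q) ^ r := by
  rw [mul_sub, usableProb_mul_pooledProb hq0 hq1, usableProb]; ring

theorem IsDesign.measurable_path {Ω : Type*} [MeasurableSpace Ω] {P : Measure Ω} {q : ℝ}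
    {W : ℕ → Ω → Bool} (hW : IsDesign P q W) : Measurable (fun ω k => W k ω) :=
  measurable_pi_lambda _ hW.measurable

section

variable {Ω : Type*} [MeasurableSpace Ω] {P : Measure Ω} [IsProbabilityMeasure P]
  {q : ℝ} {W : ℕ → Ω → Bool}

theorem IsDesign.measureReal_eq (hW : IsDesign P q W) (k : ℕ) (b : Bool) :
    P.real {ω | W k ω = b} = if b then q else 1 - q := by
  cases b
  · have : {ω | W k ω = false} = {ω | W k ω = true}ᶜ := by ext ω; simp
    rw [this, probReal_compl_eq_one_sub
      (measurableSet_eq_fun (hW.measurable k) measurable_const), hW.prob]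
    simp
  · simpa using hW.prob k

theorem IsDesign.measureReal_allEq (hW : IsDesign P q W) (r : ℕ) {j : ℕ} (hj : 1 ≤ j) (b : Bool) :
    P.real {ω | (fun k => W k ω) ∈ allEq r j b} = (if b then q else 1 - q) ^ r := by
  have h1 : {ω | (fun k => W k ω) ∈ allEq r j b}
      = ⋂ k ∈ sectionBlocks r j, {ω | W k ω = b} := by
    ext ω; simp [allEq]
  have h2 := hW.indep.meas_biInter (S := sectionBlocks r j) (s := fun k => {ω | W k ω = b})
    fun k _ => ⟨{b}, measurableSet_singleton b, rfl⟩
  rw [h1, Measure.real, h2, ENNReal.toReal_prod]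
  have h3 : ∀ k ∈ sectionBlocks r j, (P {ω | W k ω = b}).toReal = if b then q else 1 - q :=
    fun k _ => hW.measureReal_eq k b
  rw [Finset.prod_congr rfl h3, Finset.prod_const, card_sectionBlocks hj]

theorem IsDesign.measureReal_cellAt (hW : IsDesign P q W) {r : ℕ} (hr : 1 ≤ r) (S A : Finset ℕ)
    {j : ℕ} (hj : 1 ≤ j) :
    P.real {ω | (fun k => W k ω) ∈ cellAt r S A j}
      = if j ∈ A then q ^ r else if j ∈ S then (1 - q) ^ r else 1 - usableProb r q := by
  unfold cellAt
  split_ifs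
  · simpa using hW.measureReal_allEq r hj true
  · simpa using hW.measureReal_allEq r hj false
  · have h1 : {ω | (fun k => W k ω) ∈ (allEq r j true ∪ allEq r j false)ᶜ}
        = ({ω | (fun k => W k ω) ∈ allEq r j true} ∪ {ω | (fun k => W k ω) ∈ allEq r j false})ᶜ :=
      rfl
    have hm : ∀ b, MeasurableSet {ω | (fun k => W k ω) ∈ allEq r j b} :=
      fun b => hW.measurable_path (measurableSet_allEq r j b)
    rw [h1, probReal_compl_eq_one_sub ((hm _).union (hm _)), measureReal_union ?_ (hm _),
      hW.measureReal_allEq r hj, hW.measureReal_allEq r hj]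
    · simp [usableProb]
    · rw [Set.disjoint_left]
      intro ω h1 h2
      have := (label_of_allEq hr hj h1).symm.trans (label_of_allEq hr hj h2)
      simp at this

/-- A section is all treated, all control or not constant with probabilities `q ^ r = π * p`, `(1 -
q) ^ r = π * (1 - p)` and `1 - π`, where `π = usableProb r q`. The factorization shows that
Bernoulli(`p`) relabelling is the true conditional law of the labels given the usable set. -/
theorem IsDesign.measureReal_cell (hW : IsDesign P q W) (hq0 : 0 < q) (hq1 : q < 1)
    {r J : ℕ} (hr : 1 ≤ r) {S A : Finset ℕ} (hS : S ⊆ Finset.Icc 1 J) (hA : A ⊆ S) :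
    P.real {ω | (fun k => W k ω) ∈ cell r J S A}
      = usableProb r q ^ S.card * (1 - usableProb r q) ^ (J - S.card)
        * (pooledProb r q ^ A.card * (1 - pooledProb r q) ^ (S.card - A.card)) := by
  have h1 : {ω | (fun k => W k ω) ∈ cell r J S A}
      = ⋂ j ∈ Finset.Icc 1 J, {ω | (fun k => W k ω) ∈ cellAt r S A j} := by
    rw [cell_eq hr hS hA]; ext ω; simp
  have hF : ∀ j, MeasurableSet[⨆ k ∈ (sectionBlocks r j : Set ℕ),
      MeasurableSpace.comap (W k) inferInstance] {ω | (fun k => W k ω) ∈ cellAt r S A j} := by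
    intro j
    have hb : ∀ b, MeasurableSet[⨆ k ∈ (sectionBlocks r j : Set ℕ),
        MeasurableSpace.comap (W k) inferInstance] {ω | (fun k => W k ω) ∈ allEq r j b} := by
      intro b
      have : {ω | (fun k => W k ω) ∈ allEq r j b}
          = ⋂ k ∈ sectionBlocks r j, {ω | W k ω = b} := by ext ω; simp [allEq]
      rw [this]
      refine Finset.measurableSet_biInter _ fun k hk => ?_
      refine (le_biSup (fun k => MeasurableSpace.comap (W k) inferInstance)
        (Finset.mem_coe.2 hk) : _ ≤ _) _ ?_
      exact ⟨{b}, measurableSet_singleton b, rfl⟩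
    unfold cellAt
    split_ifs
    · exact hb _
    · exact hb _
    · exact MeasurableSet.compl (MeasurableSet.union (hb true) (hb false))
  rw [h1, Measure.real, measure_iInter_sections hW.measurable hW.indep r hF, ENNReal.toReal_prod]
  have h2 : ∀ j ∈ Finset.Icc 1 J, (P {ω | (fun k => W k ω) ∈ cellAt r S A j}).toReal
      = if j ∈ A then q ^ r else if j ∈ S then (1 - q) ^ r else 1 - usableProb r q :=
    fun j hj => hW.measureReal_cellAt hr S A (Finset.mem_Icc.1 hj).1
  rw [Finset.prod_congr rfl h2, ← Finset.prod_sdiff hS, ← Finset.prod_sdiff hA]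
  have e1 : ∏ j ∈ Finset.Icc 1 J \ S,
      (if j ∈ A then q ^ r else if j ∈ S then (1 - q) ^ r else 1 - usableProb r q)
        = (1 - usableProb r q) ^ (J - S.card) := by
    have : ∀ j ∈ Finset.Icc 1 J \ S,
        (if j ∈ A then q ^ r else if j ∈ S then (1 - q) ^ r else 1 - usableProb r q)
          = 1 - usableProb r q := fun j hj => by
      have h := (Finset.mem_sdiff.1 hj).2
      rw [if_neg (fun h' => h (hA h')), if_neg h]
    rw [Finset.prod_congr rfl this, Finset.prod_const, Finset.card_sdiff_of_subset hS,
      Nat.card_Icc, Nat.add_sub_cancel]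
  have e2 : ∏ j ∈ S \ A,
      (if j ∈ A then q ^ r else if j ∈ S then (1 - q) ^ r else 1 - usableProb r q)
        = ((1 - q) ^ r) ^ (S.card - A.card) := by
    have : ∀ j ∈ S \ A,
        (if j ∈ A then q ^ r else if j ∈ S then (1 - q) ^ r else 1 - usableProb r q)
          = (1 - q) ^ r := fun j hj => by
      have h := Finset.mem_sdiff.1 hj
      rw [if_neg h.2, if_pos h.1]
    rw [Finset.prod_congr rfl this, Finset.prod_const, Finset.card_sdiff_of_subset hA]
  have e3 : ∏ j ∈ A,
      (if j ∈ A then q ^ r else if j ∈ S then (1 - q) ^ r else 1 - usableProb r q)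
        = (q ^ r) ^ A.card := by
    rw [Finset.prod_congr rfl fun j hj => if_pos hj, Finset.prod_const]
  rw [e1, e2, e3, ← usableProb_mul_pooledProb hq0 hq1 r, ← usableProb_mul_one_sub hq0 hq1 r,
    mul_pow, mul_pow]
  have h4 : usableProb r q ^ S.card
      = usableProb r q ^ A.card * usableProb r q ^ (S.card - A.card) := by
    rw [← pow_add, Nat.add_sub_cancel' (Finset.card_le_card hA)]
  rw [h4]; ring

theorem usable_subset (r J : ℕ) (w : ℕ → Bool) : usable r J w ⊆ Finset.Icc 1 J := fun _ hj =>
  Finset.mem_Icc.2 (mem_usable.1 hj).1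

theorem mem_cell_labels (r J : ℕ) (w : ℕ → Bool) :
    w ∈ cell r J (usable r J w) ((usable r J w).filter fun j => label r w j = true) := by
  refine ⟨rfl, fun j hj => ?_⟩
  cases hb : label r w j <;> simp [lab, hj, hb]

theorem eq_of_mem_cell {r J : ℕ} {w : ℕ → Bool} {S A : Finset ℕ} (hA : A ⊆ S)
    (h : w ∈ cell r J S A) : A = S.filter fun j => label r w j = true := by
  ext j
  rw [Finset.mem_filter]
  constructor
  · intro hj
    refine ⟨hA hj, ?_⟩
    rw [h.2 j (hA hj), lab, decide_eq_true hj]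
  · rintro ⟨hj, hl⟩
    rw [h.2 j hj, lab] at hl
    exact of_decide_eq_true hl

open Classical in
/-- Joint probabilities of the design and the errors: the usable sections form a Bernoulli subset,
the treated ones a Bernoulli subset thereof, and the errors are independent of both. -/
theorem IsDesign.measureReal_usable_inter (hW : IsDesign P q W) (hq0 : 0 < q) (hq1 : q < 1)
    {ε : ℤ → Ω → ℝ} (hε : ∀ t, Measurable (ε t))
    (hWε : IndepFun (fun ω k => W k ω) (fun ω t => ε t ω) P) {r : ℕ} (hr : 1 ≤ r) (J : ℕ)
    (C : Finset ℕ → Prop) {R : (ℕ → Bool) → (ℤ → ℝ) → Prop}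
    {G : Finset ℕ → Finset ℕ → Set (ℤ → ℝ)} (hG : ∀ S A, MeasurableSet (G S A))
    (hR : ∀ S ⊆ Finset.Icc 1 J, ∀ A ⊆ S, ∀ w ∈ cell r J S A, ∀ e, R w e ↔ e ∈ G S A) :
    P.real {ω | C (usable r J fun i => W i ω) ∧ R (fun i => W i ω) (fun t => ε t ω)}
      = bexp (usableProb r q) (Finset.Icc 1 J) (fun S => if C S then
          bexp (pooledProb r q) S (fun A => P.real {ω | (fun t => ε t ω) ∈ G S A}) else 0) := by
  have hεm : Measurable (fun ω t => ε t ω) := measurable_pi_lambda _ hε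
  set I : Finset ((_ : Finset ℕ) × Finset ℕ) :=
    ((Finset.Icc 1 J).powerset.filter C).sigma fun S => S.powerset with hI
  have hmem : ∀ x ∈ I, (x.1 ⊆ Finset.Icc 1 J ∧ C x.1) ∧ x.2 ⊆ x.1 := fun x hx => by
    rw [hI, Finset.mem_sigma, Finset.mem_filter, Finset.mem_powerset, Finset.mem_powerset] at hx
    exact hx
  -- The event is cut into disjoint pieces indexed by the usable set and the treated part of it; on
  -- each piece `R` is a condition on the errors alone.
  have hset : {ω | C (usable r J fun i => W i ω) ∧ R (fun i => W i ω) (fun t => ε t ω)}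
      = ⋃ x ∈ I, (fun ω k => W k ω) ⁻¹' cell r J x.1 x.2 ∩
          (fun ω t => ε t ω) ⁻¹' G x.1 x.2 := by
    ext ω
    simp only [Set.mem_ofPred_eq, Set.mem_iUnion, Set.mem_inter_iff, Set.mem_preimage, exists_prop]
    constructor
    · rintro ⟨hC, hRω⟩
      have hc := mem_cell_labels r J (fun i => W i ω)
      refine ⟨⟨_, _⟩, ?_, hc,
        (hR _ (usable_subset _ _ _) _ (Finset.filter_subset _ _) _ hc _).1 hRω⟩
      rw [hI, Finset.mem_sigma, Finset.mem_filter, Finset.mem_powerset, Finset.mem_powerset]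
      exact ⟨⟨usable_subset _ _ _, hC⟩, Finset.filter_subset _ _⟩
    · rintro ⟨x, hx, hc, hg⟩
      obtain ⟨⟨h1, h2⟩, h3⟩ := hmem x hx
      refine ⟨?_, (hR _ h1 _ h3 _ hc _).2 hg⟩
      rw [hc.1]; exact h2
  rw [hset, measureReal_biUnion_finset]
  · have hx : ∀ x ∈ I, P.real ((fun ω k => W k ω) ⁻¹' cell r J x.1 x.2 ∩
          (fun ω t => ε t ω) ⁻¹' G x.1 x.2)
        = usableProb r q ^ x.1.card * (1 - usableProb r q) ^ (J - x.1.card)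
          * (pooledProb r q ^ x.2.card * (1 - pooledProb r q) ^ (x.1.card - x.2.card)
            * P.real {ω | (fun t => ε t ω) ∈ G x.1 x.2}) := by
      intro x hx
      obtain ⟨⟨h1, h2⟩, h3⟩ := hmem x hx
      have h4 := hW.measureReal_cell hq0 hq1 hr h1 h3
      have h5 := hWε.measure_inter_preimage_eq_mul _ _ (measurableSet_cell hr h1 h3) (hG x.1 x.2)
      rw [Measure.real, h5, ENNReal.toReal_mul, ← mul_assoc]
      exact congrArg₂ (· * ·) h4 rfl
    rw [Finset.sum_congr rfl hx, hI, Finset.sum_sigma, Finset.sum_filter, bexp, Nat.card_Icc,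
      Nat.add_sub_cancel]
    refine Finset.sum_congr rfl fun S _ => ?_
    split_ifs
    · rw [bexp, Finset.mul_sum]
    · rw [mul_zero]
  · intro x hx y hy hxy
    refine Set.disjoint_left.2 fun ω h1 h2 => hxy ?_
    have hS : x.1 = y.1 := h1.1.1.symm.trans h2.1.1
    have hA1 := eq_of_mem_cell (hmem x hx).2 h1.1
    have hA2 := eq_of_mem_cell (hmem y hy).2 h2.1
    rcases x with ⟨S, A⟩
    rcases y with ⟨S', A'⟩
    obtain rfl : S = S' := hS
    obtain rfl : A = A' := hA1.trans hA2.symm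
    rfl
  · intro x hx
    obtain ⟨⟨h1, h2⟩, h3⟩ := hmem x hx
    exact (hW.measurable_path (measurableSet_cell hr h1 h3)).inter (hεm (hG _ _))

/-- The usable sections form a Bernoulli subset of all sections. -/
theorem IsDesign.measureReal_usable (hW : IsDesign P q W) (hq0 : 0 < q) (hq1 : q < 1)
    {r : ℕ} (hr : 1 ≤ r) (J : ℕ) (C : Finset ℕ → Prop) :
    P.real {ω | C (usable r J fun i => W i ω)}
      = bprob (usableProb r q) (Finset.Icc 1 J) C := by
  classical
  have h := hW.measureReal_usable_inter hq0 hq1 (ε := fun _ _ => 0) (fun _ => measurable_const)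
    (indepFun_const_right _ _) hr J C (R := fun _ _ => True) (G := fun _ _ => Set.univ)
    (fun _ _ => MeasurableSet.univ) (fun _ _ _ _ _ _ _ => by simp)
  simpa [bexp_const, bprob] using h

/-- The number of usable sections tends to infinity in probability. -/
theorem IsDesign.tendsto_numUsable_lt (hW : IsDesign P q W) (hq0 : 0 < q) (hq1 : q < 1)
    {r : ℕ} (hr : 1 ≤ r) (K : ℕ) :
    Tendsto (fun J => P.real {ω | numUsable r J (fun i => W i ω) < K}) atTop (𝓝 0) := by
  have hπ0 := usableProb_pos hq0 hq1 r
  have hπ1 := usableProb_le_one hq0 hq1 hr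
  set π := usableProb r q with hπ
  have hb : ∀ᶠ J : ℕ in atTop, P.real {ω | numUsable r J (fun i => W i ω) < K}
      ≤ (4 / π ^ 2) * (1 / (J : ℝ)) := by
    filter_upwards [eventually_ge_atTop ⌈2 * K / π⌉₊, eventually_gt_atTop 0] with J hJ hJ0
    have hJ' : (0 : ℝ) < J := by exact_mod_cast hJ0
    have hJK : 2 * K ≤ π * J := by
      have := (Nat.ceil_le.1 hJ)
      rw [div_le_iff₀ hπ0] at this; linarith
    have h1 := hW.measureReal_usable hq0 hq1 hr J (fun S => S.card < K)
    have h2 : bprob π (Finset.Icc 1 J) (fun S => S.card < K)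
        ≤ bexp π (Finset.Icc 1 J) (fun A => (0 + ∑ j ∈ Finset.Icc 1 J,
          (fun (_ : ℕ) b => ind b - π) j (decide (j ∈ A))) ^ 2) / (π * J / 2) ^ 2 := by
      -- Since `K ≤ π * J / 2`, fewer than `K` usable sections means a deviation of at least `π * J
      -- / 2` from the mean `π * J`.
      refine bprob_le_sq_div hπ0.le hπ1 (by positivity) fun A hA hC => ?_
      have h3 : ∑ j ∈ Finset.Icc 1 J, (ind (decide (j ∈ A)) - π) = A.card - J * π := by
        have h4 : ∑ j ∈ Finset.Icc 1 J, ind (decide (j ∈ A)) = A.card := by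
          simp only [ind, decide_eq_true_eq]
          rw [← Finset.sum_filter, Finset.filter_mem_eq_inter, Finset.inter_eq_right.2 hA]
          simp
        rw [Finset.sum_sub_distrib, h4]; simp
      have h5 : (A.card : ℝ) ≤ K := by exact_mod_cast hC.le
      simp only [h3, zero_add]
      rw [abs_of_nonpos (by linarith)]
      linarith
    rw [bexp_sq_sum π _ (fun _ b => ind b - π) (fun _ _ => by simp [ind]; ring)] at h2
    have h6 : (0 : ℝ) ^ 2 + ∑ _j ∈ Finset.Icc 1 J,
        (π * (ind true - π) ^ 2 + (1 - π) * (ind false - π) ^ 2) ≤ J := by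
      simp only [ind, Finset.sum_const, Nat.card_Icc, Nat.add_sub_cancel, nsmul_eq_mul]
      have : π * (1 - π) ^ 2 + (1 - π) * π ^ 2 ≤ 1 := by
        have : π * (1 - π) ^ 2 + (1 - π) * π ^ 2 = π * (1 - π) := by ring
        nlinarith
      simp
      nlinarith
    calc P.real {ω | numUsable r J (fun i => W i ω) < K}
        = bprob π (Finset.Icc 1 J) (fun S => S.card < K) := h1
      _ ≤ J / (π * J / 2) ^ 2 := h2.trans (by gcongr)
      _ = (4 / π ^ 2) * (1 / (J : ℝ)) := by field_simp; norm_num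
  refine squeeze_zero' (Eventually.of_forall fun _ => measureReal_nonneg) hb ?_
  have h := (tendsto_one_div_atTop_nhds_zero_nat (𝕜 := ℝ)).const_mul (4 / π ^ 2)
  rwa [mul_zero] at h

end

/-! ### The tests on a cell of the design -/

theorem card_focal {L r m j : ℕ} (hj : 1 ≤ j) : (focal L r m j).card = r * L - m := by
  obtain ⟨i, rfl⟩ : ∃ i, j = i + 1 := ⟨j - 1, by omega⟩
  rw [focal, Nat.card_Icc, Nat.add_sub_cancel, add_mul, one_mul]
  omega

/-- The periods that influence the focal outcomes of a usable section carry its label. -/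
theorem path_eq_of_focal {L r m j t l : ℕ} {w : ℕ → Bool} {b : Bool} (hL : 0 < L) (hl : l ≤ m)
    (ht : t ∈ focal L r m j) (hw : w ∈ allEq r j b) : path L w (t - l) = ind b := by
  rw [focal, Finset.mem_Icc] at ht
  rw [path, if_neg (by omega), hw]
  rw [sectionBlocks, Finset.mem_Icc]
  constructor
  · rw [Nat.add_le_add_iff_right, Nat.le_div_iff_mul_le hL, mul_assoc]
    omega
  · rw [Nat.add_one_le_iff, Nat.div_lt_iff_lt_mul hL, mul_assoc]
    omega

/-- The first `m ≥ m₀` periods of the section absorb the carryover, so all lagged treatments in a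
focal outcome equal the section's label and the coefficients add up to `tauTot`. -/
theorem focalMean_eq_shift {L r m m₀ J : ℕ} (hm : m < r * L) (hm₀ : m₀ ≤ m) (μ : ℝ) (β : ℕ → ℝ)
    {S A : Finset ℕ} (hS : S ⊆ Finset.Icc 1 J) {w : ℕ → Bool} (hw : w ∈ cell r J S A)
    (e : ℤ → ℝ) {j : ℕ} (hj : j ∈ S) :
    focalMean L r m m₀ μ β w e j
      = shift (fun j => μ + errMean L r m e j) (tauTot m₀ β) A j := by
  have hL : 0 < L := Nat.pos_of_ne_zero fun h => by simp [h] at hm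
  have hr : 1 ≤ r := Nat.one_le_iff_ne_zero.2 fun h => by simp [h] at hm
  have hj1 := (Finset.mem_Icc.1 (hS hj)).1
  have hn : ((r * L - m : ℕ) : ℝ) ≠ 0 := by
    have : r * L - m ≠ 0 := by omega
    exact_mod_cast this
  have hall : w ∈ allEq r j (lab A j) := by
    rw [← hw.2 j hj]
    have hj' : j ∈ usable r J w := by rw [hw.1]; exact hj
    exact mem_allEq_label hr hj1 (mem_usable.1 hj').2
  have ht : ∀ t ∈ focal L r m j, outcome m₀ μ β e (path L w) t
      = (μ + tauTot m₀ β * ind (lab A j)) + e (t : ℤ) := by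
    intro t ht
    rw [outcome, tauTot, Finset.sum_mul]
    congr 2
    refine Finset.sum_congr rfl fun l hl => ?_
    rw [path_eq_of_focal hL (by have := Finset.mem_range.1 hl; omega) ht hall]
  rw [focalMean, Finset.sum_congr rfl ht, Finset.sum_add_distrib, Finset.sum_const,
    card_focal hj1, nsmul_eq_mul, add_div, mul_div_cancel_left₀ _ hn, shift, errMean]
  ring

theorem critValue_congr {p α : ℝ} {S : Finset ℕ} {y y' : ℕ → ℝ} (hy : ∀ j ∈ S, y j = y' j) :
    critValue p α S y = critValue p α S y' := by
  unfold critValue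
  congr 1
  funext t
  exact randProb_congr hy _

section

variable {L r m m₀ J : ℕ} {q μ α : ℝ} {β : ℕ → ℝ} {S A : Finset ℕ} {w : ℕ → Bool}

theorem tTot_on_cell (hm : m < r * L) (hm₀ : m₀ ≤ m) (hS : S ⊆ Finset.Icc 1 J)
    (hw : w ∈ cell r J S A) (e : ℤ → ℝ) :
    tTot L r m m₀ J q μ β w e = tStat (pooledProb r q) S
      (shift (fun j => μ + errMean L r m e j) (tauTot m₀ β) A) (lab A) := by
  rw [tTot, hw.1]
  exact tStat_congr (fun j hj => focalMean_eq_shift hm hm₀ μ β hS hw e hj) hw.2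

theorem rejects_iff (hm : m < r * L) (hm₀ : m₀ ≤ m) (hS : S ⊆ Finset.Icc 1 J)
    (hw : w ∈ cell r J S A) (e : ℤ → ℝ) :
    Rejects L r m m₀ J q μ α β w e ↔ RejCrit (pooledProb r q) α S
      (fun j => μ + errMean L r m e j) (tauTot m₀ β) A := by
  rw [Rejects, RejCrit, tTot_on_cell hm hm₀ hS hw, hw.1,
    critValue_congr fun j hj => focalMean_eq_shift hm hm₀ μ β hS hw e hj]

theorem rejectsPval_iff (hm : m < r * L) (hm₀ : m₀ ≤ m) (hS : S ⊆ Finset.Icc 1 J)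
    (hw : w ∈ cell r J S A) (e : ℤ → ℝ) :
    RejectsPval L r m m₀ J q μ α β w e ↔ RejPval (pooledProb r q) α S
      (fun j => μ + errMean L r m e j) (tauTot m₀ β) A := by
  rw [RejectsPval, RejPval, tTot_on_cell hm hm₀ hS hw, hw.1,
    randProb_congr fun j hj => focalMean_eq_shift hm hm₀ μ β hS hw e hj]

end

/-! ### Measurability -/

theorem measurable_tStat_shift (p μ τ : ℝ) (L r m : ℕ) (S A : Finset ℕ) (z : ℕ → Bool) :
    Measurable fun e : ℤ → ℝ =>
      tStat p S (shift (fun j => μ + errMean L r m e j) τ A) z := by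
  simp only [tStat_eq, htSum, htSqSum, shift, errMean]
  fun_prop

theorem measurableSet_rejPval (p α μ τ : ℝ) (L r m : ℕ) (S A : Finset ℕ) :
    MeasurableSet {e : ℤ → ℝ | RejPval p α S (fun j => μ + errMean L r m e j) τ A} := by
  have hT := measurable_tStat_shift p μ τ L r m S A
  refine measurableSet_le (Finset.measurable_sum _ fun B _ => Measurable.const_mul ?_ _)
    measurable_const
  exact Measurable.ite (measurableSet_le (hT _) (hT _)) measurable_const measurable_const

/-- `critValue_le_iff` removes the infimum, leaving a comparison with a finite sum of indicators. -/
theorem measurableSet_rejCrit {p α : ℝ} (hp0 : 0 < p) (hp1 : p < 1) (hα0 : 0 < α) (hα1 : α < 1)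
    (μ τ : ℝ) (L r m : ℕ) (S A : Finset ℕ) :
    MeasurableSet {e : ℤ → ℝ | RejCrit p α S (fun j => μ + errMean L r m e j) τ A} := by
  have hT := measurable_tStat_shift p μ τ L r m S A
  simp only [RejCrit, critValue_le_iff hp0 hp1 hα0 hα1]
  refine measurableSet_le measurable_const
    (Finset.measurable_sum _ fun B _ => Measurable.const_mul ?_ _)
  exact Measurable.ite (measurableSet_le (hT _) (hT _)) measurable_const measurable_const

/-! ### Averaging over the errors -/

/-- Exchange the finite average over `A` with the integral over `ω`, and bound the inner probability
by `c` off `B` and by `1` on `B`. `B` need not be measurable; its measurable hull has the same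
measure. -/
theorem bexp_measureReal_le {Ω : Type*} [MeasurableSpace Ω] {P : Measure Ω}
    [IsProbabilityMeasure P] {p : ℝ} (hp0 : 0 ≤ p) (hp1 : p ≤ 1) {S : Finset ℕ}
    {E : Finset ℕ → Set Ω} (hE : ∀ A, MeasurableSet (E A)) {B : Set Ω} {c : ℝ} (hc : 0 ≤ c)
    (h : ∀ ω ∉ B, bprob p S (fun A => ω ∈ E A) ≤ c) :
    bexp p S (fun A => P.real (E A)) ≤ c + P.real B := by
  classical
  set D := toMeasurable P B with hD
  have hDm : MeasurableSet D := measurableSet_toMeasurable P B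
  have hi : ∀ F : Set Ω, MeasurableSet F → Integrable (F.indicator fun _ => (1 : ℝ)) P :=
    fun F hF => (integrable_const 1).indicator hF
  have h1 : bexp p S (fun A => P.real (E A))
      = ∫ ω, bexp p S (fun A => (E A).indicator (fun _ => (1 : ℝ)) ω) ∂P := by
    unfold bexp
    rw [integral_finsetSum _ fun A _ => (hi _ (hE A)).const_mul _]
    refine Finset.sum_congr rfl fun A _ => ?_
    rw [integral_const_mul, integral_indicator_const _ (hE A), smul_eq_mul, mul_one]
  have h2 : ∫ ω, (c + D.indicator (fun _ => (1 : ℝ)) ω) ∂P = c + P.real B := by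
    rw [integral_add (integrable_const c) (hi D hDm), integral_indicator_const _ hDm]
    simp [Measure.real, hD, measure_toMeasurable]
  rw [h1, ← h2]
  refine integral_mono (integrable_finsetSum _ fun A _ => (hi _ (hE A)).const_mul _)
    ((integrable_const c).add (hi D hDm)) fun ω => ?_
  have h3 : bexp p S (fun A => (E A).indicator (fun _ => (1 : ℝ)) ω)
      = bprob p S (fun A => ω ∈ E A) := bexp_congr fun A _ => by simp [Set.indicator_apply]
  simp only [h3]
  by_cases hω : ω ∈ D
  · rw [Set.indicator_of_mem hω]
    have := bprob_le_one hp0 hp1 S (fun A => ω ∈ E A)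
    linarith
  · rw [Set.indicator_of_notMem hω, add_zero]
    exact h ω fun hB => hω (subset_toMeasurable P B hB)

theorem le_bexp_measureReal {Ω : Type*} [MeasurableSpace Ω] {P : Measure Ω}
    [IsProbabilityMeasure P] {p : ℝ} (hp0 : 0 ≤ p) (hp1 : p ≤ 1) {S : Finset ℕ}
    {E : Finset ℕ → Set Ω} (hE : ∀ A, MeasurableSet (E A)) {B : Set Ω} {c : ℝ} (hc : c ≤ 1)
    (h : ∀ ω ∉ B, c ≤ bprob p S (fun A => ω ∈ E A)) :
    c - P.real B ≤ bexp p S (fun A => P.real (E A)) := by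
  have h1 := bexp_measureReal_le (P := P) hp0 hp1 (S := S) (E := fun A => (E A)ᶜ)
    (fun A => (hE A).compl) (B := B) (c := 1 - c) (by linarith) fun ω hω => by
      have := h ω hω
      have h2 := bprob_not p S (fun A => ω ∈ E A)
      simp only [Set.mem_compl_iff]
      linarith
  have h3 : bexp p S (fun A => P.real (E A)ᶜ) = 1 - bexp p S (fun A => P.real (E A)) := by
    rw [← bexp_const p S 1, ← bexp_sub]
    exact bexp_congr fun A _ => probReal_compl_eq_one_sub (hE A)
  linarith

/-! ### Conditional power -/

theorem IsDesign.measurableSet_numUsable {Ω : Type*} [MeasurableSpace Ω] {P : Measure Ω} {q : ℝ}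
    {W : ℕ → Ω → Bool} (hW : IsDesign P q W) {r : ℕ} (hr : 1 ≤ r) (J k : ℕ) :
    MeasurableSet {ω | numUsable r J (fun i => W i ω) = k} := by
  have : {ω | numUsable r J (fun i => W i ω) = k}
      = ⋃ S ∈ ((Finset.Icc 1 J).powerset.filter fun S => S.card = k), ⋃ A ∈ S.powerset,
          (fun ω i => W i ω) ⁻¹' cell r J S A := by
    ext ω
    simp only [Set.mem_ofPred_eq, Set.mem_iUnion, Set.mem_preimage, exists_prop,
      Finset.mem_filter, Finset.mem_powerset]
    constructor
    · intro h
      exact ⟨_, ⟨usable_subset _ _ _, h⟩, _, Finset.filter_subset _ _, mem_cell_labels _ _ _⟩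
    · rintro ⟨S, ⟨_, h⟩, A, _, hc⟩
      rw [numUsable, hc.1, h]
  rw [this]
  refine Finset.measurableSet_biUnion _ fun S hS => Finset.measurableSet_biUnion _ fun A hA =>
    hW.measurable_path (measurableSet_cell hr ?_ (Finset.mem_powerset.1 hA))
  exact Finset.mem_powerset.1 (Finset.mem_filter.1 hS).1

section

variable {Ω : Type*} [MeasurableSpace Ω] {P : Measure Ω} [IsProbabilityMeasure P]
  {q μ α ρ σu : ℝ} {W : ℕ → Ω → Bool} {u ε : ℤ → Ω → ℝ} {L r m m₀ : ℕ}

/-- A bound on the power given the usable sections bounds the power given their number. -/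
theorem abs_condPower_sub_le (hW : IsDesign P q W) (hq0 : 0 < q) (hq1 : q < 1)
    (hε : ∀ t, Measurable (ε t)) (hWε : IndepFun (fun ω k => W k ω) (fun ω t => ε t ω) P)
    (hr : 1 ≤ r) {J k : ℕ} {R : (ℕ → Bool) → (ℤ → ℝ) → Prop}
    {G : Finset ℕ → Finset ℕ → Set (ℤ → ℝ)} (hG : ∀ S A, MeasurableSet (G S A))
    (hR : ∀ S ⊆ Finset.Icc 1 J, ∀ A ⊆ S, ∀ w ∈ cell r J S A, ∀ e, R w e ↔ e ∈ G S A)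
    (hk : P {ω | numUsable r J (fun i => W i ω) = k} ≠ 0) {c δ : ℝ}
    (hb : ∀ S ⊆ Finset.Icc 1 J, S.card = k →
      |bexp (pooledProb r q) S (fun A => P.real {ω | (fun t => ε t ω) ∈ G S A}) - c| ≤ δ) :
    |condPower P W ε r J k R - c| ≤ δ := by
  classical
  have hπ0 := usableProb_pos hq0 hq1 r
  have hπ1 := usableProb_le_one hq0 hq1 hr
  have hnum := hW.measureReal_usable_inter hq0 hq1 hε hWε hr J (fun S => S.card = k) hG hR
  have hden := hW.measureReal_usable hq0 hq1 hr J (fun S => S.card = k)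
  have hpos : 0 < P.real {ω | numUsable r J (fun i => W i ω) = k} :=
    ENNReal.toReal_pos hk (measure_ne_top _ _)
  have hcond : condPower P W ε r J k R
      = P.real {ω | (usable r J fun i => W i ω).card = k ∧ R (fun i => W i ω) (fun t => ε t ω)}
        / P.real {ω | numUsable r J (fun i => W i ω) = k} := by
    rw [condPower, Measure.real, cond_apply (hW.measurableSet_numUsable hr J k),
      ENNReal.toReal_mul, ENNReal.toReal_inv, inv_mul_eq_div]
    rfl
  have h1 : P.real {ω | numUsable r J (fun i => W i ω) = k}
      = bprob (usableProb r q) (Finset.Icc 1 J) (fun S => S.card = k) := hden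
  -- After clearing the denominator, both bounds compare Bernoulli averages over `S` and hold term
  -- by term.
  rw [hcond, abs_le, sub_eq_add_neg, ← sub_eq_add_neg, le_sub_iff_add_le, sub_le_iff_le_add,
    le_div_iff₀ hpos, div_le_iff₀ hpos, hnum, h1, bprob, ← bexp_mul_left, ← bexp_mul_left]
  constructor
  · refine bexp_mono hπ0.le hπ1 fun S hS => ?_
    split_ifs with hc
    · have := (abs_le.1 (hb S hS hc)).1
      linarith
    · simp
  · refine bexp_mono hπ0.le hπ1 fun S hS => ?_
    split_ifs with hc
    · have := (abs_le.1 (hb S hS hc)).2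
      linarith
    · simp

/-- Power of both forms of the test given the number of usable sections. -/
theorem condPower_sub_powerApprox (hW : IsDesign P q W) (hq0 : 0 < q) (hq1 : q < 1)
    (hε : IsStationaryAR1 P ρ σu u ε) (hρ : |ρ| < 1) (hσu : 0 < σu)
    (hWε : IndepFun (fun ω k => W k ω) (fun ω t => ε t ω) P)
    (hm : m < r * L) (hm₀ : m₀ ≤ m) (hα0 : 0 < α) (hα1 : α < 1) {δ : ℝ} (hδ : 0 < δ) :
    ∃ K : ℕ, ∀ (J k : ℕ) (β : ℕ → ℝ), K ≤ k →
      P {ω | numUsable r J (fun i => W i ω) = k} ≠ 0 →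
      |condPower P W ε r J k (Rejects L r m m₀ J q μ α β)
          - powerApprox (ar1MeanVar σu ρ (r * L - m)) (pooledProb r q) μ (tauTot m₀ β) α k| ≤ δ ∧
      |condPower P W ε r J k (RejectsPval L r m m₀ J q μ α β)
          - powerApprox (ar1MeanVar σu ρ (r * L - m)) (pooledProb r q) μ (tauTot m₀ β) α k|
        ≤ δ := by
  have hr : 1 ≤ r := Nat.one_le_iff_ne_zero.2 fun h => by simp [h] at hm
  have hp0 := pooledProb_pos hq0 hq1 r
  have hp1 := pooledProb_lt_one hq0 hq1 r
  have hs := hε.ar1MeanVar_pos hρ hσu (by omega : 0 < r * L - m)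
  set s := ar1MeanVar σu ρ (r * L - m)
  set p := pooledProb r q
  -- Half of `δ` pays for the approximation at balanced errors, the other half for the probability
  -- that the errors are not balanced.
  obtain ⟨κ, hκ, K₁, hK₁⟩ := power_balanced hs hp0 hp1 hα0 hα1 μ (half_pos hδ)
  obtain ⟨K₂, hK₂⟩ := hε.errMean_balanced hρ hm μ hκ (half_pos hδ)
  have hεm : Measurable (fun ω t => ε t ω) := measurable_pi_lambda _ hε.measurable
  refine ⟨max K₁ K₂, fun J k β hk hP => ?_⟩
  set τ := tauTot m₀ β
  have hGc := measurableSet_rejCrit hp0 hp1 hα0 hα1 μ τ L r m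
  have hGp := measurableSet_rejPval p α μ τ L r m
  -- One chain of inequalities, with the `p`-value form below the critical value form, serves both
  -- tests.
  have hbound : ∀ S ⊆ Finset.Icc 1 J, S.card = k →
      powerApprox s p μ τ α k - δ ≤ bexp p S (fun A => P.real {ω | (fun t => ε t ω) ∈
        {e | RejPval p α S (fun j => μ + errMean L r m e j) τ A}}) ∧
      bexp p S (fun A => P.real {ω | (fun t => ε t ω) ∈
        {e | RejPval p α S (fun j => μ + errMean L r m e j) τ A}}) ≤
      bexp p S (fun A => P.real {ω | (fun t => ε t ω) ∈
        {e | RejCrit p α S (fun j => μ + errMean L r m e j) τ A}}) ∧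
      bexp p S (fun A => P.real {ω | (fun t => ε t ω) ∈
        {e | RejCrit p α S (fun j => μ + errMean L r m e j) τ A}})
        ≤ powerApprox s p μ τ α k + δ := by
    rintro S hS rfl
    have hbad := hK₂ S (fun j hj => (Finset.mem_Icc.1 (hS hj)).1) ((le_max_right _ _).trans hk)
    have hgood := fun x => hK₁ S x τ ((le_max_left _ _).trans hk)
    have h0 := powerApprox_nonneg s p μ τ α S.card
    have h1 := powerApprox_le_one s p μ τ α S.card
    refine ⟨?_, ?_, ?_⟩
    · have := le_bexp_measureReal (P := P) hp0.le hp1.le (S := S)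
        (fun A => hεm (hGp S A)) (B := {ω | ¬ Balanced (s + μ ^ 2) κ S
          (fun j => μ + errMean L r m (fun t => ε t ω) j)})
        (c := powerApprox s p μ τ α S.card - δ / 2) (by linarith)
        fun ω hω => (hgood _ (not_not.1 hω)).1
      refine le_trans ?_ this
      linarith
    · refine bexp_mono hp0.le hp1.le fun A _ => measureReal_mono fun ω hω => ?_
      exact RejPval.rejCrit hp0 hp1 hα0 hα1 hω
    · have := bexp_measureReal_le (P := P) hp0.le hp1.le (S := S)
        (fun A => hεm (hGc S A)) (B := {ω | ¬ Balanced (s + μ ^ 2) κ S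
          (fun j => μ + errMean L r m (fun t => ε t ω) j)})
        (c := powerApprox s p μ τ α S.card + δ / 2) (by linarith)
        fun ω hω => (hgood _ (not_not.1 hω)).2
      refine le_trans this ?_
      linarith
  constructor
  · refine abs_condPower_sub_le hW hq0 hq1 hε.measurable hWε hr hGc
      (fun S hS A _ w hw e => rejects_iff hm hm₀ hS hw e) hP fun S hS hc => ?_
    obtain ⟨h1, h2, h3⟩ := hbound S hS hc
    rw [abs_le]
    constructor
    · exact le_sub_iff_add_le.2 (le_trans (by linarith) (h1.trans h2))
    · exact sub_le_iff_le_add'.2 h3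
  · refine abs_condPower_sub_le hW hq0 hq1 hε.measurable hWε hr hGp
      (fun S hS A _ w hw e => rejectsPval_iff hm hm₀ hS hw e) hP fun S hS hc => ?_
    obtain ⟨h1, h2, h3⟩ := hbound S hS hc
    rw [abs_le]
    constructor
    · exact le_sub_iff_add_le.2 (le_trans (by linarith) h1)
    · exact sub_le_iff_le_add'.2 (h2.trans h3)

/-- A sequence of functions of the number of usable sections that is small for large values of
positive probability tends to zero in probability. -/
theorem tendstoInMeasure_numUsable (hW : IsDesign P q W) (hq0 : 0 < q) (hq1 : q < 1) (hr : 1 ≤ r)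
    (d : ℕ → ℕ → ℝ) (h : ∀ δ > 0, ∃ K : ℕ, ∀ J k : ℕ, K ≤ k →
      P {ω | numUsable r J (fun i => W i ω) = k} ≠ 0 → |d J k| ≤ δ) :
    TendstoInMeasure P (fun J ω => d J (numUsable r J (fun i => W i ω))) atTop
      (fun _ => (0 : ℝ)) := by
  rw [tendstoInMeasure_iff_dist]
  intro η hη
  obtain ⟨K, hK⟩ := h (η / 2) (half_pos hη)
  have hlim : Tendsto (fun J => P {ω | numUsable r J (fun i => W i ω) < K}) atTop (𝓝 0) := by
    rw [← ENNReal.tendsto_toReal_iff (fun _ => measure_ne_top _ _) ENNReal.zero_ne_top]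
    exact hW.tendsto_numUsable_lt hq0 hq1 hr K
  refine tendsto_of_tendsto_of_tendsto_of_le_of_le tendsto_const_nhds hlim (fun _ => zero_le)
    fun J => ?_
  refine measure_mono_ae ?_
  -- Values `k` of probability zero, for which the hypothesis on `d` says nothing, are almost surely
  -- not attained. So almost surely a deviation of size `η` forces fewer than `K` usable sections.
  have hae : ∀ᵐ ω ∂P, P {ω' | numUsable r J (fun i => W i ω')
      = numUsable r J (fun i => W i ω)} ≠ 0 := by
    have hk : ∀ k : ℕ, ∀ᵐ ω ∂P, numUsable r J (fun i => W i ω) = k →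
        P {ω' | numUsable r J (fun i => W i ω') = k} ≠ 0 := by
      intro k
      by_cases h0 : P {ω' | numUsable r J (fun i => W i ω') = k} = 0
      · have : ∀ᵐ ω ∂P, ¬ numUsable r J (fun i => W i ω) = k := by
          rw [ae_iff]; simpa using h0
        filter_upwards [this] with ω hω h using absurd h hω
      · exact ae_of_all _ fun _ _ => h0
    filter_upwards [ae_all_iff.2 hk] with ω hω using hω _ rfl
  filter_upwards [hae] with ω hω hd
  change numUsable r J (fun i => W i ω) < K
  by_contra hcon
  have h1 := hK J _ (not_lt.1 hcon) hω
  have h2 : η ≤ dist (d J (numUsable r J fun i => W i ω)) 0 := hd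
  rw [dist_zero_right, Real.norm_eq_abs] at h2
  linarith

end

end Switchback

/-! ### Assembling the main theorem -/

theorem proposition2 {Ω : Type*} [MeasurableSpace Ω] (P : Measure Ω) [IsProbabilityMeasure P]
    (L r m m₀ : ℕ) (hm : m < r * L) (hm₀ : m₀ ≤ m)
    (q : ℝ) (hq0 : 0 < q) (hq1 : q < 1)
    (μ ρ σu α : ℝ) (hρ : |ρ| < 1) (hσu : 0 < σu) (hα0 : 0 < α) (hα1 : α < 1)
    (W : ℕ → Ω → Bool) (hW : Switchback.IsDesign P q W)
    (u ε : ℤ → Ω → ℝ) (hε : Switchback.IsStationaryAR1 P ρ σu u ε)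
    (hWε : IndepFun (fun ω k => W k ω) (fun ω t => ε t ω) P)
    (p : ℝ) (hp : p = Switchback.pooledProb r q)
    (n : ℕ) (hn : n = r * L - m)
    (s : ℝ) (hs : s = Switchback.ar1MeanVar σu ρ n) :
    -- `s` is the variance of the mean of `n` consecutive errors
    Var[fun ω => (∑ i ∈ Finset.Icc 1 n, ε (i : ℤ) ω) / (n : ℝ); P] = s ∧
    -- power given `J_tot = k`, as `k → ∞`, uniformly in the lag coefficients and in `J`
    (∀ δ > 0, ∃ K : ℕ, ∀ (J k : ℕ) (β : ℕ → ℝ), K ≤ k →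
      P {ω | Switchback.numUsable r J (fun i => W i ω) = k} ≠ 0 →
      |Switchback.condPower P W ε r J k (Switchback.Rejects L r m m₀ J q μ α β)
          - Switchback.powerApprox s p μ (Switchback.tauTot m₀ β) α k| ≤ δ ∧
      |Switchback.condPower P W ε r J k (Switchback.RejectsPval L r m m₀ J q μ α β)
          - Switchback.powerApprox s p μ (Switchback.tauTot m₀ β) α k| ≤ δ) ∧
    -- power given the random number `J_tot`, as `J → ∞`, along any sequence of lag coefficients
    (∀ β : ℕ → ℕ → ℝ,
      TendstoInMeasure P (fun J ω =>
        Switchback.condPower P W ε r J (Switchback.numUsable r J (fun i => W i ω))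
            (Switchback.Rejects L r m m₀ J q μ α (β J))
          - Switchback.powerApprox s p μ (Switchback.tauTot m₀ (β J)) α
              (Switchback.numUsable r J (fun i => W i ω))) atTop (fun _ => (0 : ℝ)) ∧
      TendstoInMeasure P (fun J ω =>
        Switchback.condPower P W ε r J (Switchback.numUsable r J (fun i => W i ω))
            (Switchback.RejectsPval L r m m₀ J q μ α (β J))
          - Switchback.powerApprox s p μ (Switchback.tauTot m₀ (β J)) α
              (Switchback.numUsable r J (fun i => W i ω))) atTop (fun _ => (0 : ℝ))) ∧
    -- the limiting variance
    (∀ τ : ℝ, 0 < Switchback.sigmaTotSq s p μ τ ∧ Switchback.sigmaTotSq s p μ τ ≤ 1) ∧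
    Tendsto (fun τ : ℝ => Switchback.sigmaTotSq s p μ τ) (𝓝 0) (𝓝 1) := by
  subst hp hn hs
  have hr : 1 ≤ r := Nat.one_le_iff_ne_zero.2 fun h => by simp [h] at hm
  have hp0 := Switchback.pooledProb_pos hq0 hq1 r
  have hp1 := Switchback.pooledProb_lt_one hq0 hq1 r
  have hs := hε.ar1MeanVar_pos hρ hσu (by omega : 0 < r * L - m)
  have hpow := fun δ (hδ : 0 < δ) => Switchback.condPower_sub_powerApprox (μ := μ) hW hq0 hq1 hε
    hρ hσu hWε hm hm₀ hα0 hα1 hδ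
  refine ⟨?_, hpow, fun β => ⟨?_, ?_⟩, fun τ => ?_, Switchback.tendsto_sigmaTotSq hs hp0 hp1 μ⟩
  -- The mean over the periods `1, …, n` is the mean of `n` consecutive errors started at `1`; only
  -- the summation index is shifted.
  · rw [← hε.variance_mean hρ 1]
    congr 1
    funext ω
    congr 1
    rw [Finset.sum_bij (fun i _ => i - 1) (t := Finset.range (r * L - m))
      (g := fun i => ε (1 + (i : ℤ)) ω)]
    · exact fun i hi => by rw [Finset.mem_Icc] at hi; rw [Finset.mem_range]; omega
    · exact fun i hi j hj hij => by rw [Finset.mem_Icc] at hi hj; omega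
    · exact fun i hi => ⟨i + 1, by rw [Finset.mem_range] at hi; rw [Finset.mem_Icc]; omega, by simp⟩
    · exact fun i hi => by
        rw [Finset.mem_Icc] at hi
        congr 1
        omega
  · exact Switchback.tendstoInMeasure_numUsable hW hq0 hq1 hr
      (fun J k => Switchback.condPower P W ε r J k
      (Switchback.Rejects L r m m₀ J q μ α (β J)) - Switchback.powerApprox _ _ μ
        (Switchback.tauTot m₀ (β J)) α k) fun δ hδ => by
      obtain ⟨K, hK⟩ := hpow δ hδ
      exact ⟨K, fun J k hk hP => (hK J k (β J) hk hP).1⟩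
  · exact Switchback.tendstoInMeasure_numUsable hW hq0 hq1 hr
      (fun J k => Switchback.condPower P W ε r J k
      (Switchback.RejectsPval L r m m₀ J q μ α (β J)) - Switchback.powerApprox _ _ μ
        (Switchback.tauTot m₀ (β J)) α k) fun δ hδ => by
      obtain ⟨K, hK⟩ := hpow δ hδ
      exact ⟨K, fun J k hk hP => (hK J k (β J) hk hP).2⟩
  · exact ⟨Switchback.sigmaTotSq_pos hs hp0 hp1 μ τ, Switchback.sigmaTotSq_le_one hs hp0 hp1 μ τ⟩
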